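/- Let $(M,g)$ be a complete smooth Riemannian manifold of dimension $n$ without boundary (for instance a compact one) with nonpositive sectional curvature, and let $SM$ be its unit sphere bundle. For every $v\in S_pM$ there is a unique geodesic $\gamma:\mathbb R\to M$ with $\gamma'(0)=v$. Let $N_p\gamma=v^\perp\subset T_pM$. Then the following hold. 1. For every $v \in S_pM$ and $X\in N_p\gamma$ there is a unique (smooth) Jacobi field $J_X$ along $\gamma$ with $J_X(0)=X$ and $|J_X(r)|=O(1)$ for $r\ge 0$. Put $$\mathrm{II}_{H(v)}(X,X)=\Big\langle -\tfrac{D}{dr}J_X(0),X\Big\rangle v,$$ $$\mathrm{II}_{H(v)}(X,Y)=\tfrac12\big(\mathrm{II}_{H(v)}(X+Y,X+Y)-\mathrm{II}_{H(v)}(X,X)-\mathrm{II}_{H(v)}(Y,Y)\big).$$ Then $\mathrm{II}_{H(v)}$ is a well-defined symmetric bilinear map $N_p\gamma\times N_p\gamma\to T_pM$ (and the second formula with $Y=X$ agrees with the first). 2. $\langle \mathrm{II}_{H(v)}(X,X),v\rangle\ge 0$ for all $v\in S_pM$ and $X\in N_p\gamma$. 3. $\mathrm{II}_{H(v)}$ is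 continuous in $v$: if $U\subset SM$ is open and $v\mapsto X(v)$, $v\mapsto Y(v)$ are continuous maps $U\to TM$ such that $X(v)$, $Y(v)$ have the same root as $v$ and are perpendicular to $v$, then $v\mapsto\langle \mathrm{II}_{H(v)}(X(v),Y(v)),v\rangle$ is continuous on $U$. -/

import Mathlib

open Bundle Manifold Topology
open scoped ContDiff RealInnerProductSpace

noncomputable section

namespace Horosphere

/-! ### Levi-Civita connection and curvature in charts -/

section Charts

variable {n : ℕ} {M : Type*} [TopologicalSpace M] [ChartedSpace (EuclideanSpace ℝ (Fin n)) M]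
  [IsManifold (𝓡 n) ∞ M]

/-- Components of a tangent vector at `p` with respect to the coordinate vector fields of the
preferred chart around `c` (for `p` in the domain of that chart). -/
def coords (c p : M) : TangentSpace (𝓡 n) p →L[ℝ] EuclideanSpace ℝ (Fin n) :=
  (trivializationAt (EuclideanSpace ℝ (Fin n)) (fun x : M => TangentSpace (𝓡 n) x)
    c).continuousLinearMapAt ℝ p

/-- The tangent vector at `p` with given components with respect to the coordinate vector fields of
the preferred chart around `c` (for `p` in the domain of that chart). -/
def ofCoords (c p : M) : EuclideanSpace ℝ (Fin n) →L[ℝ] TangentSpace (𝓡 n) p :=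
  (trivializationAt (EuclideanSpace ℝ (Fin n)) (fun x : M => TangentSpace (𝓡 n) x)
    c).symmL ℝ p

variable [RiemannianBundle (fun x : M => TangentSpace (𝓡 n) x)]

/-- The matrix `g_{ij}` of the metric in the preferred chart around `c`, at the point with
coordinates `y`. -/
def gram (c : M) (y : EuclideanSpace ℝ (Fin n)) : Matrix (Fin n) (Fin n) ℝ :=
  Matrix.of fun i j =>
    ⟪ofCoords c ((extChartAt (𝓡 n) c).symm y) (EuclideanSpace.single i (1 : ℝ)),
      ofCoords c ((extChartAt (𝓡 n) c).symm y) (EuclideanSpace.single j (1 : ℝ))⟫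

/-- The partial derivative `∂_k g_{ij}` in the preferred chart around `c`. -/
def dgram (c : M) (y : EuclideanSpace ℝ (Fin n)) (k i j : Fin n) : ℝ :=
  fderiv ℝ (fun z => gram c z i j) y (EuclideanSpace.single k (1 : ℝ))

/-- The Christoffel symbols of the Levi-Civita connection,
`Γ^k_{ij} = ½ ∑_l g^{kl} (∂_i g_{jl} + ∂_j g_{il} - ∂_l g_{ij})`. -/
def christoffelSymbol (c : M) (y : EuclideanSpace ℝ (Fin n)) (k i j : Fin n) : ℝ :=
  (1 / 2) * ∑ l, (gram c y)⁻¹ k l * (dgram c y i j l + dgram c y j i l - dgram c y l i j)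

/-- `Γ(u, w) = ∑_{i,j,k} Γ^k_{ij} u^i w^j e_k`. -/
def christoffel (c : M) (y u w : EuclideanSpace ℝ (Fin n)) : EuclideanSpace ℝ (Fin n) :=
  WithLp.toLp 2 fun k => ∑ i, ∑ j, christoffelSymbol c y k i j * u i * w j

/-- The curvature tensor `R(u, v)w = ∇_u ∇_v w - ∇_v ∇_u w - ∇_{[u, v]} w` in the preferred chart
around `c`; here `u`, `v`, `w` are constant combinations of the coordinate vector fields. -/
def chartCurvature (c : M) (y u v w : EuclideanSpace ℝ (Fin n)) : EuclideanSpace ℝ (Fin n) :=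
  fderiv ℝ (fun z => christoffel c z v w) y u - fderiv ℝ (fun z => christoffel c z u w) y v
    + christoffel c y u (christoffel c y v w) - christoffel c y v (christoffel c y u w)

/-- The curvature tensor `R(u, v)w` at `p`, computed in the preferred chart around `p`. -/
def curvature (p : M) (u v w : TangentSpace (𝓡 n) p) : TangentSpace (𝓡 n) p :=
  ofCoords p p (chartCurvature p (extChartAt (𝓡 n) p p) (coords p p u) (coords p p v)
    (coords p p w))

/-- The sectional curvature of the plane spanned by the linearly independent vectors `u`, `v`. -/
def sectionalCurvature (p : M) (u v : TangentSpace (𝓡 n) p) : ℝ :=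
  ⟪curvature p u v v, u⟫ / (‖u‖ ^ 2 * ‖v‖ ^ 2 - ⟪u, v⟫ ^ 2)

variable (n M) in
/-- All sectional curvatures are nonpositive. -/
def NonposSectionalCurvature : Prop :=
  ∀ (p : M) (u v : TangentSpace (𝓡 n) p),
    LinearIndependent ℝ ![u, v] → sectionalCurvature p u v ≤ 0

/-! ### Geodesics and Jacobi fields -/

/-- The velocity `γ'(t)`. -/
def velocity (γ : ℝ → M) (t : ℝ) : TangentSpace (𝓡 n) (γ t) :=
  mfderiv 𝓘(ℝ, ℝ) (𝓡 n) γ t (1 : ℝ)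

/-- The covariant derivative `D/dt V` of a vector field `V` along `γ`: in coordinates it is
`dV/dt + Γ(γ', V)`, evaluated at time `t` in the preferred chart around `γ t`. -/
def covDeriv (γ : ℝ → M) (V : ∀ t, TangentSpace (𝓡 n) (γ t)) (t : ℝ) :
    TangentSpace (𝓡 n) (γ t) :=
  ofCoords (γ t) (γ t)
    (deriv (fun s => coords (γ t) (γ s) (V s)) t
      + christoffel (γ t) (extChartAt (𝓡 n) (γ t) (γ t))
          (coords (γ t) (γ t) (velocity γ t)) (coords (γ t) (γ t) (V t)))

/-- Geodesics, defined on all of `ℝ`. -/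
def IsGeodesic (γ : ℝ → M) : Prop :=
  ContMDiff 𝓘(ℝ, ℝ) (𝓡 n) ∞ γ ∧ ∀ t, covDeriv γ (velocity (n := n) γ) t = 0

/-- `γ` is a geodesic with `γ'(0) = v`. -/
def IsGeodesicFrom (v : TangentBundle (𝓡 n) M) (γ : ℝ → M) : Prop :=
  IsGeodesic (n := n) γ ∧ (⟨γ 0, velocity γ 0⟩ : TangentBundle (𝓡 n) M) = v

/-- Jacobi fields along `γ`: smooth vector fields with `D²J/dt² + R(J, γ')γ' = 0`. -/
def IsJacobiField (γ : ℝ → M) (J : ∀ t, TangentSpace (𝓡 n) (γ t)) : Prop :=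
  ContMDiff 𝓘(ℝ, ℝ) (𝓡 n).tangent ∞ (fun t => (⟨γ t, J t⟩ : TangentBundle (𝓡 n) M)) ∧
    ∀ t, covDeriv γ (covDeriv γ J) t + curvature (γ t) (J t) (velocity γ t) (velocity γ t) = 0

/-- `J` is a Jacobi field along `γ` with `J(0) = X` and `|J(r)| = O(1)` for `r ≥ 0`. -/
def IsBoundedJacobiField (γ : ℝ → M) {p : M} (X : TangentSpace (𝓡 n) p)
    (J : ∀ t, TangentSpace (𝓡 n) (γ t)) : Prop :=
  IsJacobiField γ J ∧ (⟨γ 0, J 0⟩ : TangentBundle (𝓡 n) M) = ⟨p, X⟩ ∧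
    ∃ C : ℝ, ∀ r : ℝ, 0 ≤ r → ‖J r‖ ≤ C

/-! ### The horosphere form -/

variable (n M) in
/-- The unit sphere bundle `SM`. -/
abbrev UnitTangentBundle : Type _ := {v : TangentBundle (𝓡 n) M // ‖v.2‖ = 1}

/-- The space of vectors with the same root as `v` and perpendicular to `v`. -/
def normalSpace (v : UnitTangentBundle n M) : Submodule ℝ (TangentSpace (𝓡 n) v.1.proj) :=
  (Submodule.span ℝ {v.1.2})ᗮ

/-- "The" geodesic `γ` with `γ'(0) = v`. -/
def geodesicFrom (v : UnitTangentBundle n M) : ℝ → M :=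
  @Classical.epsilon (ℝ → M) ⟨fun _ => v.1.proj⟩ (IsGeodesicFrom v.1)

/-- "The" Jacobi field `J_X` along the geodesic with initial velocity `v` such that `J_X(0) = X`
and `|J_X(r)| = O(1)` for `r ≥ 0`. -/
def boundedJacobiField (v : UnitTangentBundle n M) (X : normalSpace v) :
    ∀ t, TangentSpace (𝓡 n) (geodesicFrom v t) :=
  @Classical.epsilon (∀ t, TangentSpace (𝓡 n) (geodesicFrom v t)) ⟨fun _ => 0⟩
    (IsBoundedJacobiField (geodesicFrom v) (X : TangentSpace (𝓡 n) v.1.proj))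

/-- The quadratic form `II_{H(v)}(X, X) = ⟨-(D/dr) J_X(0), X⟩ v`; the inner product is written in
the tangent space at `γ(0)`, with `X = J_X(0)`. -/
def horosphereQuad (v : UnitTangentBundle n M) (X : normalSpace v) :
    TangentSpace (𝓡 n) v.1.proj :=
  ⟪-covDeriv (geodesicFrom v) (boundedJacobiField v X) 0, boundedJacobiField v X 0⟫ • v.1.2

/-- The form `II_{H(v)}(X, Y)`, obtained from the quadratic form by polarization. -/
def horosphereForm (v : UnitTangentBundle n M) (X Y : normalSpace v) :
    TangentSpace (𝓡 n) v.1.proj :=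
  (1 / 2 : ℝ) • (horosphereQuad v (X + Y) - horosphereQuad v X - horosphereQuad v Y)

end Charts

end Horosphere

end

/-! Let `S X = J_X'(0)`, the map called `stableDeriv`. In nonpositive curvature every Jacobi field
satisfies `(|J|²)'' = 2 (|J'|² - ⟨R(J, γ')γ', J⟩) ≥ 0`, so `|J|²` is convex. If `J` is bounded for
`r ≥ 0`, this convex function is nonincreasing on all of `ℝ`. Hence `⟨S X, X⟩ ≤ 0`, which is the
asserted sign. Applied to the difference of two bounded fields with the same initial value, the same
fact makes the difference vanish for `r ≥ 0`, hence everywhere (`eq_of_bounded`). Uniqueness also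
makes `S` linear, and the polarized form is `-½ (⟨S X, Y⟩ + ⟨S Y, X⟩) v`.

Convexity also shows that a field vanishing at `0` and at `T > 0` is zero. By linear algebra there
is then a field with `J(0) = X` and `J(T) = 0`, and convexity bounds it by `|X|` on `[0, T]`.

Existence of `J_X` and continuity in `v` both follow from one compactness statement,
`exists_tendsto_of_fieldNorm_le`. Suppose that footpoints, velocities and initial values converge
and that for every `t ≥ 0` eventually `|J_i(t)| ≤ |J_i(0)|`. Then the initial derivatives converge
to that of the bounded field: if they were unbounded, dividing by their size would give in the limit
a nonzero bounded field with initial value zero, against uniqueness. The fields with `J(T) = 0`, `T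
→ ∞`, give existence; bounded fields over varying `v` give continuity.

Both uses need a continuous flow defined for all times. A geodesic with a Jacobi field is an
integral curve of a vector field on triples `(γ', J, DJ/dt)`, and the transformation laws of
Christoffel symbols and curvature make this field independent of the chart (`jacobiAtlas`).
Solutions do not leave the manifold in finite time: the speed is constant, so the footpoint is
Lipschitz and converges by completeness, and `J`, `DJ/dt` solve a linear system with bounded
coefficients (`endsConverge_jacobiAtlas`). -/

noncomputable section

namespace Horosphere

/-! ### Transformation laws of Christoffel symbols and curvature. -/

section ChangeOfCoordinates

set_option synthInstance.maxHeartbeats 80000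

variable {E : Type*} [NormedAddCommGroup E] [NormedSpace ℝ E]

/-- The directional derivatives of a metric and of its pushforward under a change of coordinates. -/
lemma fderiv_metric_of_pullback {G G' : E → E →L[ℝ] E →L[ℝ] ℝ} {τ : E → E} {y : E}
    (hG' : DifferentiableAt ℝ G' (τ y)) (hτ : ContDiffAt ℝ 2 τ y)
    (hG : DifferentiableAt ℝ G y)
    (hpull : ∀ᶠ z in 𝓝 y, ∀ u w, G' (τ z) (fderiv ℝ τ z u) (fderiv ℝ τ z w) = G z u w)
    (a u w : E) :
    fderiv ℝ G y a u w = fderiv ℝ G' (τ y) (fderiv ℝ τ y a) (fderiv ℝ τ y u) (fderiv ℝ τ y w)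
      + G' (τ y) (fderiv ℝ (fderiv ℝ τ) y a u) (fderiv ℝ τ y w)
      + G' (τ y) (fderiv ℝ τ y u) (fderiv ℝ (fderiv ℝ τ) y a w) := by
  have h1 : HasFDerivAt τ (fderiv ℝ τ y) y := (hτ.differentiableAt (by norm_num)).hasFDerivAt
  have h2 : HasFDerivAt (fderiv ℝ τ) (fderiv ℝ (fderiv ℝ τ) y) y :=
    ((hτ.fderiv_right (m := 1) (by norm_num)).differentiableAt (by norm_num)).hasFDerivAt
  have hu := h2.clm_apply (hasFDerivAt_const u y)
  have hw := h2.clm_apply (hasFDerivAt_const w y)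
  have h0 : HasFDerivAt (fun z => G' (τ z)) ((fderiv ℝ G' (τ y)).comp (fderiv ℝ τ y)) y :=
    HasFDerivAt.comp (g := G') y hG'.hasFDerivAt h1
  have h3 := (h0.clm_apply hu).clm_apply hw
  have h4 := (hG.hasFDerivAt.clm_apply (hasFDerivAt_const u y)).clm_apply (hasFDerivAt_const w y)
  have h5 := h3.congr_of_eventuallyEq (f₁ := fun z => G z u w)
    (hpull.mono fun z hz => (hz u w).symm)
  have h6 := DFunLike.congr_fun (h4.unique h5) a
  simp at h6
  linarith

/-- The transformation law of the Christoffel symbols. -/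
lemma christoffel_transform {G G' : E → E →L[ℝ] E →L[ℝ] ℝ} {Γ Γ' : E →L[ℝ] E →L[ℝ] E}
    {τ : E → E} {y : E}
    (hG' : DifferentiableAt ℝ G' (τ y)) (hτ : ContDiffAt ℝ 2 τ y)
    (hG : DifferentiableAt ℝ G y)
    (hpull : ∀ᶠ z in 𝓝 y, ∀ u w, G' (τ z) (fderiv ℝ τ z u) (fderiv ℝ τ z w) = G z u w)
    (hsymm : ∀ u w, G' (τ y) u w = G' (τ y) w u)
    (hΓ : ∀ u w z, 2 * G y (Γ u w) z
      = fderiv ℝ G y u w z + fderiv ℝ G y w u z - fderiv ℝ G y z u w)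
    (hΓ' : ∀ u w z, 2 * G' (τ y) (Γ' u w) z
      = fderiv ℝ G' (τ y) u w z + fderiv ℝ G' (τ y) w u z - fderiv ℝ G' (τ y) z u w)
    (hnd : ∀ u, (∀ z, G' (τ y) u (fderiv ℝ τ y z) = 0) → u = 0) (u w : E) :
    fderiv ℝ τ y (Γ u w) = Γ' (fderiv ℝ τ y u) (fderiv ℝ τ y w)
      + fderiv ℝ (fderiv ℝ τ) y u w := by
  have hs : ∀ a b, fderiv ℝ (fderiv ℝ τ) y a b = fderiv ℝ (fderiv ℝ τ) y b a :=
    fun a b => (hτ.isSymmSndFDerivAt (by simp)).eq a b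
  have hD := fderiv_metric_of_pullback hG' hτ hG hpull
  rw [← sub_eq_zero]
  refine hnd _ fun z => ?_
  -- Inserting the differentiated pullback identity into the Koszul formula for `G` produces six
  -- terms with second derivatives of `τ`. By symmetry four cancel, and the other two both equal
  -- `G'(D²τ(u, w), Dτ z)`.
  have e1 := hΓ u w z
  rw [← hpull.self_of_nhds, hD, hD, hD] at e1
  have e2 := hΓ' (fderiv ℝ τ y u) (fderiv ℝ τ y w) (fderiv ℝ τ y z)
  rw [hs w u, hs z u, hs z w, hsymm (fderiv ℝ τ y w), hsymm (fderiv ℝ (fderiv ℝ τ) y u z)] at e1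
  simp only [map_sub, map_add, sub_apply, add_apply]
  linarith

/-- The transformation law of the curvature tensor. -/
lemma curvature_transform {Γ Γ' : E → E →L[ℝ] E →L[ℝ] E} {τ : E → E} {y : E}
    (hΓ : DifferentiableAt ℝ Γ y) (hΓ' : DifferentiableAt ℝ Γ' (τ y)) (hτ : ContDiffAt ℝ 3 τ y)
    (h : ∀ᶠ z in 𝓝 y, ∀ u w, fderiv ℝ τ z (Γ z u w)
      = Γ' (τ z) (fderiv ℝ τ z u) (fderiv ℝ τ z w) + fderiv ℝ (fderiv ℝ τ) z u w) (u v w : E) :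
    fderiv ℝ τ y (fderiv ℝ Γ y u v w - fderiv ℝ Γ y v u w + Γ y u (Γ y v w) - Γ y v (Γ y u w))
      = fderiv ℝ Γ' (τ y) (fderiv ℝ τ y u) (fderiv ℝ τ y v) (fderiv ℝ τ y w)
        - fderiv ℝ Γ' (τ y) (fderiv ℝ τ y v) (fderiv ℝ τ y u) (fderiv ℝ τ y w)
        + Γ' (τ y) (fderiv ℝ τ y u) (Γ' (τ y) (fderiv ℝ τ y v) (fderiv ℝ τ y w))
        - Γ' (τ y) (fderiv ℝ τ y v) (Γ' (τ y) (fderiv ℝ τ y u) (fderiv ℝ τ y w)) := by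
  have h1 : HasFDerivAt τ (fderiv ℝ τ y) y := (hτ.differentiableAt (by norm_num)).hasFDerivAt
  have c2 : ContDiffAt ℝ 2 (fderiv ℝ τ) y := hτ.fderiv_right (m := 2) (by norm_num)
  have h2 : HasFDerivAt (fderiv ℝ τ) (fderiv ℝ (fderiv ℝ τ) y) y :=
    (c2.differentiableAt (by norm_num)).hasFDerivAt
  have h3 : HasFDerivAt (fderiv ℝ (fderiv ℝ τ)) (fderiv ℝ (fderiv ℝ (fderiv ℝ τ)) y) y :=
    ((c2.fderiv_right (m := 1) (by norm_num)).differentiableAt (by norm_num)).hasFDerivAt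
  have hs : ∀ a b, fderiv ℝ (fderiv ℝ τ) y a b = fderiv ℝ (fderiv ℝ τ) y b a :=
    fun a b => ((hτ.of_le (by norm_num)).isSymmSndFDerivAt (n := 2) (by simp)).eq a b
  have hs3 : ∀ a b, fderiv ℝ (fderiv ℝ (fderiv ℝ τ)) y a b
      = fderiv ℝ (fderiv ℝ (fderiv ℝ τ)) y b a :=
    fun a b => (c2.isSymmSndFDerivAt (by simp)).eq a b
  -- The derivative of the Christoffel transformation law in the direction `a`.
  have key : ∀ a b c, fderiv ℝ (fderiv ℝ τ) y a (Γ y b c) + fderiv ℝ τ y (fderiv ℝ Γ y a b c)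
      = fderiv ℝ Γ' (τ y) (fderiv ℝ τ y a) (fderiv ℝ τ y b) (fderiv ℝ τ y c)
        + Γ' (τ y) (fderiv ℝ (fderiv ℝ τ) y a b) (fderiv ℝ τ y c)
        + Γ' (τ y) (fderiv ℝ τ y b) (fderiv ℝ (fderiv ℝ τ) y a c)
        + fderiv ℝ (fderiv ℝ (fderiv ℝ τ)) y a b c := by
    intro a b c
    have hb := h2.clm_apply (hasFDerivAt_const b y)
    have hc := h2.clm_apply (hasFDerivAt_const c y)
    have h0 : HasFDerivAt (fun z => Γ' (τ z)) ((fderiv ℝ Γ' (τ y)).comp (fderiv ℝ τ y)) y :=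
      HasFDerivAt.comp (g := Γ') y hΓ'.hasFDerivAt h1
    have hr := ((h0.clm_apply hb).clm_apply hc).add
      ((h3.clm_apply (hasFDerivAt_const b y)).clm_apply (hasFDerivAt_const c y))
    have hl := h2.clm_apply ((hΓ.hasFDerivAt.clm_apply (hasFDerivAt_const b y)).clm_apply
      (hasFDerivAt_const c y))
    have h5 := hr.congr_of_eventuallyEq (f₁ := fun z => fderiv ℝ τ z (Γ z b c))
      (h.mono fun z hz => hz b c)
    have h6 := DFunLike.congr_fun (hl.unique h5) a
    simp at h6
    rw [add_comm, h6]
    abel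
  -- Antisymmetrizing `key` in `u` and `v` removes the third derivatives of `τ`. The remaining
  -- second derivatives are eliminated by the transformation law itself, which leaves only curvature
  -- terms.
  have hy := h.self_of_nhds
  have k1 := key u v w
  have k2 := key v u w
  have d1 := fun a b => eq_sub_of_add_eq' (hy a b).symm
  have e1 : ∀ a b, fderiv ℝ (fderiv ℝ τ) y a b
      = fderiv ℝ τ y (Γ y a b) - Γ' (τ y) (fderiv ℝ τ y a) (fderiv ℝ τ y b) := d1
  rw [hs v u, hs3 v u] at k2
  rw [e1 u (Γ y v w), e1 u w] at k1
  rw [e1 v (Γ y u w), e1 v w] at k2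
  simp only [map_sub, map_add] at k1 k2 ⊢
  linear_combination (norm := module) k1 - k2

end ChangeOfCoordinates

/-! ### Integral curves and flows of a vector field given in charts. -/

open Set Filter

/-- A `C^1` vector field on a topological space, given in a family of charts. -/
structure FieldAtlas (N F ι : Type*) [TopologicalSpace N] [NormedAddCommGroup F]
    [NormedSpace ℝ F] where
  /-- The charts. -/
  chart : ι → OpenPartialHomeomorph N F
  /-- The vector field in the charts. -/
  field : ι → F → F
  /-- A chart around a given point. -/
  index : N → ι
  mem_source : ∀ x, x ∈ (chart (index x)).source
  contDiffAt_field : ∀ i, ∀ y ∈ (chart i).target, ContDiffAt ℝ 1 (field i) y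
  compat : ∀ i j x, x ∈ (chart i).source → x ∈ (chart j).source →
    ∃ A : F →L[ℝ] F, HasFDerivAt (chart j ∘ (chart i).symm) A (chart i x) ∧
      A (field i (chart i x)) = field j (chart j x)

namespace FieldAtlas

variable {N F ι : Type*} [TopologicalSpace N] [NormedAddCommGroup F] [NormedSpace ℝ F]
  (A : FieldAtlas N F ι)

/-- The curve `σ` solves the differential equation at time `t`. -/
def SolAt (σ : ℝ → N) (t : ℝ) : Prop :=
  ContinuousAt σ t ∧ ∀ i, σ t ∈ (A.chart i).source →
    HasDerivAt (A.chart i ∘ σ) (A.field i (A.chart i (σ t))) t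

variable {A} {σ τ : ℝ → N} {t : ℝ}

/-- By `compat` the chart changes carry the local fields into each other, so the chain rule
transfers the equation from one chart to all others. -/
lemma solAt_of_chart (hc : ContinuousAt σ t) {i : ι} (hi : σ t ∈ (A.chart i).source)
    (h : HasDerivAt (A.chart i ∘ σ) (A.field i (A.chart i (σ t))) t) : A.SolAt σ t := by
  refine ⟨hc, fun j hj => ?_⟩
  obtain ⟨B, hB, hBf⟩ := A.compat i j _ hi hj
  rw [← hBf]
  refine (HasFDerivAt.comp_hasDerivAt (f := A.chart i ∘ σ) t hB h).congr_of_eventuallyEq ?_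
  filter_upwards [hc.preimage_mem_nhds ((A.chart i).open_source.mem_nhds hi)] with s hs
  simp [(A.chart i).left_inv hs]

lemma SolAt.congr (h : A.SolAt σ t) (he : τ =ᶠ[𝓝 t] σ) : A.SolAt τ t := by
  have h0 := he.eq_of_nhds
  refine ⟨h.1.congr he.symm, fun i hi => ?_⟩
  rw [h0] at hi ⊢
  exact (h.2 i hi).congr_of_eventuallyEq (he.fun_comp _)

lemma SolAt.comp_add {s : ℝ} (h : A.SolAt σ (t + s)) : A.SolAt (fun r => σ (r + s)) t :=
  ⟨h.1.comp (f := fun r => r + s) (by fun_prop), fun i hi =>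
    HasDerivAt.comp_add_const (f := A.chart i ∘ σ) t s (h.2 i hi)⟩

lemma SolAt.congr_of_eqOn {S : Set ℝ} (hS : IsOpen S) (ht : t ∈ S) (h : A.SolAt σ t)
    (he : EqOn τ σ S) : A.SolAt τ t :=
  h.congr (he.eventuallyEq_of_mem (hS.mem_nhds ht))

/-- A `C^1` field is locally Lipschitz, so the uniqueness theorem for ordinary differential
equations applies in a chart around the common value. -/
lemma eventuallyEq_of_solAt (hσ : ∀ᶠ s in 𝓝 t, A.SolAt σ s) (hτ : ∀ᶠ s in 𝓝 t, A.SolAt τ s)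
    (h : σ t = τ t) : σ =ᶠ[𝓝 t] τ := by
  set i := A.index (σ t) with hi
  have hs : σ t ∈ (A.chart i).source := A.mem_source _
  have hs' : τ t ∈ (A.chart i).source := h ▸ hs
  have ht : A.chart i (σ t) ∈ (A.chart i).target := (A.chart i).map_source hs
  obtain ⟨K, s, hsn, hl⟩ := (A.contDiffAt_field i _ ht).exists_lipschitzOnWith
  have main : ∀ ρ : ℝ → N, (∀ᶠ s in 𝓝 t, A.SolAt ρ s) → ρ t = σ t →
      ∀ᶠ r in 𝓝 t, ρ r ∈ (A.chart i).source ∧ HasDerivAt (A.chart i ∘ ρ)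
        (A.field i ((A.chart i ∘ ρ) r)) r ∧ (A.chart i ∘ ρ) r ∈ s := by
    intro ρ hρ h0
    have hc : ContinuousAt ρ t := hρ.self_of_nhds.1
    have hsr : ρ t ∈ (A.chart i).source := h0 ▸ hs
    have hc2 : ContinuousAt (A.chart i ∘ ρ) t :=
      ((A.chart i).continuousAt hsr).comp hc
    filter_upwards [hρ, hc.preimage_mem_nhds ((A.chart i).open_source.mem_nhds hsr),
      hc2.preimage_mem_nhds (by simpa [h0] using hsn)] with r h1 h2 h3
    exact ⟨h2, h1.2 i h2, h3⟩
  have m1 := main σ hσ rfl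
  have m2 := main τ hτ h.symm
  have := ODE_solution_unique_of_eventually (v := fun _ => A.field i) (s := fun _ => s)
    (Eventually.of_forall fun _ => hl) (m1.mono fun _ h => h.2) (m2.mono fun _ h => h.2)
    (by simp [h])
  filter_upwards [this, m1, m2] with r h1 h2 h3
  exact (A.chart i).injOn h2.1 h3.1 h1

/-- The times near which the two curves agree form an open set by definition. This set is also
closed in `S`: at a limit time the values agree because `N` is Hausdorff, and local uniqueness
applies there. -/
lemma eqOn_of_solAt [T2Space N] {S : Set ℝ} (hS : IsOpen S) (hS' : IsPreconnected S)
    (hσ : ∀ s ∈ S, A.SolAt σ s) (hτ : ∀ s ∈ S, A.SolAt τ s) (ht : t ∈ S) (h : σ t = τ t) :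
    EqOn σ τ S := by
  have : S ⊆ {s | σ =ᶠ[𝓝 s] τ} := by
    refine hS'.subset_of_closure_inter_subset (u := {s | σ =ᶠ[𝓝 s] τ}) ?_ ?_ ?_
    · exact isOpen_setOfPred_eventually_nhds
    · exact ⟨t, ht, eventuallyEq_of_solAt (Filter.eventually_of_mem (hS.mem_nhds ht) hσ)
        (Filter.eventually_of_mem (hS.mem_nhds ht) hτ) h⟩
    · rintro s ⟨hs, hsS⟩
      refine eventuallyEq_of_solAt (Filter.eventually_of_mem (hS.mem_nhds hsS) hσ)
        (Filter.eventually_of_mem (hS.mem_nhds hsS) hτ) ?_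
      by_contra hne
      obtain ⟨U, V, hU, hV, hsU, hsV, hd⟩ := t2_separation hne
      have h1 := (hσ s hsS).1.preimage_mem_nhds (hU.mem_nhds hsU)
      have h2 := (hτ s hsS).1.preimage_mem_nhds (hV.mem_nhds hsV)
      obtain ⟨r, hr, hr'⟩ := mem_closure_iff_nhds.1 hs _ (inter_mem h1 h2)
      have hr'' : σ r = τ r := Filter.EventuallyEq.eq_of_nhds hr'
      exact disjoint_left.1 hd hr.1 (hr'' ▸ hr.2)
  exact fun s hs => Filter.EventuallyEq.eq_of_nhds (this hs)

lemma eq_of_solAt [T2Space N] (hσ : ∀ s, A.SolAt σ s) (hτ : ∀ s, A.SolAt τ s) (h : σ t = τ t) : σ = τ :=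
  funext fun s => eqOn_of_solAt isOpen_univ isPreconnected_univ (fun s _ => hσ s)
    (fun s _ => hτ s) (mem_univ t) h (mem_univ s)

variable (A) in
lemma exists_localFlow [CompleteSpace F] (x : N) : ∃ ε > 0, ∃ U, IsOpen U ∧ x ∈ U ∧
    ∃ Φ : N → ℝ → N, (∀ y ∈ U, Φ y 0 = y ∧ ∀ t ∈ Ioo (-ε) ε, A.SolAt (Φ y) t) ∧
      ∀ t ∈ Ioo (-ε) ε, ContinuousOn (fun y => Φ y t) U := by
  set i := A.index x with hi
  set κ := A.chart i
  have hs : x ∈ κ.source := A.mem_source _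
  have ht : κ x ∈ κ.target := κ.map_source hs
  obtain ⟨ε, hε, a, r, L, K, hr, hp⟩ :=
    IsPicardLindelof.of_contDiffAt_one (A.contDiffAt_field i _ ht)
  obtain ⟨α, hα, hαc⟩ :=
    (hp 0).exists_forall_mem_closedBall_eq_hasDerivWithinAt_continuousOn
  simp only [zero_sub, zero_add] at hα hαc
  have hr' : (0 : ℝ) < r := hr
  have h0 : Metric.closedBall (κ x) r ×ˢ Icc (-ε) ε ∈ 𝓝 (κ x, (0 : ℝ)) :=
    prod_mem_nhds (Metric.closedBall_mem_nhds _ hr') (Icc_mem_nhds (by linarith) hε)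
  have hcx : ContinuousAt α (κ x, 0) := hαc.continuousAt h0
  have hx0 : α (κ x, 0) = κ x := (hα _ (Metric.mem_closedBall_self hr'.le)).1
  have h1 : α ⁻¹' κ.target ∈ 𝓝 (κ x, (0 : ℝ)) :=
    hcx.preimage_mem_nhds (κ.open_target.mem_nhds (by rwa [hx0]))
  -- Shrinking times and initial points keeps the Picard–Lindelöf solution in the target of the
  -- chart, so that it can be carried back to `N`.
  obtain ⟨δ, hδ, hδs⟩ := Metric.mem_nhds_iff.1 (inter_mem h0 h1)
  have hmem : ∀ z ∈ Metric.ball (κ x) δ, ∀ t ∈ Ioo (-δ) δ,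
      (z ∈ Metric.closedBall (κ x) r ∧ t ∈ Icc (-ε) ε) ∧ α (z, t) ∈ κ.target := by
    intro z hz t ht
    have : (z, t) ∈ Metric.ball (κ x, (0 : ℝ)) δ := by
      rw [← ball_prod_same]
      exact ⟨hz, by simpa [abs_lt] using ht⟩
    exact hδs this
  refine ⟨min δ ε, lt_min hδ hε, κ.source ∩ κ ⁻¹' Metric.ball (κ x) δ,
    κ.isOpen_inter_preimage Metric.isOpen_ball, ⟨hs, Metric.mem_ball_self hδ⟩,
    fun y t => κ.symm (α (κ y, t)), ?_, ?_⟩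
  · rintro y ⟨hy, hyb⟩
    have hyr := (hmem _ hyb 0 ⟨by linarith, hδ⟩).1.1
    refine ⟨(congrArg κ.symm (hα _ hyr).1).trans (κ.left_inv hy), fun t ht => ?_⟩
    have htδ : t ∈ Ioo (-δ) δ :=
      ⟨by linarith [ht.1, min_le_left δ ε], ht.2.trans_le (min_le_left _ _)⟩
    have htε : t ∈ Ioo (-ε) ε :=
      ⟨by linarith [ht.1, min_le_right δ ε], ht.2.trans_le (min_le_right _ _)⟩
    have hd : HasDerivAt (fun t => α (κ y, t)) (A.field i (α (κ y, t))) t :=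
      ((hα _ hyr).2 t (Ioo_subset_Icc_self htε)).hasDerivAt (Icc_mem_nhds htε.1 htε.2)
    have hta := (hmem _ hyb t htδ).2
    refine solAt_of_chart (i := i) ?_ (κ.map_target hta) ?_
    · exact (κ.symm.continuousAt hta).comp (f := fun t => α (κ y, t)) hd.continuousAt
    · change HasDerivAt (κ ∘ _) (A.field i (κ (κ.symm _))) t
      rw [κ.right_inv hta]
      refine hd.congr_of_eventuallyEq ?_
      filter_upwards [Ioo_mem_nhds htδ.1 htδ.2] with s hs
      exact κ.right_inv (hmem _ hyb s hs).2
  · intro t ht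
    have htδ : t ∈ Ioo (-δ) δ :=
      ⟨by linarith [ht.1, min_le_left δ ε], ht.2.trans_le (min_le_left _ _)⟩
    refine κ.symm.continuousOn.comp (t := κ.target) ?_ fun y hy => (hmem _ hy.2 t htδ).2
    refine hαc.comp (f := fun y => (κ y, t)) ?_ fun y hy => (hmem _ hy.2 t htδ).1
    exact (κ.continuousOn.mono inter_subset_left).prodMk continuousOn_const

/-- By uniqueness the two solutions agree on the overlap `Ioo c b`, so switching from `σ` to `τ` at
time `b` creates no corner. -/
lemma exists_sol_union [T2Space N] {a b c d : ℝ} (hac : a ≤ c) (hcb : c < b) (hbd : b ≤ d)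
    (hσ : ∀ s ∈ Ioo a b, A.SolAt σ s) (hτ : ∀ s ∈ Ioo c d, A.SolAt τ s)
    (ht : t ∈ Ioo c b) (h : σ t = τ t) :
    ∃ ρ, (∀ s ∈ Ioo a d, A.SolAt ρ s) ∧ EqOn ρ σ (Ioo a b) ∧ EqOn ρ τ (Ioo c d) := by
  have he : EqOn σ τ (Ioo c b) := eqOn_of_solAt isOpen_Ioo isPreconnected_Ioo
    (fun s hs => hσ s ⟨hac.trans_lt hs.1, hs.2⟩) (fun s hs => hτ s ⟨hs.1, hs.2.trans_le hbd⟩) ht h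
  have e1 : EqOn (fun s => if s < b then σ s else τ s) σ (Ioo a b) := fun s hs => by
    simp [hs.2]
  have e2 : EqOn (fun s => if s < b then σ s else τ s) τ (Ioo c d) := fun s hs => by
    by_cases hb : s < b
    · simp [hb, he ⟨hs.1, hb⟩]
    · simp [hb]
  refine ⟨_, fun s hs => ?_, e1, e2⟩
  by_cases hb : s < b
  · exact (hσ s ⟨hs.1, hb⟩).congr_of_eqOn isOpen_Ioo ⟨hs.1, hb⟩ e1
  · have : s ∈ Ioo c d := ⟨hcb.trans_le (not_lt.1 hb), hs.2⟩
    exact (hτ s this).congr_of_eqOn isOpen_Ioo this e2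

lemma exists_extension_right [T2Space N] [CompleteSpace F] {a b : ℝ} (hab : a < b)
    (hσ : ∀ s ∈ Ioo a b, A.SolAt σ s) {x : N} (hx : Tendsto σ (𝓝[<] b) (𝓝 x)) :
    ∃ ε > 0, ∃ ρ, (∀ s ∈ Ioo a (b + ε), A.SolAt ρ s) ∧ EqOn ρ σ (Ioo a b) := by
  obtain ⟨ε, hε, U, hU, hxU, Φ, hΦ, -⟩ := A.exists_localFlow x
  have h1 : ∀ᶠ s in 𝓝[<] b, σ s ∈ U ∧ s ∈ Ioo (max a (b - ε / 2)) b :=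
    (hx.eventually_mem (hU.mem_nhds hxU)).and
      (Ioo_mem_nhdsLT (max_lt hab (by linarith)))
  -- The local flow near `x` lasts for time `ε` from every point of `U`. Restarting at a time `m > b
  -- - ε / 2` with `σ m ∈ U` therefore passes beyond `b`.
  obtain ⟨m, hmU, hm⟩ := h1.exists
  have hm1 := max_lt_iff.1 hm.1
  have hΦm := hΦ _ hmU
  obtain ⟨ρ, h1, h2, -⟩ := exists_sol_union (A := A) (σ := σ) (τ := fun s => Φ (σ m) (s + -m))
    (a := a) (b := b) (c := max a (m - ε / 2)) (d := m + ε) (t := m) (le_max_left _ _)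
    (max_lt hab (by linarith [hm.2])) (by linarith)
    hσ (fun s hs => SolAt.comp_add (hΦm.2 _ ⟨by linarith [(max_lt_iff.1 hs.1).2], by
      linarith [hs.2]⟩))
    ⟨max_lt hm1.1 (by linarith), hm.2⟩ (by simp [hΦm.1])
  exact ⟨m + ε - b, by linarith, ρ, by simpa using h1, h2⟩

lemma exists_extension_left [T2Space N] [CompleteSpace F] {a b : ℝ} (hab : a < b)
    (hσ : ∀ s ∈ Ioo a b, A.SolAt σ s) {x : N} (hx : Tendsto σ (𝓝[>] a) (𝓝 x)) :
    ∃ ε > 0, ∃ ρ, (∀ s ∈ Ioo (a - ε) b, A.SolAt ρ s) ∧ EqOn ρ σ (Ioo a b) := by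
  obtain ⟨ε, hε, U, hU, hxU, Φ, hΦ, -⟩ := A.exists_localFlow x
  have h1 : ∀ᶠ s in 𝓝[>] a, σ s ∈ U ∧ s ∈ Ioo a (min b (a + ε / 2)) :=
    (hx.eventually_mem (hU.mem_nhds hxU)).and
      (Ioo_mem_nhdsGT (lt_min hab (by linarith)))
  obtain ⟨m, hmU, hm⟩ := h1.exists
  have hm1 := lt_min_iff.1 hm.2
  have hΦm := hΦ _ hmU
  obtain ⟨ρ, h1, -, h2⟩ := exists_sol_union (A := A) (τ := σ) (σ := fun s => Φ (σ m) (s + -m))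
    (c := a) (d := b) (b := min b (m + ε / 2)) (a := m - ε) (t := m) (by linarith)
    (lt_min hab (by linarith [hm.1])) (min_le_left _ _)
    (fun s hs => SolAt.comp_add (hΦm.2 _ ⟨by linarith [hs.1], by
      linarith [(lt_min_iff.1 hs.2).2]⟩)) hσ
    ⟨hm.1, lt_min hm1.1 (by linarith)⟩ (by simp [hΦm.1])
  exact ⟨a - (m - ε), by linarith, ρ, by simpa using h1, h2⟩

variable (A) in
/-- Solutions on bounded intervals have limits at both ends. -/
def EndsConverge : Prop :=
  ∀ (σ : ℝ → N) (a b : ℝ), a < b → (∀ s ∈ Ioo a b, A.SolAt σ s) →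
    (∃ x, Tendsto σ (𝓝[<] b) (𝓝 x)) ∧ ∃ x, Tendsto σ (𝓝[>] a) (𝓝 x)

lemma EndsConverge.exists_extension [T2Space N] [CompleteSpace F] (hA : A.EndsConverge) {b : ℝ}
    (hb : 0 < b) (hσ : ∀ s ∈ Ioo (-b) b, A.SolAt σ s) :
    ∃ ε > 0, ∃ ρ, (∀ s ∈ Ioo (-(b + ε)) (b + ε), A.SolAt ρ s) ∧ ρ 0 = σ 0 := by
  obtain ⟨x, hx⟩ := (hA σ _ _ (by linarith) hσ).1
  obtain ⟨ε, hε, ρ, hρ, h1⟩ := exists_extension_right (by linarith) hσ hx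
  obtain ⟨y, hy⟩ := (hA ρ _ _ (by linarith) hρ).2
  obtain ⟨δ, hδ, ρ', hρ', h2⟩ := exists_extension_left (by linarith) hρ hy
  refine ⟨min ε δ, lt_min hε hδ, ρ', fun s hs => hρ' s ⟨?_, ?_⟩, ?_⟩
  · linarith [hs.1, min_le_right ε δ]
  · linarith [hs.2, min_le_left ε δ]
  · rw [h2 ⟨by linarith, by linarith⟩, h1 ⟨by linarith, by linarith⟩]

/-- All these solutions have the value `x` at time `0`, so they agree wherever two of them are
defined. At each time any one whose interval contains it may be used. -/
lemma exists_sol_of_forall_lt [T2Space N] {x : N} {B : Set ℝ}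
    (hB : ∀ b ∈ B, ∃ σ, (∀ s ∈ Ioo (-b) b, A.SolAt σ s) ∧ σ 0 = x) :
    ∃ σ, (∀ s, (∃ b ∈ B, |s| < b) → A.SolAt σ s) ∧ ((∃ b ∈ B, 0 < b) → σ 0 = x) := by
  classical
  have : Nonempty N := ⟨x⟩
  choose! f hf hf0 using hB
  choose! g hgB hg using fun (s : ℝ) (h : ∃ b ∈ B, |s| < b) => h
  have key : ∀ b ∈ B, ∀ c ∈ B, b ≤ c → EqOn (f b) (f c) (Ioo (-b) b) := by
    intro b hb c hc hbc
    rcases le_or_gt b 0 with h0 | h0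
    · intro s hs
      linarith [hs.1, hs.2]
    · exact eqOn_of_solAt isOpen_Ioo isPreconnected_Ioo (hf b hb)
        (fun s hs => hf c hc s ⟨by linarith [hs.1], by linarith [hs.2]⟩)
        (t := 0) ⟨by linarith, h0⟩ (by rw [hf0 b hb, hf0 c hc])
  have key2 : ∀ b ∈ B, EqOn (fun s => f (g s) s) (f b) (Ioo (-b) b) := by
    intro b hb s hs
    have hex : ∃ b ∈ B, |s| < b := ⟨b, hb, abs_lt.2 hs⟩
    have h1 := abs_lt.1 (hg s hex)
    rcases le_total b (g s) with h | h
    · exact (key b hb _ (hgB s hex) h hs).symm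
    · exact key _ (hgB s hex) b hb h h1
  refine ⟨fun s => f (g s) s, ?_, ?_⟩
  · rintro s ⟨b, hb, hs⟩
    exact (hf b hb s (abs_lt.1 hs)).congr_of_eqOn isOpen_Ioo (abs_lt.1 hs) (key2 b hb)
  · rintro ⟨b, hb, hb0⟩
    exact (key2 b hb ⟨by linarith, hb0⟩).trans (hf0 b hb)

/-- If the half-lengths `b` of intervals `(-b, b)` carrying a solution through `x` were bounded, the
union of these solutions would live on the interval given by their supremum. It could then be
extended beyond it at both ends. -/
lemma EndsConverge.exists_global [T2Space N] [CompleteSpace F] (hA : A.EndsConverge) (x : N) :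
    ∃ σ, (∀ s, A.SolAt σ s) ∧ σ 0 = x := by
  set B := {b : ℝ | 0 < b ∧ ∃ σ, (∀ s ∈ Ioo (-b) b, A.SolAt σ s) ∧ σ 0 = x} with hBdef
  have hne : ∃ b ∈ B, 0 < b := by
    obtain ⟨ε, hε, U, -, hxU, Φ, hΦ, -⟩ := A.exists_localFlow x
    exact ⟨ε, ⟨hε, Φ x, (hΦ x hxU).2, (hΦ x hxU).1⟩, hε⟩
  obtain ⟨σ, hσ, hσ0⟩ := exists_sol_of_forall_lt (A := A) (x := x) (B := B) fun b hb => hb.2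
  by_cases hbd : BddAbove B
  · exfalso
    obtain ⟨b₀, hb₀, hb₀'⟩ := hne
    have hsup : 0 < sSup B := hb₀'.trans_le (le_csSup hbd hb₀)
    obtain ⟨ε, hε, ρ, hρ, h0⟩ := hA.exists_extension (σ := σ) hsup (fun s hs => hσ s (by
      obtain ⟨c, hc, hsc⟩ := exists_lt_of_lt_csSup ⟨b₀, hb₀⟩ (abs_lt.2 hs)
      exact ⟨c, hc, hsc⟩))
    have : sSup B + ε ∈ B := ⟨by linarith, ρ, hρ, h0.trans (hσ0 ⟨b₀, hb₀, hb₀'⟩)⟩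
    linarith [le_csSup hbd this]
  · refine ⟨σ, fun s => hσ s ?_, hσ0 hne⟩
    obtain ⟨b, hb, h⟩ := not_bddAbove_iff.1 hbd |s|
    exact ⟨b, hb, h⟩

/-- The flow of a complete vector field. -/
def EndsConverge.flow [T2Space N] [CompleteSpace F] (hA : A.EndsConverge) (x : N) : ℝ → N :=
  (hA.exists_global x).choose

section

variable [T2Space N] [CompleteSpace F] (hA : A.EndsConverge)

lemma EndsConverge.flow_solAt (x : N) (t : ℝ) : A.SolAt (hA.flow x) t :=
  (hA.exists_global x).choose_spec.1 t

lemma EndsConverge.flow_zero (x : N) : hA.flow x 0 = x :=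
  (hA.exists_global x).choose_spec.2

lemma EndsConverge.eq_flow (hσ : ∀ s, A.SolAt σ s) : σ = hA.flow (σ 0) :=
  eq_of_solAt (t := 0) hσ (hA.flow_solAt _) (hA.flow_zero _).symm

lemma EndsConverge.flow_add (x : N) (s t : ℝ) : hA.flow x (s + t) = hA.flow (hA.flow x t) s := by
  have := hA.eq_flow (σ := fun s => hA.flow x (s + t)) fun s => (hA.flow_solAt x _).comp_add
  simpa using congrFun this s

/-- Continuity at `x` of the time-`s` map is a locally constant property of `s`: nearby times differ
by a local flow around `hA.flow x s`, which runs in both directions. It holds at `s = 0`, and `ℝ` is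
connected. -/
lemma EndsConverge.continuous_flow (t : ℝ) : Continuous fun x => hA.flow x t := by
  have loc : ∀ x, ∃ ε > 0, ∃ U, IsOpen U ∧ x ∈ U ∧ ∀ y ∈ U, ∀ s ∈ Ioo (-ε) ε,
      ContinuousAt (fun y => hA.flow y s) y := by
    intro x
    obtain ⟨ε, hε, U, hU, hxU, Φ, hΦ, hΦc⟩ := A.exists_localFlow x
    refine ⟨ε, hε, U, hU, hxU, fun y hy s hs => ?_⟩
    refine ((hΦc s hs).continuousAt (hU.mem_nhds hy)).congr ?_
    filter_upwards [hU.mem_nhds hy] with z hz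
    exact eqOn_of_solAt isOpen_Ioo isPreconnected_Ioo (hΦ z hz).2 (fun s _ => hA.flow_solAt z s)
      (t := 0) ⟨by linarith, hε⟩ ((hΦ z hz).1.trans (hA.flow_zero z).symm) hs
  refine continuous_iff_continuousAt.2 fun x => ?_
  have hlc : IsLocallyConstant fun s => ContinuousAt (fun y => hA.flow y s) x := by
    refine (IsLocallyConstant.iff_eventually_eq _).2 fun s => ?_
    obtain ⟨ε, hε, U, hU, hxU, h⟩ := loc (hA.flow x s)
    filter_upwards [(hA.flow_solAt x s).1.preimage_mem_nhds (hU.mem_nhds hxU),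
      Ioo_mem_nhds (show s - ε < s by linarith) (show s < s + ε by linarith)] with r hr hr'
    have trans : ∀ p q, p - q ∈ Ioo (-ε) ε → hA.flow x q ∈ U →
        ContinuousAt (fun y => hA.flow y q) x → ContinuousAt (fun y => hA.flow y p) x := by
      intro p q hpq hq hc
      have h2 := (h _ hq _ hpq).comp (f := fun y => hA.flow y q) hc
      refine h2.congr (Eventually.of_forall fun y => ?_)
      simp [← hA.flow_add]
    exact propext ⟨trans s r ⟨by linarith [hr'.2], by linarith [hr'.1]⟩ hr,
      trans r s ⟨by linarith [hr'.1], by linarith [hr'.2]⟩ hxU⟩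
  have h0 : ContinuousAt (fun y => hA.flow y 0) x := by
    simp only [hA.flow_zero]
    exact continuousAt_id
  exact (hlc.apply_eq_of_preconnectedSpace t 0).mpr h0

end

end FieldAtlas

set_option synthInstance.maxHeartbeats 200000

/-! ### Metric, Christoffel symbols and curvature in the preferred charts. -/

section ChartMetric

variable {n : ℕ} {M : Type*} [TopologicalSpace M] [ChartedSpace (EuclideanSpace ℝ (Fin n)) M]

/-- The change of coordinates between the preferred charts around two points. -/
def transition (c c' : M) : EuclideanSpace ℝ (Fin n) → EuclideanSpace ℝ (Fin n) :=
  extChartAt (𝓡 n) c' ∘ (extChartAt (𝓡 n) c).symm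

lemma transition_apply {c c' p : M} (hp : p ∈ (extChartAt (𝓡 n) c).source) :
    transition c c' (extChartAt (𝓡 n) c p) = extChartAt (𝓡 n) c' p := by
  exact congrArg _ ((extChartAt (𝓡 n) c).left_inv hp)

lemma eventually_extChartAt_symm {c c' p : M} (hp : p ∈ (extChartAt (𝓡 n) c).source)
    (hp' : p ∈ (extChartAt (𝓡 n) c').source) :
    ∀ᶠ z in 𝓝 (extChartAt (𝓡 n) c p), z ∈ (extChartAt (𝓡 n) c).target ∧
      (extChartAt (𝓡 n) c).symm z ∈ (extChartAt (𝓡 n) c').source := by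
  have ht := (extChartAt (𝓡 n) c).map_source hp
  refine ((isOpen_extChartAt_target c).eventually_mem ht).and ?_
  exact (continuousAt_extChartAt_symm'' ht).preimage_mem_nhds
    ((isOpen_extChartAt_source c').mem_nhds (by rwa [(extChartAt (𝓡 n) c).left_inv hp]))

variable [IsManifold (𝓡 n) ∞ M]

lemma coords_ofCoords {c p : M} (hp : p ∈ (extChartAt (𝓡 n) c).source)
    (u : EuclideanSpace ℝ (Fin n)) : coords c p (ofCoords c p u) = u :=
  (trivializationAt (EuclideanSpace ℝ (Fin n)) (fun x : M => TangentSpace (𝓡 n) x)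
    c).continuousLinearMapAt_symmL (by simpa using hp) u

lemma ofCoords_coords {c p : M} (hp : p ∈ (extChartAt (𝓡 n) c).source)
    (u : TangentSpace (𝓡 n) p) : ofCoords c p (coords c p u) = u :=
  (trivializationAt (EuclideanSpace ℝ (Fin n)) (fun x : M => TangentSpace (𝓡 n) x)
    c).symmL_continuousLinearMapAt (by simpa using hp) u

lemma ofCoords_injective {c p : M} (hp : p ∈ (extChartAt (𝓡 n) c).source) :
    Function.Injective (ofCoords (n := n) c p) :=
  Function.LeftInverse.injective (coords_ofCoords hp)

lemma coords_injective {c p : M} (hp : p ∈ (extChartAt (𝓡 n) c).source) :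
    Function.Injective (coords (n := n) c p) :=
  Function.LeftInverse.injective (ofCoords_coords hp)

lemma coords_comp_ofCoords {c c' p : M} (hp : p ∈ (extChartAt (𝓡 n) c).source)
    (hp' : p ∈ (extChartAt (𝓡 n) c').source) (u : EuclideanSpace ℝ (Fin n)) :
    coords c' p (ofCoords c p u) = tangentCoordChange (𝓡 n) c c' p u := by
  have h1 : coords (n := n) c' p = tangentCoordChange (𝓡 n) p c' p :=
    TangentBundle.continuousLinearMapAt_trivializationAt_eq_core (by simpa using hp')
  have h2 : ofCoords (n := n) c p = tangentCoordChange (𝓡 n) c p p :=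
    TangentBundle.symmL_trivializationAt_eq_core (by simpa using hp)
  rw [h1, h2]
  exact tangentCoordChange_comp ⟨⟨hp, mem_extChartAt_source p⟩, hp'⟩

lemma hasFDerivAt_transition {c c' p : M} (hp : p ∈ (extChartAt (𝓡 n) c).source)
    (hp' : p ∈ (extChartAt (𝓡 n) c').source) :
    HasFDerivAt (transition c c') (tangentCoordChange (𝓡 n) c c' p) (extChartAt (𝓡 n) c p) := by
  have := hasFDerivWithinAt_tangentCoordChange (I := 𝓡 n) (x := c) (y := c') (z := p) ⟨hp, hp'⟩
  rw [modelWithCornersSelf_coe, range_id, hasFDerivWithinAt_univ] at this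
  exact this

lemma fderiv_transition {c c' p : M} (hp : p ∈ (extChartAt (𝓡 n) c).source)
    (hp' : p ∈ (extChartAt (𝓡 n) c').source) (u : EuclideanSpace ℝ (Fin n)) :
    fderiv ℝ (transition c c') (extChartAt (𝓡 n) c p) u = coords c' p (ofCoords c p u) := by
  rw [(hasFDerivAt_transition hp hp').fderiv, coords_comp_ofCoords hp hp']

lemma contDiffAt_transition {c c' p : M} (hp : p ∈ (extChartAt (𝓡 n) c).source)
    (hp' : p ∈ (extChartAt (𝓡 n) c').source) :
    ContDiffAt ℝ ∞ (transition c c') (extChartAt (𝓡 n) c p) := by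
  have h := contDiffWithinAt_ext_coord_change (I := 𝓡 n) (n := ∞) c' c
    (y := extChartAt (𝓡 n) c p) (by
      rw [PartialEquiv.trans_source, PartialEquiv.symm_source]
      exact ⟨(extChartAt (𝓡 n) c).map_source hp,
        by rwa [mem_preimage, (extChartAt (𝓡 n) c).left_inv hp]⟩)
  rw [modelWithCornersSelf_coe, range_id, contDiffWithinAt_univ] at h
  exact h

lemma contMDiffAt_ofCoords {c : M} {y : EuclideanSpace ℝ (Fin n)}
    (hy : y ∈ (extChartAt (𝓡 n) c).target) (u : EuclideanSpace ℝ (Fin n)) :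
    ContMDiffAt 𝓘(ℝ, EuclideanSpace ℝ (Fin n)) (𝓡 n).tangent ∞
      (fun z => (⟨(extChartAt (𝓡 n) c).symm z, ofCoords c ((extChartAt (𝓡 n) c).symm z) u⟩ :
        TangentBundle (𝓡 n) M)) y := by
  have hs := (extChartAt (𝓡 n) c).map_target hy
  rw [(trivializationAt (EuclideanSpace ℝ (Fin n)) (fun x : M => TangentSpace (𝓡 n) x)
    c).contMDiffAt_iff (by rw [Trivialization.mem_source]; simpa using hs)]
  have htn := (isOpen_extChartAt_target (I := 𝓡 n) c).mem_nhds hy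
  refine ⟨(contMDiffOn_extChartAt_symm c).contMDiffAt htn,
    (contMDiffAt_const (c := u)).congr_of_eventuallyEq ?_⟩
  filter_upwards [htn] with z hz
  have hz' := (extChartAt (𝓡 n) c).map_target hz
  have := coords_ofCoords hz' u
  rw [coords, Trivialization.continuousLinearMapAt_apply,
    Trivialization.coe_linearMapAt_of_mem _ (by simpa using hz')] at this
  exact this

variable [RiemannianBundle (fun x : M => TangentSpace (𝓡 n) x)]

/-- The metric in the preferred chart around `c`, as a field of bilinear forms. -/
def metricForm (c : M) (y : EuclideanSpace ℝ (Fin n)) :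
    EuclideanSpace ℝ (Fin n) →L[ℝ] EuclideanSpace ℝ (Fin n) →L[ℝ] ℝ :=
  ∑ i, ∑ j, gram c y i j •
    (EuclideanSpace.proj (𝕜 := ℝ) i).smulRight (EuclideanSpace.proj (𝕜 := ℝ) j)

/-- The Christoffel symbols in the preferred chart around `c`, as a field of bilinear maps. -/
def christoffelForm (c : M) (y : EuclideanSpace ℝ (Fin n)) :
    EuclideanSpace ℝ (Fin n) →L[ℝ] EuclideanSpace ℝ (Fin n) →L[ℝ] EuclideanSpace ℝ (Fin n) :=
  ∑ k, ∑ i, ∑ j, christoffelSymbol c y k i j • (EuclideanSpace.proj (𝕜 := ℝ) i).smulRight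
    ((EuclideanSpace.proj (𝕜 := ℝ) j).smulRight (EuclideanSpace.single k (1 : ℝ)))

/-- The curvature tensor in the preferred chart around `c`, written with `christoffelForm`. -/
def curvatureForm (c : M) (y u v w : EuclideanSpace ℝ (Fin n)) : EuclideanSpace ℝ (Fin n) :=
  fderiv ℝ (christoffelForm c) y u v w - fderiv ℝ (christoffelForm c) y v u w
    + christoffelForm c y u (christoffelForm c y v w)
    - christoffelForm c y v (christoffelForm c y u w)

lemma metricForm_apply_eq_sum (c : M) (y u w : EuclideanSpace ℝ (Fin n)) :
    metricForm c y u w = ∑ i, ∑ j, gram c y i j * (u i * w j) := by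
  simp [metricForm]

lemma christoffelForm_apply (c : M) (y u w : EuclideanSpace ℝ (Fin n)) :
    christoffelForm c y u w = christoffel c y u w := by
  ext k
  simp only [christoffelForm, christoffel, sum_apply, smul_apply,
    ContinuousLinearMap.smulRight_apply, PiLp.proj_apply, PiLp.smul_apply, smul_eq_mul,
    WithLp.ofLp_sum, Finset.sum_apply, PiLp.single_apply]
  rw [Finset.sum_eq_single k (fun l _ hl => by simp [Ne.symm hl]) (by simp)]
  simp [mul_assoc]

lemma sum_smul_single (u : EuclideanSpace ℝ (Fin n)) :
    ∑ i, u i • EuclideanSpace.single i (1 : ℝ) = u := by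
  ext k
  simp [Pi.single_apply]

lemma metricForm_apply (c : M) (y u w : EuclideanSpace ℝ (Fin n)) :
    metricForm c y u w = ⟪ofCoords c ((extChartAt (𝓡 n) c).symm y) u,
      ofCoords c ((extChartAt (𝓡 n) c).symm y) w⟫ := by
  rw [metricForm_apply_eq_sum]
  conv_rhs => rw [← sum_smul_single u, ← sum_smul_single w]
  simp only [map_sum, map_smul, sum_inner, inner_sum, real_inner_smul_left, real_inner_smul_right,
    gram, Matrix.of_apply]
  rw [Finset.sum_comm]
  exact Finset.sum_congr rfl fun i _ => Finset.sum_congr rfl fun j _ => by ring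

lemma metricForm_extChartAt {c p : M} (hp : p ∈ (extChartAt (𝓡 n) c).source)
    (u w : EuclideanSpace ℝ (Fin n)) :
    metricForm c (extChartAt (𝓡 n) c p) u w = ⟪ofCoords c p u, ofCoords c p w⟫ := by
  rw [metricForm_apply, (extChartAt (𝓡 n) c).left_inv hp]

lemma metricForm_symm (c : M) (y u w : EuclideanSpace ℝ (Fin n)) :
    metricForm c y u w = metricForm c y w u := by
  rw [metricForm_apply, metricForm_apply, real_inner_comm]

/-- By Cramer's rule the entries of the inverse are determinants in the entries of `A`, divided by a
nonvanishing determinant. -/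
lemma contDiffAt_matrix_inv {F : Type*} [NormedAddCommGroup F] [NormedSpace ℝ F]
    {ι : Type*} [Fintype ι] [DecidableEq ι] {A : F → Matrix ι ι ℝ} {y : F}
    (hA : ∀ i j, ContDiffAt ℝ ∞ (fun z => A z i j) y) (hy : (A y).det ≠ 0) (i j : ι) :
    ContDiffAt ℝ ∞ (fun z => (A z)⁻¹ i j) y := by
  have hdet : ∀ B : F → Matrix ι ι ℝ, (∀ i j, ContDiffAt ℝ ∞ (fun z => B z i j) y) →
      ContDiffAt ℝ ∞ (fun z => (B z).det) y := by
    intro B hB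
    simp only [Matrix.det_apply, Units.smul_def, zsmul_eq_mul]
    exact ContDiffAt.sum fun σ _ => contDiffAt_const.mul (contDiffAt_prod fun k _ => hB _ _)
  simp only [Matrix.inv_def, Ring.inverse_eq_inv', Matrix.smul_apply, smul_eq_mul,
    Matrix.adjugate_apply]
  refine ((hdet A hA).inv hy).mul (hdet _ fun k l => ?_)
  by_cases hk : k = j
  · subst hk
    simpa using contDiffAt_const
  · simpa [Matrix.updateRow_apply, hk] using hA k l

lemma eq_zero_of_metricForm {c : M} {y : EuclideanSpace ℝ (Fin n)}
    (hy : y ∈ (extChartAt (𝓡 n) c).target) {u : EuclideanSpace ℝ (Fin n)}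
    (h : metricForm c y u u = 0) : u = 0 := by
  rw [metricForm_apply, inner_self_eq_zero] at h
  exact ofCoords_injective ((extChartAt (𝓡 n) c).map_target hy) (by rw [h, map_zero])

/-- A vector in the kernel of the Gram matrix would have length zero. -/
lemma det_gram_ne_zero {c : M} {y : EuclideanSpace ℝ (Fin n)}
    (hy : y ∈ (extChartAt (𝓡 n) c).target) : (gram c y).det ≠ 0 := by
  intro h
  obtain ⟨v, hv, hv0⟩ := Matrix.exists_mulVec_eq_zero_iff.2 h
  refine hv ?_
  have h1 : metricForm c y (WithLp.toLp 2 v) (WithLp.toLp 2 v) = 0 := by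
    rw [metricForm_apply_eq_sum]
    refine Finset.sum_eq_zero fun i _ => ?_
    have := congrFun hv0 i
    simp only [Matrix.mulVec, dotProduct, Pi.zero_apply] at this
    calc ∑ j, gram c y i j * (v i * v j) = v i * ∑ j, gram c y i j * v j := by
          rw [Finset.mul_sum]
          exact Finset.sum_congr rfl fun j _ => by ring
      _ = 0 := by rw [this, mul_zero]
  simpa using eq_zero_of_metricForm hy h1

variable [IsContMDiffRiemannianBundle (𝓡 n) ∞ (EuclideanSpace ℝ (Fin n))
      (fun x : M => TangentSpace (𝓡 n) x)]

lemma contDiffAt_gram {c : M} {y : EuclideanSpace ℝ (Fin n)}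
    (hy : y ∈ (extChartAt (𝓡 n) c).target) (i j : Fin n) :
    ContDiffAt ℝ ∞ (fun z => gram c z i j) y :=
  contMDiffAt_iff_contDiffAt.1
    ((contMDiffAt_ofCoords hy _).inner_bundle (contMDiffAt_ofCoords hy _))

lemma contDiffAt_metricForm {c : M} {y : EuclideanSpace ℝ (Fin n)}
    (hy : y ∈ (extChartAt (𝓡 n) c).target) : ContDiffAt ℝ ∞ (metricForm (n := n) c) y :=
  ContDiffAt.sum fun i _ => ContDiffAt.sum fun j _ =>
    (contDiffAt_gram hy i j).continuousLinearMap_comp (ContinuousLinearMap.toSpanSingleton ℝ _)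

lemma contDiffAt_dgram {c : M} {y : EuclideanSpace ℝ (Fin n)}
    (hy : y ∈ (extChartAt (𝓡 n) c).target) (k i j : Fin n) :
    ContDiffAt ℝ ∞ (fun z => dgram c z k i j) y :=
  ((contDiffAt_gram hy i j).fderiv_right (m := ∞) (by simp)).clm_apply contDiffAt_const

lemma contDiffAt_christoffelForm {c : M} {y : EuclideanSpace ℝ (Fin n)}
    (hy : y ∈ (extChartAt (𝓡 n) c).target) : ContDiffAt ℝ ∞ (christoffelForm (n := n) c) y := by
  refine ContDiffAt.sum fun k _ => ContDiffAt.sum fun i _ => ContDiffAt.sum fun j _ =>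
    ContDiffAt.continuousLinearMap_comp (ContinuousLinearMap.toSpanSingleton ℝ _) ?_
  refine contDiffAt_const.mul (ContDiffAt.sum fun l _ => ContDiffAt.mul ?_ ?_)
  · exact contDiffAt_matrix_inv (contDiffAt_gram hy) (det_gram_ne_zero hy) k l
  · exact ((contDiffAt_dgram hy _ _ _).add (contDiffAt_dgram hy _ _ _)).sub
      (contDiffAt_dgram hy _ _ _)

lemma fderiv_metricForm {c : M} {y : EuclideanSpace ℝ (Fin n)}
    (hy : y ∈ (extChartAt (𝓡 n) c).target) (a u w : EuclideanSpace ℝ (Fin n)) :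
    fderiv ℝ (metricForm c) y a u w = ∑ k, ∑ i, ∑ j, dgram c y k i j * (a k * u i * w j) := by
  have h1 := (((contDiffAt_metricForm hy).differentiableAt (by simp)).hasFDerivAt.clm_apply
    (hasFDerivAt_const u y)).clm_apply (hasFDerivAt_const w y)
  have h2 : HasFDerivAt (fun z => ∑ i, ∑ j, gram c z i j * (u i * w j))
      (∑ i, ∑ j, (u i * w j) • fderiv ℝ (fun z => gram c z i j) y) y :=
    HasFDerivAt.fun_sum fun i _ => HasFDerivAt.fun_sum fun j _ =>
      ((contDiffAt_gram hy i j).differentiableAt (by simp)).hasFDerivAt.mul_const _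
  simp only [metricForm_apply_eq_sum] at h1
  have h3 := DFunLike.congr_fun (h1.unique h2) a
  simp only [ContinuousLinearMap.comp_zero, zero_add, ContinuousLinearMap.flip_apply] at h3
  rw [h3]
  have h4 : ∀ i j, fderiv ℝ (fun z => gram c z i j) y a = ∑ k, a k * dgram c y k i j := by
    intro i j
    conv_lhs => rw [← sum_smul_single a]
    simp [dgram]
  simp only [sum_apply, smul_apply, h4, smul_eq_mul, Finset.mul_sum]
  symm
  rw [Finset.sum_comm]
  refine Finset.sum_congr rfl fun i _ => ?_
  rw [Finset.sum_comm]
  exact Finset.sum_congr rfl fun j _ => Finset.sum_congr rfl fun k _ => by ring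

/-- The Koszul formula in a chart. -/
lemma metricForm_christoffelForm {c : M} {y : EuclideanSpace ℝ (Fin n)}
    (hy : y ∈ (extChartAt (𝓡 n) c).target) (u w z : EuclideanSpace ℝ (Fin n)) :
    2 * metricForm c y (christoffelForm c y u w) z = fderiv ℝ (metricForm c) y u w z
      + fderiv ℝ (metricForm c) y w u z - fderiv ℝ (metricForm c) y z u w := by
  -- `B l` is twice the `l`-th component of `Γ(u, w)` with its index lowered. Raising the index and
  -- pairing with `z` cancels the inverse Gram matrix.
  set B : Fin n → ℝ := fun l => ∑ i, ∑ j,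
    (dgram c y i j l + dgram c y j i l - dgram c y l i j) * (u i * w j) with hB
  have h1 : ∀ k, christoffelForm c y u w k = (1 / 2) * ∑ l, (gram c y)⁻¹ k l * B l := by
    intro k
    rw [christoffelForm_apply]
    simp only [christoffel, christoffelSymbol, hB, Finset.mul_sum, Finset.sum_mul]
    symm
    rw [Finset.sum_comm]
    refine Finset.sum_congr rfl fun i _ => ?_
    rw [Finset.sum_comm]
    exact Finset.sum_congr rfl fun j _ => Finset.sum_congr rfl fun l _ => by ring
  have h2 : ∀ l, ∑ k, gram c y k l * ∑ m, (gram c y)⁻¹ k m * B m = B l := by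
    intro l
    have hs : ∀ k, gram c y k l = gram c y l k := fun k => by
      simp only [gram, Matrix.of_apply, real_inner_comm]
    have := congrFun (Matrix.mulVec_mulVec B (gram c y) (gram c y)⁻¹) l
    rw [Matrix.mul_nonsing_inv _ (isUnit_iff_ne_zero.2 (det_gram_ne_zero hy)),
      Matrix.one_mulVec] at this
    simp only [hs]
    exact this
  have h3 : 2 * metricForm c y (christoffelForm c y u w) z = ∑ l, z l * B l := by
    simp only [metricForm_apply_eq_sum, h1]
    rw [Finset.sum_comm, Finset.mul_sum]
    refine Finset.sum_congr rfl fun l _ => ?_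
    rw [← h2 l, Finset.mul_sum, Finset.mul_sum]
    exact Finset.sum_congr rfl fun k _ => by ring
  rw [h3, fderiv_metricForm hy, fderiv_metricForm hy, fderiv_metricForm hy]
  have e1 : ∑ k, ∑ i, ∑ j, dgram c y k i j * (u k * w i * z j)
      = ∑ l, ∑ i, ∑ j, dgram c y i j l * (u i * w j * z l) := by
    symm
    rw [Finset.sum_comm]
    exact Finset.sum_congr rfl fun i _ => Finset.sum_comm
  have e2 : ∑ k, ∑ i, ∑ j, dgram c y k i j * (w k * u i * z j)
      = ∑ l, ∑ i, ∑ j, dgram c y j i l * (w j * u i * z l) := by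
    symm
    calc _ = ∑ l, ∑ j, ∑ i, dgram c y j i l * (w j * u i * z l) :=
          Finset.sum_congr rfl fun l _ => Finset.sum_comm
      _ = _ := by
          rw [Finset.sum_comm]
          exact Finset.sum_congr rfl fun i _ => Finset.sum_comm
  rw [e1, e2, ← Finset.sum_add_distrib, ← Finset.sum_sub_distrib]
  refine Finset.sum_congr rfl fun l _ => ?_
  rw [hB, ← Finset.sum_add_distrib, ← Finset.sum_sub_distrib, Finset.mul_sum]
  refine Finset.sum_congr rfl fun i _ => ?_
  rw [← Finset.sum_add_distrib, ← Finset.sum_sub_distrib, Finset.mul_sum]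
  exact Finset.sum_congr rfl fun j _ => by ring

/-- The Levi-Civita connection is compatible with the metric. -/
lemma fderiv_metricForm_eq {c : M} {y : EuclideanSpace ℝ (Fin n)}
    (hy : y ∈ (extChartAt (𝓡 n) c).target) (a u w : EuclideanSpace ℝ (Fin n)) :
    fderiv ℝ (metricForm c) y a u w = metricForm c y (christoffelForm c y a u) w
      + metricForm c y u (christoffelForm c y a w) := by
  have hs : ∀ a u w, fderiv ℝ (metricForm c) y a u w = fderiv ℝ (metricForm c) y a w u := by
    intro a u w
    have h := ((contDiffAt_metricForm hy).differentiableAt (by simp)).hasFDerivAt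
    have h1 := (h.clm_apply (hasFDerivAt_const u y)).clm_apply (hasFDerivAt_const w y)
    have h2 := (h.clm_apply (hasFDerivAt_const w y)).clm_apply (hasFDerivAt_const u y)
    simp only [metricForm_symm c _ w u] at h2
    simpa using DFunLike.congr_fun (h1.unique h2) a
  have h1 := metricForm_christoffelForm hy a u w
  have h2 := metricForm_christoffelForm hy a w u
  rw [metricForm_symm] at h2
  rw [metricForm_symm c y u]
  rw [metricForm_symm] at h2
  linarith [hs a u w, hs u a w, hs w a u]

lemma chartCurvature_eq {c : M} {y : EuclideanSpace ℝ (Fin n)}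
    (hy : y ∈ (extChartAt (𝓡 n) c).target) (u v w : EuclideanSpace ℝ (Fin n)) :
    chartCurvature c y u v w = curvatureForm c y u v w := by
  have hd : ∀ u v w : EuclideanSpace ℝ (Fin n),
      fderiv ℝ (fun z => christoffel c z v w) y u = fderiv ℝ (christoffelForm c) y u v w := by
    intro u v w
    have h := ((contDiffAt_christoffelForm hy).differentiableAt (by simp)).hasFDerivAt
    have h1 := (h.clm_apply (hasFDerivAt_const v y)).clm_apply (hasFDerivAt_const w y)
    simp only [christoffelForm_apply] at h1
    simp [h1.fderiv]
  simp only [chartCurvature, curvatureForm, hd]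
  simp only [← christoffelForm_apply]

section Transition

variable {c c' p : M} (hp : p ∈ (extChartAt (𝓡 n) c).source)
    (hp' : p ∈ (extChartAt (𝓡 n) c').source)
include hp hp'

/-- The derivative of a transition map is the change of components of tangent vectors, so it pulls
one coordinate metric back to the other. The Koszul formula in both charts then puts this under
`christoffel_transform`. -/
lemma fderiv_transition_christoffelForm (u w : EuclideanSpace ℝ (Fin n)) :
    fderiv ℝ (transition c c') (extChartAt (𝓡 n) c p)
        (christoffelForm c (extChartAt (𝓡 n) c p) u w)
      = christoffelForm c' (extChartAt (𝓡 n) c' p)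
          (fderiv ℝ (transition c c') (extChartAt (𝓡 n) c p) u)
          (fderiv ℝ (transition c c') (extChartAt (𝓡 n) c p) w)
        + fderiv ℝ (fderiv ℝ (transition c c')) (extChartAt (𝓡 n) c p) u w := by
  have ht := (extChartAt (𝓡 n) c).map_source hp
  have ht' := (extChartAt (𝓡 n) c').map_source hp'
  refine christoffel_transform (G := metricForm c) (G' := metricForm c')
    ?_ ((contDiffAt_transition hp hp').of_le (by norm_cast))
    ((contDiffAt_metricForm ht).differentiableAt (by simp)) ?_ ?_
    (metricForm_christoffelForm ht) ?_ ?_ u w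
  · rw [transition_apply hp]
    exact (contDiffAt_metricForm ht').differentiableAt (by simp)
  · filter_upwards [eventually_extChartAt_symm hp hp'] with z hz a b
    obtain ⟨q, hq, rfl⟩ : ∃ q ∈ (extChartAt (𝓡 n) c).source, extChartAt (𝓡 n) c q = z :=
      ⟨_, (extChartAt (𝓡 n) c).map_target hz.1, (extChartAt (𝓡 n) c).right_inv hz.1⟩
    have hq' := hz.2
    rw [(extChartAt (𝓡 n) c).left_inv hq] at hq'
    rw [transition_apply hq, fderiv_transition hq hq', fderiv_transition hq hq',
      metricForm_extChartAt hq', metricForm_extChartAt hq, ofCoords_coords hq',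
      ofCoords_coords hq']
  · exact metricForm_symm c' _
  · rw [transition_apply hp]
    exact metricForm_christoffelForm ht'
  -- Testing against the vector whose image under the derivative of the transition map is `v` itself
  -- gives `⟨v, v⟩ = 0`.
  · intro v hv
    rw [transition_apply hp] at hv
    have := hv (coords c p (ofCoords c' p v))
    rw [fderiv_transition hp hp', ofCoords_coords hp, coords_ofCoords hp'] at this
    exact eq_zero_of_metricForm ht' this

lemma fderiv_transition_curvatureForm (u v w : EuclideanSpace ℝ (Fin n)) :
    fderiv ℝ (transition c c') (extChartAt (𝓡 n) c p)
        (curvatureForm c (extChartAt (𝓡 n) c p) u v w)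
      = curvatureForm c' (extChartAt (𝓡 n) c' p)
          (fderiv ℝ (transition c c') (extChartAt (𝓡 n) c p) u)
          (fderiv ℝ (transition c c') (extChartAt (𝓡 n) c p) v)
          (fderiv ℝ (transition c c') (extChartAt (𝓡 n) c p) w) := by
  have ht := (extChartAt (𝓡 n) c).map_source hp
  have ht' := (extChartAt (𝓡 n) c').map_source hp'
  have := curvature_transform (Γ := christoffelForm c) (Γ' := christoffelForm c')
    (τ := transition c c') (y := extChartAt (𝓡 n) c p)
    ((contDiffAt_christoffelForm ht).differentiableAt (by simp))
    (by rw [transition_apply hp]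
        exact (contDiffAt_christoffelForm ht').differentiableAt (by simp))
    ((contDiffAt_transition hp hp').of_le (by norm_cast)) (by
      filter_upwards [eventually_extChartAt_symm hp hp'] with z hz a b
      obtain ⟨q, hq, rfl⟩ : ∃ q ∈ (extChartAt (𝓡 n) c).source, extChartAt (𝓡 n) c q = z :=
        ⟨_, (extChartAt (𝓡 n) c).map_target hz.1, (extChartAt (𝓡 n) c).right_inv hz.1⟩
      have hq' := hz.2
      rw [(extChartAt (𝓡 n) c).left_inv hq] at hq'
      rw [transition_apply hq]
      exact fderiv_transition_christoffelForm hq hq' a b) u v w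
  rwa [transition_apply hp] at this

end Transition

end ChartMetric

/-! ### The state space and the vector field of geodesics with Jacobi fields. -/

section StateSpace

variable (n : ℕ) (M : Type*) [TopologicalSpace M] [ChartedSpace (EuclideanSpace ℝ (Fin n)) M]
  [IsManifold (𝓡 n) ∞ M]

/-- Triples of tangent vectors with the same root: the velocity of a curve, a vector field along it
and the covariant derivative of that field. -/
abbrev State : Type _ :=
  TotalSpace (EuclideanSpace ℝ (Fin n) × EuclideanSpace ℝ (Fin n) × EuclideanSpace ℝ (Fin n))
    ((fun x : M => TangentSpace (𝓡 n) x) ×ᵇ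
      ((fun x : M => TangentSpace (𝓡 n) x) ×ᵇ (fun x : M => TangentSpace (𝓡 n) x)))

/-- Coordinates of states. -/
abbrev StateCoord : Type :=
  EuclideanSpace ℝ (Fin n) × EuclideanSpace ℝ (Fin n) × EuclideanSpace ℝ (Fin n) ×
    EuclideanSpace ℝ (Fin n)

variable {n M}

/-- The chart of the state space given by the preferred chart around `c`. -/
def stateChart (c : M) : OpenPartialHomeomorph (State n M) (StateCoord n) :=
  (trivializationAt
    (EuclideanSpace ℝ (Fin n) × EuclideanSpace ℝ (Fin n) × EuclideanSpace ℝ (Fin n))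
    ((fun x : M => TangentSpace (𝓡 n) x) ×ᵇ
      ((fun x : M => TangentSpace (𝓡 n) x) ×ᵇ (fun x : M => TangentSpace (𝓡 n) x)))
    c).toOpenPartialHomeomorph ≫ₕ
  (chartAt (EuclideanSpace ℝ (Fin n)) c).prod (OpenPartialHomeomorph.refl _)

lemma mem_stateChart_source {c : M} {x : State n M} :
    x ∈ (stateChart c).source ↔ x.proj ∈ (extChartAt (𝓡 n) c).source := by
  simp only [stateChart, mfld_simps]
  rw [Trivialization.mem_source]
  have h1 : x.proj ∈ (chartAt (EuclideanSpace ℝ (Fin n)) c).source →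
      x.proj ∈ (trivializationAt
        (EuclideanSpace ℝ (Fin n) × EuclideanSpace ℝ (Fin n) × EuclideanSpace ℝ (Fin n))
        ((fun x : M => TangentSpace (𝓡 n) x) ×ᵇ
          ((fun x : M => TangentSpace (𝓡 n) x) ×ᵇ (fun x : M => TangentSpace (𝓡 n) x)))
        c).baseSet := fun h => ⟨h, h, h⟩
  exact ⟨fun h => h.1.1, fun h => ⟨h1 h, h⟩⟩

lemma mem_stateChart_target {c : M} {y : StateCoord n} :
    y ∈ (stateChart c).target ↔ y.1 ∈ (extChartAt (𝓡 n) c).target := by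
  simp only [stateChart, mfld_simps]
  rw [Trivialization.mem_target]
  refine ⟨fun h => h.1, fun h => ⟨h, ?_⟩⟩
  have := (chartAt _ c).map_target h
  exact ⟨this, this, this⟩

lemma trivializationAt_apply_eq_coords {c p : M} (hp : p ∈ (extChartAt (𝓡 n) c).source)
    (u : TangentSpace (𝓡 n) p) :
    (trivializationAt (EuclideanSpace ℝ (Fin n)) (fun x : M => TangentSpace (𝓡 n) x) c
      (⟨p, u⟩ : TangentBundle (𝓡 n) M)).2 = coords c p u := by
  rw [coords, Trivialization.continuousLinearMapAt_apply,
    Trivialization.coe_linearMapAt_of_mem _ (by simpa using hp)]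

lemma stateChart_apply {c : M} {x : State n M} (hx : x.proj ∈ (extChartAt (𝓡 n) c).source) :
    stateChart c x = (extChartAt (𝓡 n) c x.proj, coords c x.proj x.2.1, coords c x.proj x.2.2.1,
      coords c x.proj x.2.2.2) := by
  simp only [← trivializationAt_apply_eq_coords hx]
  rfl

instance [T2Space M] : T2Space (State n M) := by
  refine ⟨fun x y hxy => ?_⟩
  -- States over the same point lie in a common chart; states over different points are separated by
  -- their projections.
  by_cases h : x.proj = y.proj
  · have hx : x ∈ (stateChart x.proj).source := mem_stateChart_source.2 (mem_extChartAt_source _)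
    have hy : y ∈ (stateChart x.proj).source :=
      mem_stateChart_source.2 (h ▸ mem_extChartAt_source _)
    have hne : stateChart x.proj x ≠ stateChart x.proj y :=
      fun he => hxy ((stateChart x.proj).injOn hx hy he)
    obtain ⟨U, V, hU, hV, hxU, hyV, hd⟩ := t2_separation hne
    exact ⟨_, _, (stateChart x.proj).isOpen_inter_preimage hU,
      (stateChart x.proj).isOpen_inter_preimage hV, ⟨hx, hxU⟩, ⟨hy, hyV⟩,
      (hd.preimage _).mono inter_subset_right inter_subset_right⟩
  · obtain ⟨U, V, hU, hV, hxU, hyV, hd⟩ := t2_separation h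
    exact ⟨_, _, hU.preimage (FiberBundle.continuous_proj _ _),
      hV.preimage (FiberBundle.continuous_proj _ _), hxU, hyV, hd.preimage _⟩

lemma continuous_state_iff {X : Type*} [TopologicalSpace X] {f : X → State n M} {s : Set X}
    {x : X} : ContinuousWithinAt f s x ↔
      ContinuousWithinAt (fun a => (⟨(f a).proj, (f a).2.1⟩ : TangentBundle (𝓡 n) M)) s x ∧
      ContinuousWithinAt (fun a => (⟨(f a).proj, (f a).2.2.1⟩ : TangentBundle (𝓡 n) M)) s x ∧
      ContinuousWithinAt (fun a => (⟨(f a).proj, (f a).2.2.2⟩ : TangentBundle (𝓡 n) M)) s x := by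
  rw [(FiberBundle.Prod.isInducing_diag _ _ _ _).continuousWithinAt_iff, continuousWithinAt_prod_iff]
  refine and_congr Iff.rfl ?_
  change ContinuousWithinAt (fun a => (⟨(f a).proj, (f a).2.2⟩ : TotalSpace
    (EuclideanSpace ℝ (Fin n) × EuclideanSpace ℝ (Fin n))
    ((fun x : M => TangentSpace (𝓡 n) x) ×ᵇ (fun x : M => TangentSpace (𝓡 n) x)))) s x ↔ _
  rw [(FiberBundle.Prod.isInducing_diag _ _ _ _).continuousWithinAt_iff, continuousWithinAt_prod_iff]
  exact Iff.rfl

/-- The change of coordinates of states. -/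
def stateTransition (c c' : M) (z : StateCoord n) : StateCoord n :=
  (transition c c' z.1, fderiv ℝ (transition c c') z.1 z.2.1,
    fderiv ℝ (transition c c') z.1 z.2.2.1, fderiv ℝ (transition c c') z.1 z.2.2.2)

lemma stateTransition_apply {c c' : M} {x : State n M}
    (hx : x.proj ∈ (extChartAt (𝓡 n) c).source) (hx' : x.proj ∈ (extChartAt (𝓡 n) c').source) :
    stateTransition c c' (stateChart c x) = stateChart c' x := by
  rw [stateChart_apply hx, stateChart_apply hx']
  simp only [stateTransition, fderiv_transition hx hx', ofCoords_coords hx, transition_apply hx]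

/-- Vector components change by `Dτ`, taken at the moving base point, so their derivatives acquire
terms in `D²τ`. These match the inhomogeneous term in the transformation law of the Christoffel
symbols. -/
lemma hasFDerivAt_stateTransition {c c' p : M} (hp : p ∈ (extChartAt (𝓡 n) c).source)
    (hp' : p ∈ (extChartAt (𝓡 n) c').source) (w j k : EuclideanSpace ℝ (Fin n)) :
    ∃ A : StateCoord n →L[ℝ] StateCoord n,
      HasFDerivAt (stateTransition c c') A (extChartAt (𝓡 n) c p, w, j, k) ∧
      ∀ a b d e, A (a, b, d, e) = (fderiv ℝ (transition c c') (extChartAt (𝓡 n) c p) a,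
        fderiv ℝ (transition c c') (extChartAt (𝓡 n) c p) b
          + fderiv ℝ (fderiv ℝ (transition c c')) (extChartAt (𝓡 n) c p) a w,
        fderiv ℝ (transition c c') (extChartAt (𝓡 n) c p) d
          + fderiv ℝ (fderiv ℝ (transition c c')) (extChartAt (𝓡 n) c p) a j,
        fderiv ℝ (transition c c') (extChartAt (𝓡 n) c p) e
          + fderiv ℝ (fderiv ℝ (transition c c')) (extChartAt (𝓡 n) c p) a k) := by
  set z : StateCoord n := (extChartAt (𝓡 n) c p, w, j, k)
  have ht := contDiffAt_transition hp hp'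
  have h1 : HasFDerivAt (fun z : StateCoord n => transition c c' z.1) _ z :=
    HasFDerivAt.comp (f := fun z : StateCoord n => z.1) z
      (ht.differentiableAt (by simp)).hasFDerivAt hasFDerivAt_fst
  have h2 : HasFDerivAt (fun z : StateCoord n => fderiv ℝ (transition c c') z.1) _ z :=
    HasFDerivAt.comp (f := fun z : StateCoord n => z.1) z
      ((ht.fderiv_right (m := 1) (by norm_cast)).differentiableAt (by simp)).hasFDerivAt
      hasFDerivAt_fst
  have hs : HasFDerivAt (fun z : StateCoord n => z.2) (ContinuousLinearMap.snd ℝ _ _) z :=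
    hasFDerivAt_snd
  refine ⟨_, h1.prodMk ((h2.clm_apply hs.fst).prodMk ((h2.clm_apply hs.snd.fst).prodMk
    (h2.clm_apply hs.snd.snd))), fun a b d e => ?_⟩
  simp [z]

variable [RiemannianBundle (fun x : M => TangentSpace (𝓡 n) x)]

/-- The equations `γ' = w`, `Dw/dt = 0`, `Dj/dt = k`, `Dk/dt = -R(j, w)w` in a chart. -/
def jacobiField (c : M) (z : StateCoord n) : StateCoord n :=
  (z.2.1, -christoffelForm c z.1 z.2.1 z.2.1, z.2.2.2 - christoffelForm c z.1 z.2.1 z.2.2.1,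
    -curvatureForm c z.1 z.2.2.1 z.2.1 z.2.1 - christoffelForm c z.1 z.2.1 z.2.2.2)

variable [IsContMDiffRiemannianBundle (𝓡 n) ∞ (EuclideanSpace ℝ (Fin n))
      (fun x : M => TangentSpace (𝓡 n) x)]

set_option maxSynthPendingDepth 6 in
lemma contDiffAt_jacobiField {c : M} {z : StateCoord n}
    (hz : z.1 ∈ (extChartAt (𝓡 n) c).target) : ContDiffAt ℝ ∞ (jacobiField c) z := by
  have hΓ : ContDiffAt ℝ ∞ (fun z : StateCoord n => christoffelForm c z.1) z :=
    ContDiffAt.comp (f := fun z : StateCoord n => z.1) z (contDiffAt_christoffelForm hz)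
      contDiffAt_fst
  have hΓ' : ContDiffAt ℝ ∞ (fun z : StateCoord n => fderiv ℝ (christoffelForm c) z.1) z :=
    ContDiffAt.comp (f := fun z : StateCoord n => z.1) z
      ((contDiffAt_christoffelForm hz).fderiv_right (m := ∞) (by simp)) contDiffAt_fst
  have hw : ContDiffAt ℝ ∞ (fun z : StateCoord n => z.2.1) z := by fun_prop
  have hj : ContDiffAt ℝ ∞ (fun z : StateCoord n => z.2.2.1) z := by fun_prop
  have hk : ContDiffAt ℝ ∞ (fun z : StateCoord n => z.2.2.2) z := by fun_prop
  refine hw.prodMk (((hΓ.clm_apply hw).clm_apply hw).neg.prodMk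
    ((hk.sub ((hΓ.clm_apply hw).clm_apply hj)).prodMk (ContDiffAt.sub (ContDiffAt.neg ?_)
      ((hΓ.clm_apply hw).clm_apply hk))))
  exact (((((hΓ'.clm_apply hj).clm_apply hw).clm_apply hw).sub
    (((hΓ'.clm_apply hw).clm_apply hj).clm_apply hw)).add
    ((hΓ.clm_apply hj).clm_apply ((hΓ.clm_apply hw).clm_apply hw))).sub
    ((hΓ.clm_apply hw).clm_apply ((hΓ.clm_apply hj).clm_apply hw))

variable (n M) in
/-- The vector field on the state space whose integral curves are the geodesics with a Jacobi field
along them. -/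
def jacobiAtlas : FieldAtlas (State n M) (StateCoord n) M where
  chart := stateChart
  field := jacobiField
  index := fun x => x.proj
  mem_source := fun x => mem_stateChart_source.2 (mem_extChartAt_source _)
  contDiffAt_field := fun i y hy =>
    (contDiffAt_jacobiField (mem_stateChart_target.1 hy)).of_le (by norm_cast)
  compat := by
    intro c c' x hx hx'
    rw [mem_stateChart_source] at hx hx'
    obtain ⟨A, hA, hA'⟩ := hasFDerivAt_stateTransition hx hx' (coords c x.proj x.2.1)
      (coords c x.proj x.2.2.1) (coords c x.proj x.2.2.2)
    rw [← stateChart_apply hx] at hA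
    refine ⟨A, hA.congr_of_eventuallyEq ?_, ?_⟩
    · have hs := (stateChart c).map_source (mem_stateChart_source.2 hx)
      filter_upwards [(stateChart c).open_target.mem_nhds hs,
        ((stateChart c).continuousAt_symm hs).preimage_mem_nhds
          ((stateChart c').open_source.mem_nhds (by
            rw [(stateChart c).left_inv (mem_stateChart_source.2 hx)]
            exact mem_stateChart_source.2 hx'))] with z hz hz'
      have hq := (stateChart c).map_target hz
      have := stateTransition_apply (mem_stateChart_source.1 hq) (mem_stateChart_source.1 hz')
      rw [(stateChart c).right_inv hz] at this
      exact this.symm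
    -- In each of the last three components the second derivative of the transition map cancels
    -- against the one from the Christoffel symbols, while the curvature term transforms as a
    -- tensor.
    · rw [stateChart_apply hx, jacobiField, hA']
      simp only [map_neg, map_sub, fderiv_transition_christoffelForm hx hx',
        fderiv_transition_curvatureForm hx hx']
      simp only [fderiv_transition hx hx', ofCoords_coords hx, stateChart_apply hx', jacobiField]
      refine Prod.ext rfl (Prod.ext ?_ (Prod.ext ?_ ?_)) <;> simp only <;> abel

end StateSpace

/-- Bootstrapping: if `z` is `C^k`, then so is `f ∘ z = z'`, hence `z` is `C^(k+1)`. -/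
lemma contDiffOn_of_hasDerivAt_autonomous {F : Type*} [NormedAddCommGroup F] [NormedSpace ℝ F]
    {f : F → F} {z : ℝ → F} {I : Set ℝ} (hI : IsOpen I)
    (hz : ∀ t ∈ I, HasDerivAt z (f (z t)) t) (hf : ∀ t ∈ I, ContDiffAt ℝ ∞ f (z t)) :
    ContDiffOn ℝ ∞ z I := by
  refine contDiffOn_infty.2 fun k => ?_
  induction k with
  | zero => exact contDiffOn_zero.2 fun t ht => (hz t ht).continuousAt.continuousWithinAt
  | succ k ih =>
    rw [Nat.cast_add, Nat.cast_one, contDiffOn_succ_iff_deriv_of_isOpen hI]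
    refine ⟨fun t ht => (hz t ht).differentiableAt.differentiableWithinAt, by simp, ?_⟩
    refine ContDiffOn.congr (f := fun t => f (z t)) (fun t ht => ?_) fun t ht => (hz t ht).deriv
    exact (((hf t ht).of_le (by exact_mod_cast le_top)).comp t
      ((ih t ht).contDiffAt (hI.mem_nhds ht))).contDiffWithinAt

/-! ### Covariant derivatives along curves in arbitrary charts. -/

section Curves

variable {n : ℕ} {M : Type*} [TopologicalSpace M] [ChartedSpace (EuclideanSpace ℝ (Fin n)) M]
  {γ : ℝ → M} {t : ℝ} {c : M}

lemma eventually_mem_source (hγ : ContinuousAt γ t) (hc : γ t ∈ (extChartAt (𝓡 n) c).source) :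
    ∀ᶠ s in 𝓝 t, γ s ∈ (extChartAt (𝓡 n) c).source :=
  hγ.preimage_mem_nhds ((isOpen_extChartAt_source c).mem_nhds hc)

variable [IsManifold (𝓡 n) ∞ M] {V : ∀ t, TangentSpace (𝓡 n) (γ t)}

lemma hasDerivAt_extChartAt_comp (hγ : MDifferentiableAt 𝓘(ℝ, ℝ) (𝓡 n) γ t)
    (hc : γ t ∈ (extChartAt (𝓡 n) c).source) :
    HasDerivAt (fun s => extChartAt (𝓡 n) c (γ s)) (coords c (γ t) (velocity γ t)) t := by
  rw [extChartAt_source] at hc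
  have h1 := HasMFDerivAt.comp t (mdifferentiableAt_extChartAt (I := 𝓡 n) hc).hasMFDerivAt
    hγ.hasMFDerivAt
  have h2 : ∃ A : ℝ →L[ℝ] EuclideanSpace ℝ (Fin n), A 1 = coords c (γ t) (velocity γ t) ∧
      HasFDerivAt (fun s => extChartAt (𝓡 n) c (γ s)) A t := by
    rw [coords, TangentBundle.continuousLinearMapAt_trivializationAt hc]
    exact ⟨_, rfl, hasMFDerivAt_iff_hasFDerivAt.1 h1⟩
  obtain ⟨A, hA, hA'⟩ := h2
  exact hA ▸ hA'.hasDerivAt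

lemma contMDiffAt_iff_coords (hγ : ContMDiffAt 𝓘(ℝ, ℝ) (𝓡 n) ∞ γ t)
    (hc : γ t ∈ (extChartAt (𝓡 n) c).source) :
    ContMDiffAt 𝓘(ℝ, ℝ) (𝓡 n).tangent ∞ (fun s => (⟨γ s, V s⟩ : TangentBundle (𝓡 n) M)) t ↔
      ContDiffAt ℝ ∞ (fun s => coords c (γ s) (V s)) t := by
  rw [(trivializationAt (EuclideanSpace ℝ (Fin n)) (fun x : M => TangentSpace (𝓡 n) x)
    c).contMDiffAt_iff (by rw [Trivialization.mem_source]; simpa using hc), and_iff_right hγ,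
    contMDiffAt_iff_contDiffAt]
  have he : (fun s => (trivializationAt (EuclideanSpace ℝ (Fin n))
      (fun x : M => TangentSpace (𝓡 n) x) c (⟨γ s, V s⟩ : TangentBundle (𝓡 n) M)).2)
      =ᶠ[𝓝 t] fun s => coords c (γ s) (V s) := by
    filter_upwards [eventually_mem_source hγ.continuousAt hc] with s hs
    exact trivializationAt_apply_eq_coords hs (V s)
  exact ⟨fun h => h.congr_of_eventuallyEq he.symm, fun h => h.congr_of_eventuallyEq he⟩

lemma contDiffAt_extChartAt_comp (hγ : ContMDiffAt 𝓘(ℝ, ℝ) (𝓡 n) ∞ γ t)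
    (hc : γ t ∈ (extChartAt (𝓡 n) c).source) :
    ContDiffAt ℝ ∞ (fun s => extChartAt (𝓡 n) c (γ s)) t :=
  contMDiffAt_iff_contDiffAt.1
    ((contMDiffAt_iff_target_of_mem_source (by simpa using hc)).1 hγ).2

lemma contMDiffAt_velocity (hγ : ContMDiff 𝓘(ℝ, ℝ) (𝓡 n) ∞ γ) (t : ℝ) :
    ContMDiffAt 𝓘(ℝ, ℝ) (𝓡 n).tangent ∞
      (fun s => (⟨γ s, velocity γ s⟩ : TangentBundle (𝓡 n) M)) t := by
  have hc := mem_extChartAt_source (I := 𝓡 n) (γ t)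
  rw [contMDiffAt_iff_coords (hγ t) hc]
  refine (((contDiffAt_extChartAt_comp (hγ t) hc).fderiv_right (m := ∞) (by simp)).clm_apply
    (contDiffAt_const (c := (1 : ℝ)))).congr_of_eventuallyEq ?_
  filter_upwards [eventually_mem_source (hγ t).continuousAt hc] with s hs
  rw [fderiv_apply_one_eq_deriv,
    (hasDerivAt_extChartAt_comp ((hγ s).mdifferentiableAt (by simp)) hs).deriv]

variable [RiemannianBundle (fun x : M => TangentSpace (𝓡 n) x)]

/-- In the chart centred at `γ t` the formula is the definition, so no smoothness of the curve or
the field is required. -/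
lemma coords_covDeriv_self : coords (γ t) (γ t) (covDeriv γ V t) =
    deriv (fun s => coords (γ t) (γ s) (V s)) t
      + christoffelForm (γ t) (extChartAt (𝓡 n) (γ t) (γ t))
          (coords (γ t) (γ t) (velocity γ t)) (coords (γ t) (γ t) (V t)) := by
  rw [covDeriv, coords_ofCoords (mem_extChartAt_source _), christoffelForm_apply]

variable [IsContMDiffRiemannianBundle (𝓡 n) ∞ (EuclideanSpace ℝ (Fin n))
      (fun x : M => TangentSpace (𝓡 n) x)]

/-- The covariant derivative is given by the usual formula in every chart. -/
lemma coords_covDeriv (hγ : ContMDiffAt 𝓘(ℝ, ℝ) (𝓡 n) ∞ γ t)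
    (hV : ContMDiffAt 𝓘(ℝ, ℝ) (𝓡 n).tangent ∞ (fun s => (⟨γ s, V s⟩ : TangentBundle (𝓡 n) M)) t)
    (hc : γ t ∈ (extChartAt (𝓡 n) c).source) :
    coords c (γ t) (covDeriv γ V t) = deriv (fun s => coords c (γ s) (V s)) t
      + christoffelForm c (extChartAt (𝓡 n) c (γ t))
          (coords c (γ t) (velocity γ t)) (coords c (γ t) (V t)) := by
  have h0 := mem_extChartAt_source (I := 𝓡 n) (γ t)
  have hd := hasDerivAt_extChartAt_comp (hγ.mdifferentiableAt (by simp)) h0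
  have hV0 := (((contMDiffAt_iff_coords hγ h0).1 hV).differentiableAt (by simp)).hasDerivAt
  have hτ := ((contDiffAt_transition h0 hc).fderiv_right (m := 1) (by norm_cast)).differentiableAt
    (by simp)
  have h1 := (HasFDerivAt.comp_hasDerivAt (f := fun s => extChartAt (𝓡 n) (γ t) (γ s)) t
    hτ.hasFDerivAt hd).clm_apply hV0
  have h2 : HasDerivAt (fun s => coords c (γ s) (V s)) _ t := h1.congr_of_eventuallyEq (by
    filter_upwards [eventually_mem_source hγ.continuousAt h0,
      eventually_mem_source hγ.continuousAt hc] with s hs hs'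
    simp only [Function.comp_apply]
    rw [fderiv_transition hs hs', ofCoords_coords hs])
  have h3 := fderiv_transition_christoffelForm h0 hc (coords (γ t) (γ t) (velocity γ t))
    (coords (γ t) (γ t) (V t))
  rw [h2.deriv]
  simp only [fderiv_transition h0 hc, ofCoords_coords h0] at h3
  simp only [Function.comp_apply, fderiv_transition h0 hc]
  rw [covDeriv, map_add, map_add, ← christoffelForm_apply, h3]
  abel

end Curves

/-! ### Equations satisfied by the components of a solution. -/

section Solutions

lemma hasDerivAt_components {n : ℕ} {f : ℝ → StateCoord n} {f' : StateCoord n} {t : ℝ}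
    (h : HasDerivAt f f' t) :
    HasDerivAt (fun s => (f s).1) f'.1 t ∧ HasDerivAt (fun s => (f s).2.1) f'.2.1 t ∧
      HasDerivAt (fun s => (f s).2.2.1) f'.2.2.1 t ∧
      HasDerivAt (fun s => (f s).2.2.2) f'.2.2.2 t :=
  ⟨h.hasFDerivAt.fst.hasDerivAt.congr_deriv (by simp),
    h.hasFDerivAt.snd.fst.hasDerivAt.congr_deriv (by simp),
    h.hasFDerivAt.snd.snd.fst.hasDerivAt.congr_deriv (by simp),
    h.hasFDerivAt.snd.snd.snd.hasDerivAt.congr_deriv (by simp)⟩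

variable {n : ℕ} {M : Type*} [TopologicalSpace M] [ChartedSpace (EuclideanSpace ℝ (Fin n)) M]
  [IsManifold (𝓡 n) ∞ M] {σ : ℝ → State n M} {t : ℝ} {c : M}

/-- The coordinates of a state. -/
def stateCoords (c : M) (x : State n M) : StateCoord n :=
  (extChartAt (𝓡 n) c x.proj, coords c x.proj x.2.1, coords c x.proj x.2.2.1,
    coords c x.proj x.2.2.2)

lemma stateChart_comp_eventuallyEq (hσ : ContinuousAt (fun s => (σ s).proj) t)
    (hc : (σ t).proj ∈ (extChartAt (𝓡 n) c).source) :
    (fun s => stateCoords c (σ s)) =ᶠ[𝓝 t] stateChart c ∘ σ := by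
  filter_upwards [eventually_mem_source hσ hc] with s hs
  exact (stateChart_apply hs).symm

lemma continuous_proj : Continuous (fun x : State n M => x.proj) :=
  FiberBundle.continuous_proj _ _

variable [RiemannianBundle (fun x : M => TangentSpace (𝓡 n) x)]
  [IsContMDiffRiemannianBundle (𝓡 n) ∞ (EuclideanSpace ℝ (Fin n))
      (fun x : M => TangentSpace (𝓡 n) x)]

lemma solAt_continuousAt_proj (h : (jacobiAtlas n M).SolAt σ t) :
    ContinuousAt (fun s => (σ s).proj) t :=
  continuous_proj.continuousAt.comp h.1

lemma solAt_hasDerivAt (h : (jacobiAtlas n M).SolAt σ t)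
    (hc : (σ t).proj ∈ (extChartAt (𝓡 n) c).source) :
    HasDerivAt (fun s => stateCoords c (σ s)) (jacobiField c (stateCoords c (σ t))) t := by
  have h1 := h.2 c (mem_stateChart_source.2 hc)
  have h2 := stateChart_comp_eventuallyEq (solAt_continuousAt_proj h) hc
  rw [show stateCoords c (σ t) = stateChart c (σ t) from h2.eq_of_nhds]
  exact h1.congr_of_eventuallyEq h2

lemma solAt_of_hasDerivAt (hσ : ContinuousAt (fun s => (σ s).proj) t)
    (hc : (σ t).proj ∈ (extChartAt (𝓡 n) c).source)
    (h : HasDerivAt (fun s => stateCoords c (σ s)) (jacobiField c (stateCoords c (σ t))) t) :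
    (jacobiAtlas n M).SolAt σ t := by
  have h2 := stateChart_comp_eventuallyEq hσ hc
  have h1 := h.congr_of_eventuallyEq h2.symm
  have hs := mem_stateChart_source.2 hc
  refine FieldAtlas.solAt_of_chart (i := c) ?_ hs ?_
  · refine (((stateChart c).symm.continuousAt ((stateChart c).map_source hs)).comp
      (f := stateChart c ∘ σ) h1.continuousAt).congr ?_
    filter_upwards [eventually_mem_source hσ hc] with s hs
    exact (stateChart c).left_inv (mem_stateChart_source.2 hs)
  · rw [show stateCoords c (σ t) = stateChart c (σ t) from h2.eq_of_nhds] at h1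
    exact h1

/-- The derivative of the inner product of two fields along a curve. -/
lemma hasDerivAt_inner_of_coords {γ : ℝ → M} {V W : ∀ t, TangentSpace (𝓡 n) (γ t)}
    {V' W' : TangentSpace (𝓡 n) (γ t)} {u : EuclideanSpace ℝ (Fin n)}
    (hc : γ t ∈ (extChartAt (𝓡 n) c).source) (hγ : ContinuousAt γ t)
    (hd : HasDerivAt (fun s => extChartAt (𝓡 n) c (γ s)) u t)
    (hV : HasDerivAt (fun s => coords c (γ s) (V s)) (coords c (γ t) V' -
      christoffelForm c (extChartAt (𝓡 n) c (γ t)) u (coords c (γ t) (V t))) t)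
    (hW : HasDerivAt (fun s => coords c (γ s) (W s)) (coords c (γ t) W' -
      christoffelForm c (extChartAt (𝓡 n) c (γ t)) u (coords c (γ t) (W t))) t) :
    HasDerivAt (fun s => ⟪V s, W s⟫) (⟪V', W t⟫ + ⟪V t, W'⟫) t := by
  have hy := (extChartAt (𝓡 n) c).map_source hc
  have hG := ((contDiffAt_metricForm hy).differentiableAt (by simp)).hasFDerivAt
  have h1 := ((HasFDerivAt.comp_hasDerivAt (f := fun s => extChartAt (𝓡 n) c (γ s)) t
    hG hd).clm_apply hV).clm_apply hW
  have h2 := h1.congr_of_eventuallyEq (f₁ := fun s => ⟪V s, W s⟫) (by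
    filter_upwards [eventually_mem_source hγ hc] with s hs
    simp only [Function.comp_apply]
    rw [metricForm_extChartAt hs, ofCoords_coords hs, ofCoords_coords hs])
  refine h2.congr_deriv ?_
  simp only [Function.comp_apply, add_apply, fderiv_metricForm_eq hy, map_sub, sub_apply]
  simp only [metricForm_extChartAt hc, ofCoords_coords hc]
  ring

lemma coords_curvature (p : M) (u v w : TangentSpace (𝓡 n) p) :
    coords p p (curvature p u v w) = curvatureForm p (extChartAt (𝓡 n) p p) (coords p p u)
      (coords p p v) (coords p p w) := by
  rw [curvature, coords_ofCoords (mem_extChartAt_source p),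
    chartCurvature_eq (mem_extChartAt_target p)]

section

variable (h : (jacobiAtlas n M).SolAt σ t)
include h

lemma solAt_fst (hc : (σ t).proj ∈ (extChartAt (𝓡 n) c).source) :
    HasDerivAt (fun s => extChartAt (𝓡 n) c (σ s).proj) (coords c (σ t).proj (σ t).2.1) t :=
  (hasDerivAt_components (solAt_hasDerivAt h hc)).1

lemma solAt_vel (hc : (σ t).proj ∈ (extChartAt (𝓡 n) c).source) :
    HasDerivAt (fun s => coords c (σ s).proj (σ s).2.1)
      (-christoffelForm c (extChartAt (𝓡 n) c (σ t).proj) (coords c (σ t).proj (σ t).2.1)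
        (coords c (σ t).proj (σ t).2.1)) t :=
  (hasDerivAt_components (solAt_hasDerivAt h hc)).2.1

lemma solAt_field (hc : (σ t).proj ∈ (extChartAt (𝓡 n) c).source) :
    HasDerivAt (fun s => coords c (σ s).proj (σ s).2.2.1)
      (coords c (σ t).proj (σ t).2.2.2 - christoffelForm c (extChartAt (𝓡 n) c (σ t).proj)
        (coords c (σ t).proj (σ t).2.1) (coords c (σ t).proj (σ t).2.2.1)) t :=
  (hasDerivAt_components (solAt_hasDerivAt h hc)).2.2.1

lemma solAt_deriv_aux (hc : (σ t).proj ∈ (extChartAt (𝓡 n) c).source) :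
    HasDerivAt (fun s => coords c (σ s).proj (σ s).2.2.2)
      (-curvatureForm c (extChartAt (𝓡 n) c (σ t).proj) (coords c (σ t).proj (σ t).2.2.1)
        (coords c (σ t).proj (σ t).2.1) (coords c (σ t).proj (σ t).2.1)
        - christoffelForm c (extChartAt (𝓡 n) c (σ t).proj)
        (coords c (σ t).proj (σ t).2.1) (coords c (σ t).proj (σ t).2.2.2)) t :=
  (hasDerivAt_components (solAt_hasDerivAt h hc)).2.2.2

/-- The chart is the one around the footpoint, in which `curvature` is defined. The equation is
thereby in the shape that `hasDerivAt_inner_of_coords` expects. -/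
lemma solAt_curvature : HasDerivAt (fun s => coords (σ t).proj (σ s).proj (σ s).2.2.2)
      (coords (σ t).proj (σ t).proj (-curvature (σ t).proj (σ t).2.2.1 (σ t).2.1 (σ t).2.1)
        - christoffelForm (σ t).proj (extChartAt (𝓡 n) (σ t).proj (σ t).proj)
        (coords (σ t).proj (σ t).proj (σ t).2.1) (coords (σ t).proj (σ t).proj (σ t).2.2.2)) t := by
  rw [map_neg, coords_curvature]
  exact solAt_deriv_aux h (mem_extChartAt_source _)

lemma solAt_hasDerivAt_inner_vel : HasDerivAt (fun s => ⟪(σ s).2.1, (σ s).2.1⟫) 0 t := by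
  have hc := mem_extChartAt_source (I := 𝓡 n) (σ t).proj
  have h1 : HasDerivAt (fun s => coords (σ t).proj (σ s).proj (σ s).2.1)
      (coords (σ t).proj (σ t).proj 0 - christoffelForm (σ t).proj
        (extChartAt (𝓡 n) (σ t).proj (σ t).proj) (coords (σ t).proj (σ t).proj (σ t).2.1)
        (coords (σ t).proj (σ t).proj (σ t).2.1)) t := by
    rw [map_zero, zero_sub]
    exact solAt_vel h hc
  simpa using hasDerivAt_inner_of_coords (γ := fun s => (σ s).proj) (V := fun s => (σ s).2.1)
    (W := fun s => (σ s).2.1) hc (solAt_continuousAt_proj h) (solAt_fst h hc) h1 h1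

lemma solAt_hasDerivAt_inner_field :
    HasDerivAt (fun s => ⟪(σ s).2.2.1, (σ s).2.2.1⟫) (2 * ⟪(σ t).2.2.2, (σ t).2.2.1⟫) t := by
  have hc := mem_extChartAt_source (I := 𝓡 n) (σ t).proj
  have h1 := solAt_field h hc
  have := hasDerivAt_inner_of_coords (γ := fun s => (σ s).proj) (V := fun s => (σ s).2.2.1)
    (W := fun s => (σ s).2.2.1) hc (solAt_continuousAt_proj h) (solAt_fst h hc) h1 h1
  rw [real_inner_comm, ← two_mul] at this
  rwa [real_inner_comm]

/-- This is half of the second derivative of `|J|²`, the quantity whose sign the curvature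
assumption controls. -/
lemma solAt_hasDerivAt_inner_deriv :
    HasDerivAt (fun s => ⟪(σ s).2.2.2, (σ s).2.2.1⟫)
      (⟪-curvature (σ t).proj (σ t).2.2.1 (σ t).2.1 (σ t).2.1, (σ t).2.2.1⟫
        + ⟪(σ t).2.2.2, (σ t).2.2.2⟫) t := by
  have hc := mem_extChartAt_source (I := 𝓡 n) (σ t).proj
  exact hasDerivAt_inner_of_coords (γ := fun s => (σ s).proj) (V := fun s => (σ s).2.2.2)
    (W := fun s => (σ s).2.2.1) hc (solAt_continuousAt_proj h) (solAt_fst h hc)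
    (solAt_curvature h) (solAt_field h hc)

end

end Solutions

/-! ### Solutions correspond to geodesics with Jacobi fields. -/

section Lift

variable {n : ℕ} {M : Type*} [TopologicalSpace M] [ChartedSpace (EuclideanSpace ℝ (Fin n)) M]
  [IsManifold (𝓡 n) ∞ M] {σ : ℝ → State n M} {t : ℝ} {c : M}
  {γ : ℝ → M} {J K J₁ K₁ J₂ K₂ : ∀ t, TangentSpace (𝓡 n) (γ t)}

/-- The curve of states given by a curve and two vector fields along it. -/
def lift (γ : ℝ → M) (J K : ∀ t, TangentSpace (𝓡 n) (γ t)) (t : ℝ) : State n M :=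
  ⟨γ t, (velocity γ t, J t, K t)⟩

variable [RiemannianBundle (fun x : M => TangentSpace (𝓡 n) x)]

lemma curvatureForm_add_smul (c : M) (y w j₁ j₂ : EuclideanSpace ℝ (Fin n)) (a b : ℝ) :
    curvatureForm c y (a • j₁ + b • j₂) w w
      = a • curvatureForm c y j₁ w w + b • curvatureForm c y j₂ w w := by
  simp only [curvatureForm, map_add, map_smul, add_apply, smul_apply]
  module

lemma hasDerivAt_velocity_of_isGeodesic (hγ : IsGeodesic (n := n) γ) (t : ℝ) :
    HasDerivAt (fun s => coords (γ t) (γ s) (velocity γ s))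
      (-christoffelForm (γ t) (extChartAt (𝓡 n) (γ t) (γ t)) (coords (γ t) (γ t) (velocity γ t))
        (coords (γ t) (γ t) (velocity γ t))) t := by
  have hc := mem_extChartAt_source (I := 𝓡 n) (γ t)
  have h1 := ((contMDiffAt_iff_coords (hγ.1 t) hc).1
    (contMDiffAt_velocity hγ.1 t)).differentiableAt (by simp)
  have h2 := coords_covDeriv_self (γ := γ) (V := velocity (n := n) γ) (t := t)
  rw [hγ.2 t, map_zero] at h2
  exact h1.hasDerivAt.congr_deriv (eq_neg_of_add_eq_zero_left h2.symm)

variable [IsContMDiffRiemannianBundle (𝓡 n) ∞ (EuclideanSpace ℝ (Fin n))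
      (fun x : M => TangentSpace (𝓡 n) x)]

lemma contDiffAt_stateCoords (h : ∀ᶠ s in 𝓝 t, (jacobiAtlas n M).SolAt σ s)
    (hc : (σ t).proj ∈ (extChartAt (𝓡 n) c).source) :
    ContDiffAt ℝ ∞ (fun s => stateCoords c (σ s)) t := by
  obtain ⟨I, hI, hIo, ht⟩ := mem_nhds_iff.1 (h.and
    (eventually_mem_source (solAt_continuousAt_proj h.self_of_nhds) hc))
  exact (contDiffOn_of_hasDerivAt_autonomous hIo
    (fun s hs => solAt_hasDerivAt (hI hs).1 (hI hs).2)
    fun s hs => contDiffAt_jacobiField ((extChartAt (𝓡 n) c).map_source (hI hs).2)).contDiffAt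
      (hIo.mem_nhds ht)

lemma contMDiffAt_proj_of_sol (h : ∀ᶠ s in 𝓝 t, (jacobiAtlas n M).SolAt σ s) :
    ContMDiffAt 𝓘(ℝ, ℝ) (𝓡 n) ∞ (fun s => (σ s).proj) t :=
  (contMDiffAt_iff_target (I' := 𝓡 n)).2 ⟨solAt_continuousAt_proj h.self_of_nhds,
    contMDiffAt_iff_contDiffAt.2
      (contDiffAt_stateCoords h (mem_extChartAt_source (I := 𝓡 n) (σ t).proj)).fst⟩

lemma velocity_of_solAt (h : ∀ᶠ s in 𝓝 t, (jacobiAtlas n M).SolAt σ s) :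
    velocity (n := n) (fun s => (σ s).proj) t = (σ t).2.1 := by
  have hc := mem_extChartAt_source (I := 𝓡 n) (σ t).proj
  exact coords_injective hc ((hasDerivAt_extChartAt_comp
    ((contMDiffAt_proj_of_sol h).mdifferentiableAt (by simp)) hc).unique
      (solAt_fst h.self_of_nhds hc))

section

variable (h : ∀ t, (jacobiAtlas n M).SolAt σ t)
include h

lemma contMDiff_proj_of_sol : ContMDiff 𝓘(ℝ, ℝ) (𝓡 n) ∞ fun s => (σ s).proj :=
  fun _ => contMDiffAt_proj_of_sol (Eventually.of_forall h)

lemma contMDiff_field_of_sol : ContMDiff 𝓘(ℝ, ℝ) (𝓡 n).tangent ∞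
    fun s => (⟨(σ s).proj, (σ s).2.2.1⟩ : TangentBundle (𝓡 n) M) := by
  intro t
  have hc := mem_extChartAt_source (I := 𝓡 n) (σ t).proj
  exact (contMDiffAt_iff_coords (V := fun s => (σ s).2.2.1) (contMDiff_proj_of_sol h t) hc).2
    (contDiffAt_stateCoords (Eventually.of_forall h) hc).snd.snd.fst

lemma velocity_of_sol : velocity (n := n) (fun s => (σ s).proj) = fun s => (σ s).2.1 :=
  funext fun _ => velocity_of_solAt (Eventually.of_forall h)

lemma eq_lift_of_sol : σ = lift (fun s => (σ s).proj) (fun s => (σ s).2.2.1)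
    fun s => (σ s).2.2.2 := by
  funext t
  rw [lift, velocity_of_sol h]

lemma isGeodesic_of_sol : IsGeodesic (n := n) fun s => (σ s).proj := by
  refine ⟨contMDiff_proj_of_sol h, fun t => ?_⟩
  have hc := mem_extChartAt_source (I := 𝓡 n) (σ t).proj
  refine coords_injective hc ?_
  rw [velocity_of_sol h]
  refine (coords_covDeriv_self (γ := fun s => (σ s).proj) (V := fun s => (σ s).2.1)).trans ?_
  rw [velocity_of_sol h, (solAt_vel (h t) hc).deriv, map_zero, neg_add_cancel]

lemma covDeriv_field_of_sol :
    covDeriv (fun s => (σ s).proj) (fun s => (σ s).2.2.1) = fun s => (σ s).2.2.2 := by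
  funext t
  have hc := mem_extChartAt_source (I := 𝓡 n) (σ t).proj
  refine coords_injective hc ?_
  refine (coords_covDeriv_self (γ := fun s => (σ s).proj) (V := fun s => (σ s).2.2.1)).trans ?_
  rw [velocity_of_sol h, (solAt_field (h t) hc).deriv, sub_add_cancel]

lemma isJacobiField_of_sol : IsJacobiField (fun s => (σ s).proj) fun s => (σ s).2.2.1 := by
  refine ⟨contMDiff_field_of_sol h, fun t => ?_⟩
  have hc := mem_extChartAt_source (I := 𝓡 n) (σ t).proj
  refine coords_injective hc ?_
  rw [covDeriv_field_of_sol h, velocity_of_sol h, map_add, map_zero]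
  refine (congrArg₂ (· + ·) (coords_covDeriv_self (γ := fun s => (σ s).proj)
    (V := fun s => (σ s).2.2.2)) rfl).trans ?_
  rw [velocity_of_sol h, (solAt_curvature (h t)).deriv, map_neg]
  abel

end

/-- One chart suffices, and the remaining equation, for the footpoint, holds automatically because
`lift` carries the true velocity. -/
lemma solAt_lift_iff (hγ : ContMDiff 𝓘(ℝ, ℝ) (𝓡 n) ∞ γ)
    (hc : γ t ∈ (extChartAt (𝓡 n) c).source) :
    (jacobiAtlas n M).SolAt (lift γ J K) t ↔
      HasDerivAt (fun s => coords c (γ s) (velocity γ s))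
        (-christoffelForm c (extChartAt (𝓡 n) c (γ t)) (coords c (γ t) (velocity γ t))
          (coords c (γ t) (velocity γ t))) t ∧
      HasDerivAt (fun s => coords c (γ s) (J s)) (coords c (γ t) (K t)
        - christoffelForm c (extChartAt (𝓡 n) c (γ t)) (coords c (γ t) (velocity γ t))
          (coords c (γ t) (J t))) t ∧
      HasDerivAt (fun s => coords c (γ s) (K s))
        (-curvatureForm c (extChartAt (𝓡 n) c (γ t)) (coords c (γ t) (J t))
          (coords c (γ t) (velocity γ t)) (coords c (γ t) (velocity γ t))
        - christoffelForm c (extChartAt (𝓡 n) c (γ t)) (coords c (γ t) (velocity γ t))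
          (coords c (γ t) (K t))) t := by
  constructor
  · intro h
    exact ⟨solAt_vel h hc, solAt_field h hc, solAt_deriv_aux h hc⟩
  · rintro ⟨h1, h2, h3⟩
    exact solAt_of_hasDerivAt (hγ t).continuousAt hc ((hasDerivAt_extChartAt_comp
      ((hγ t).mdifferentiableAt (by simp)) hc).prodMk (h1.prodMk (h2.prodMk h3)))

/-- Over a fixed geodesic the equations for the field and its derivative are linear. -/
lemma solAt_lift_combination (hγ : ContMDiff 𝓘(ℝ, ℝ) (𝓡 n) ∞ γ) (a b : ℝ)
    (h₁ : (jacobiAtlas n M).SolAt (lift γ J₁ K₁) t)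
    (h₂ : (jacobiAtlas n M).SolAt (lift γ J₂ K₂) t) :
    (jacobiAtlas n M).SolAt (lift γ (fun s => a • J₁ s + b • J₂ s)
      fun s => a • K₁ s + b • K₂ s) t := by
  have hc := mem_extChartAt_source (I := 𝓡 n) (γ t)
  rw [solAt_lift_iff hγ hc] at *
  refine ⟨h₁.1, ?_, ?_⟩
  · simp only [map_add, map_smul]
    refine ((h₁.2.1.const_smul a).add (h₂.2.1.const_smul b)).congr_deriv ?_
    module
  · simp only [map_add, map_smul, curvatureForm_add_smul]
    refine ((h₁.2.2.const_smul a).add (h₂.2.2.const_smul b)).congr_deriv ?_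
    module

lemma solAt_lift_zero (hγ : IsGeodesic (n := n) γ) (t : ℝ) :
    (jacobiAtlas n M).SolAt (lift γ (fun _ => 0) fun _ => 0) t := by
  rw [solAt_lift_iff hγ.1 (mem_extChartAt_source (I := 𝓡 n) (γ t))]
  refine ⟨hasDerivAt_velocity_of_isGeodesic hγ t, ?_, ?_⟩
  · simpa using hasDerivAt_const t (0 : EuclideanSpace ℝ (Fin n))
  · simpa [curvatureForm] using hasDerivAt_const t (0 : EuclideanSpace ℝ (Fin n))

lemma solAt_lift_covDeriv (hγ : IsGeodesic (n := n) γ) (hJ : IsJacobiField γ J) (t : ℝ) :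
    (jacobiAtlas n M).SolAt (lift γ J (covDeriv γ J)) t := by
  have hc := mem_extChartAt_source (I := 𝓡 n) (γ t)
  rw [solAt_lift_iff hγ.1 hc]
  have hJs := (contMDiffAt_iff_coords (hγ.1 t) hc).1 (hJ.1 t)
  refine ⟨hasDerivAt_velocity_of_isGeodesic hγ t, ?_, ?_⟩
  · refine (hJs.differentiableAt (by simp)).hasDerivAt.congr_deriv ?_
    rw [coords_covDeriv_self, add_sub_cancel_right]
  -- `covDeriv` uses a different chart at every time. To differentiate it at `t` it must be
  -- expressed in the fixed chart around `γ t` at all nearby times.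
  · have hev : (fun s => coords (γ t) (γ s) (covDeriv γ J s)) =ᶠ[𝓝 t] fun s =>
        fderiv ℝ (fun s => coords (γ t) (γ s) (J s)) s 1
          + christoffelForm (γ t) (extChartAt (𝓡 n) (γ t) (γ s))
            (coords (γ t) (γ s) (velocity γ s)) (coords (γ t) (γ s) (J s)) := by
      filter_upwards [eventually_mem_source (hγ.1 t).continuousAt hc] with s hs
      rw [coords_covDeriv (hγ.1 s) (hJ.1 s) hs, fderiv_apply_one_eq_deriv]
    have hd : DifferentiableAt ℝ (fun s => coords (γ t) (γ s) (covDeriv γ J s)) t := by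
      refine DifferentiableAt.congr_of_eventuallyEq ?_ hev
      have h1 := (contDiffAt_christoffelForm (mem_extChartAt_target (I := 𝓡 n) (γ t))).comp t
        (contDiffAt_extChartAt_comp (hγ.1 t) hc)
      have h2 := (contMDiffAt_iff_coords (hγ.1 t) hc).1 (contMDiffAt_velocity hγ.1 t)
      have h3 := (hJs.fderiv_right (m := ∞) (by simp)).clm_apply (contDiffAt_const (c := (1 : ℝ)))
      exact (h3.add ((h1.clm_apply h2).clm_apply hJs)).differentiableAt (by simp)
    have h2 := coords_covDeriv_self (γ := γ) (V := covDeriv γ J) (t := t)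
    rw [eq_neg_of_add_eq_zero_left (hJ.2 t), map_neg, coords_curvature] at h2
    exact hd.hasDerivAt.congr_deriv (eq_sub_of_add_eq h2.symm)

end Lift

/-! ### Completeness of the geodesic flow with Jacobi fields. -/

lemma exists_tendsto_of_lipschitzOnWith {α : Type*} [PseudoEMetricSpace α] [CompleteSpace α]
    {f : ℝ → α} {l : Filter ℝ} (hl : Cauchy l) {S : Set ℝ} (hS : S ∈ l) {C : NNReal}
    (hf : LipschitzOnWith C f S) : ∃ x, Tendsto f l (𝓝 x) :=
  CompleteSpace.complete (hl.map_of_le hf.uniformContinuousOn (le_principal_iff.2 hS))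

/-- The function `log (1 + |j|² + |k|²)` has derivative at most `4 |D|` in absolute value, so it
stays bounded on a bounded interval. -/
lemma exists_bound_of_linear_growth {E : Type*} [NormedAddCommGroup E] [InnerProductSpace ℝ E]
    {j k j' k' : ℝ → E} {c d D : ℝ} (hj : ∀ s ∈ Ioo c d, HasDerivAt j (j' s) s)
    (hk : ∀ s ∈ Ioo c d, HasDerivAt k (k' s) s)
    (hj' : ∀ s ∈ Ioo c d, ‖j' s‖ ≤ D * (‖j s‖ + ‖k s‖))
    (hk' : ∀ s ∈ Ioo c d, ‖k' s‖ ≤ D * (‖j s‖ + ‖k s‖)) :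
    ∃ R, ∀ s ∈ Ioo c d, ‖j s‖ ≤ R ∧ ‖k s‖ ≤ R := by
  rcases (Ioo c d).eq_empty_or_nonempty with he | ⟨m, hm⟩
  · exact ⟨0, by simp [he]⟩
  have hd : ∀ s ∈ Ioo c d, HasDerivAt (fun s => Real.log (1 + ‖j s‖ ^ 2 + ‖k s‖ ^ 2))
      ((2 * ⟪j s, j' s⟫ + 2 * ⟪k s, k' s⟫) / (1 + ‖j s‖ ^ 2 + ‖k s‖ ^ 2)) s := fun s hs =>
    ((((hj s hs).norm_sq).const_add 1).add (hk s hs).norm_sq).log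
      (by positivity : (0 : ℝ) < 1 + ‖j s‖ ^ 2 + ‖k s‖ ^ 2).ne'
  have hb : ∀ s ∈ Ioo c d, ‖(2 * ⟪j s, j' s⟫ + 2 * ⟪k s, k' s⟫) /
      (1 + ‖j s‖ ^ 2 + ‖k s‖ ^ 2)‖ ≤ 4 * |D| := by
    intro s hs
    rw [norm_div, Real.norm_eq_abs, Real.norm_eq_abs,
      abs_of_pos (a := 1 + ‖j s‖ ^ 2 + ‖k s‖ ^ 2) (by positivity), div_le_iff₀ (by positivity)]
    have h1 := (abs_real_inner_le_norm (j s) (j' s)).trans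
      (mul_le_mul_of_nonneg_left (hj' s hs) (norm_nonneg _))
    have h2 := (abs_real_inner_le_norm (k s) (k' s)).trans
      (mul_le_mul_of_nonneg_left (hk' s hs) (norm_nonneg _))
    have h3 := abs_add_le (2 * ⟪j s, j' s⟫) (2 * ⟪k s, k' s⟫)
    rw [abs_mul, abs_mul, abs_two] at h3
    have h4 : D * (‖j s‖ + ‖k s‖) ^ 2 ≤ |D| * (‖j s‖ + ‖k s‖) ^ 2 :=
      mul_le_mul_of_nonneg_right (le_abs_self D) (sq_nonneg _)
    have h5 : |D| * (‖j s‖ + ‖k s‖) ^ 2 ≤ |D| * (2 * (1 + ‖j s‖ ^ 2 + ‖k s‖ ^ 2)) :=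
      mul_le_mul_of_nonneg_left (by nlinarith [sq_nonneg (‖j s‖ - ‖k s‖)]) (abs_nonneg D)
    nlinarith
  have hlip : ∀ s ∈ Ioo c d, Real.log (1 + ‖j s‖ ^ 2 + ‖k s‖ ^ 2) ≤
      Real.log (1 + ‖j m‖ ^ 2 + ‖k m‖ ^ 2) + 4 * |D| * (d - c) := by
    intro s hs
    have h1 := (convex_Ioo c d).norm_image_sub_le_of_norm_hasDerivWithin_le
      (fun x hx => (hd x hx).hasDerivWithinAt) hb hm hs
    have h2 := (le_abs_self _).trans h1
    have h3 : ‖s - m‖ ≤ d - c := abs_le.2 ⟨by linarith [hs.1, hm.2], by linarith [hs.2, hm.1]⟩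
    nlinarith [mul_le_mul_of_nonneg_left h3 (by positivity : 0 ≤ 4 * |D|)]
  set L := Real.exp (Real.log (1 + ‖j m‖ ^ 2 + ‖k m‖ ^ 2) + 4 * |D| * (d - c))
  have hL : ∀ s ∈ Ioo c d, 1 + ‖j s‖ ^ 2 + ‖k s‖ ^ 2 ≤ L := fun s hs => by
    rw [← Real.log_le_iff_le_exp (by positivity)]
    exact hlip s hs
  refine ⟨1 + L, fun s hs => ⟨?_, ?_⟩⟩
  · nlinarith [hL s hs, sq_nonneg (‖j s‖ - 1), sq_nonneg ‖k s‖]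
  · nlinarith [hL s hs, sq_nonneg (‖k s‖ - 1), sq_nonneg ‖j s‖]

section Metric

variable {n : ℕ} {M : Type*} [TopologicalSpace M] [ChartedSpace (EuclideanSpace ℝ (Fin n)) M]
  [IsManifold (𝓡 n) ∞ M] [RiemannianBundle (fun x : M => TangentSpace (𝓡 n) x)]

instance isContinuousRiemannianBundle_of_isContMDiff [h : IsContMDiffRiemannianBundle (𝓡 n) ∞
    (EuclideanSpace ℝ (Fin n)) (fun x : M => TangentSpace (𝓡 n) x)] :
    IsContinuousRiemannianBundle (EuclideanSpace ℝ (Fin n))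
      (fun x : M => TangentSpace (𝓡 n) x) := by
  obtain ⟨g, hg, hg'⟩ := h.exists_contMDiff
  exact ⟨g, hg.continuous, hg'⟩

lemma norm_christoffelForm_le (c : M) (y u w : EuclideanSpace ℝ (Fin n)) :
    ‖christoffelForm c y u w‖ ≤ ‖christoffelForm (n := n) c y‖ * ‖u‖ * ‖w‖ :=
  (christoffelForm c y).le_opNorm₂ u w

set_option maxSynthPendingDepth 6 in
lemma norm_fderiv_christoffelForm_le (c : M) (y u v w : EuclideanSpace ℝ (Fin n)) :
    ‖fderiv ℝ (christoffelForm c) y u v w‖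
      ≤ ‖fderiv ℝ (christoffelForm (n := n) c) y‖ * ‖u‖ * ‖v‖ * ‖w‖ :=
  ((fderiv ℝ (christoffelForm c) y u).le_opNorm₂ v w).trans (by
    gcongr
    exact ContinuousLinearMap.le_opNorm _ _)

set_option maxSynthPendingDepth 6 in
lemma norm_curvatureForm_le (c : M) (y u w : EuclideanSpace ℝ (Fin n)) :
    ‖curvatureForm c y u w w‖ ≤ 2 * (‖fderiv ℝ (christoffelForm (n := n) c) y‖
      + ‖christoffelForm (n := n) c y‖ ^ 2) * ‖w‖ ^ 2 * ‖u‖ := by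
  have h1 := norm_fderiv_christoffelForm_le c y u w w
  have h2 := norm_fderiv_christoffelForm_le c y w u w
  have h3 := norm_christoffelForm_le c y u (christoffelForm c y w w)
  have h4 := norm_christoffelForm_le c y w (christoffelForm c y u w)
  have h5 := mul_le_mul_of_nonneg_left (norm_christoffelForm_le c y w w)
    (by positivity : 0 ≤ ‖christoffelForm (n := n) c y‖ * ‖u‖)
  have h6 := mul_le_mul_of_nonneg_left (norm_christoffelForm_le c y u w)
    (by positivity : 0 ≤ ‖christoffelForm (n := n) c y‖ * ‖w‖)
  rw [curvatureForm]
  refine (norm_sub_le _ _).trans ?_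
  have h7 := (norm_add_le (fderiv ℝ (christoffelForm c) y u w w - fderiv ℝ (christoffelForm c) y w u w)
    (christoffelForm c y u (christoffelForm c y w w))).trans (add_le_add_left (norm_sub_le _ _) _)
  nlinarith

end Metric

section Complete

variable {n : ℕ} {M : Type*} [EMetricSpace M] [ChartedSpace (EuclideanSpace ℝ (Fin n)) M]
  [IsManifold (𝓡 n) ∞ M] {σ : ℝ → State n M} {a b : ℝ}
  [RiemannianBundle (fun x : M => TangentSpace (𝓡 n) x)]
  [IsContMDiffRiemannianBundle (𝓡 n) ∞ (EuclideanSpace ℝ (Fin n))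
      (fun x : M => TangentSpace (𝓡 n) x)]

/-- The speed of a geodesic is constant because `|γ'|²` has derivative zero. -/
lemma exists_norm_vel_eq (h : ∀ s ∈ Ioo a b, (jacobiAtlas n M).SolAt σ s) :
    ∃ L : NNReal, ∀ s ∈ Ioo a b, ‖(σ s).2.1‖ = L := by
  rcases (Ioo a b).eq_empty_or_nonempty with he | ⟨m, hm⟩
  · exact ⟨0, by simp [he]⟩
  refine ⟨⟨‖(σ m).2.1‖, norm_nonneg _⟩, fun s hs => ?_⟩
  have h1 := (convex_Ioo a b).norm_image_sub_le_of_norm_hasDerivWithin_le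
      (fun x hx => (solAt_hasDerivAt_inner_vel (h x hx)).hasDerivWithinAt) (C := 0) (by simp) hm hs
  rw [zero_mul, norm_le_zero_iff, sub_eq_zero, real_inner_self_eq_norm_sq,
    real_inner_self_eq_norm_sq] at h1
  exact (sq_eq_sq₀ (norm_nonneg _) (norm_nonneg _)).1 h1

/-- The Riemannian distance is at most the length of the arc, which is `L` times the elapsed time.
-/
lemma lipschitzOnWith_proj [IsRiemannianManifold (𝓡 n) M]
    (h : ∀ s ∈ Ioo a b, (jacobiAtlas n M).SolAt σ s) {L : NNReal}
    (hL : ∀ s ∈ Ioo a b, ‖(σ s).2.1‖ = L) : LipschitzOnWith L (fun s => (σ s).proj) (Ioo a b) := by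
  have hev : ∀ t ∈ Ioo a b, ∀ᶠ s in 𝓝 t, (jacobiAtlas n M).SolAt σ s := fun t ht =>
    eventually_of_mem (isOpen_Ioo.mem_nhds ht) h
  have key : ∀ s ∈ Ioo a b, ∀ t ∈ Ioo a b, s ≤ t →
      edist (σ s).proj (σ t).proj ≤ L * edist s t := by
    intro s hs t ht hst
    have hsub : Icc s t ⊆ Ioo a b := Icc_subset_Ioo hs.1 ht.2
    rw [IsRiemannianManifold.out (I := 𝓡 n)]
    refine (riemannianEDist_le_pathELength (I := 𝓡 n) (γ := fun s => (σ s).proj)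
      (fun x hx => ((contMDiffAt_proj_of_sol (hev x (hsub hx))).of_le
        (by norm_cast)).contMDiffWithinAt) rfl rfl hst).trans ?_
    rw [pathELength_eq_lintegral_mfderiv_Icc]
    have hn : ∀ x ∈ Icc s t,
        ‖mfderiv 𝓘(ℝ, ℝ) (𝓡 n) (fun s => (σ s).proj) x (1 : ℝ)‖ₑ = L := by
      intro x hx
      have h1 : mfderiv 𝓘(ℝ, ℝ) (𝓡 n) (fun s => (σ s).proj) x (1 : ℝ) = (σ x).2.1 :=
        velocity_of_solAt (hev x (hsub hx))
      rw [h1, ← ofReal_norm, hL x (hsub hx), ENNReal.ofReal_coe_nnreal]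
    refine (MeasureTheory.setLIntegral_congr_fun measurableSet_Icc hn).trans_le ?_
    simp [edist_dist, Real.dist_eq, abs_of_nonpos (sub_nonpos.2 hst)]
  intro s hs t ht
  rcases le_total s t with hst | hst
  · exact key s hs t ht hst
  · rw [edist_comm, edist_comm s]
    exact key t ht s hs hst

-- The footpoint converges to some `q` by completeness. In the chart around `q` velocity,
-- Christoffel symbols and curvature are bounded near the end, so the field and its derivative are
-- bounded by linear growth. All coordinates are then Lipschitz and converge. The filter `l` stands
-- for a one-sided neighbourhood of either endpoint.
set_option maxSynthPendingDepth 6 in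
lemma exists_tendsto_of_solAt [IsRiemannianManifold (𝓡 n) M] [CompleteSpace M] {l : Filter ℝ}
    (hl : Cauchy l) (hb : ∀ s ∈ l, ∃ c d, Ioo c d ∈ l ∧ Ioo c d ⊆ s)
    (hsol : ∀ᶠ s in l, (jacobiAtlas n M).SolAt σ s) : ∃ x, Tendsto σ l (𝓝 x) := by
  obtain ⟨a, b, hab, hsub⟩ := hb _ hsol
  obtain ⟨L, hL⟩ := exists_norm_vel_eq hsub
  obtain ⟨q, hq⟩ := exists_tendsto_of_lipschitzOnWith hl hab (lipschitzOnWith_proj hsub hL)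
  have hqs := mem_extChartAt_source (I := 𝓡 n) q
  have hqt := (extChartAt (𝓡 n) q).map_source hqs
  -- `C` compares coordinate norms with Riemannian norms near `q`, which turns the constant speed
  -- into a bound on the velocity components.
  obtain ⟨C, hC, hCq⟩ := eventually_norm_trivializationAt_lt (EuclideanSpace ℝ (Fin n))
    (fun x : M => TangentSpace (𝓡 n) x) q
  have hy : Tendsto (fun s => extChartAt (𝓡 n) q (σ s).proj) l (𝓝 (extChartAt (𝓡 n) q q)) :=
    (continuousAt_extChartAt q).tendsto.comp hq
  have hΓ : ContinuousAt (fun y => ‖christoffelForm (n := n) q y‖) (extChartAt (𝓡 n) q q) :=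
    have h0 : ContinuousAt (christoffelForm (n := n) q) (extChartAt (𝓡 n) q q) :=
      (contDiffAt_christoffelForm hqt).continuousAt
    h0.norm
  have hΓ' : ContinuousAt (fun y => ‖fderiv ℝ (christoffelForm (n := n) q) y‖)
      (extChartAt (𝓡 n) q q) :=
    have h0 : ContinuousAt (fderiv ℝ (christoffelForm (n := n) q)) (extChartAt (𝓡 n) q q) :=
      ((contDiffAt_christoffelForm hqt).fderiv_right (m := ∞) (by simp)).continuousAt
    h0.norm
  obtain ⟨D, hD⟩ : ∃ D, ∀ᶠ y in 𝓝 (extChartAt (𝓡 n) q q), ‖christoffelForm (n := n) q y‖ ≤ D :=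
    ⟨_, (hΓ.eventually_lt_const (lt_add_one _)).mono fun _ => le_of_lt⟩
  obtain ⟨D', hD'⟩ : ∃ D, ∀ᶠ y in 𝓝 (extChartAt (𝓡 n) q q),
      ‖fderiv ℝ (christoffelForm (n := n) q) y‖ ≤ D :=
    ⟨_, (hΓ'.eventually_lt_const (lt_add_one _)).mono fun _ => le_of_lt⟩
  obtain ⟨c, d, hcd, hI⟩ := hb _ (hsol.and ((hy.eventually hD).and ((hy.eventually hD').and
    ((hq.eventually hCq).and (hq.eventually ((isOpen_extChartAt_source q).mem_nhds hqs))))))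
  have hsrc : ∀ s ∈ Ioo c d, (σ s).proj ∈ (extChartAt (𝓡 n) q).source := fun s hs =>
    (hI hs).2.2.2.2
  have hCL : ∀ s ∈ Ioo c d, ∀ u, ‖coords q (σ s).proj u‖ ≤ C * ‖u‖ := fun s hs u =>
    ContinuousLinearMap.le_of_opNorm_le _ (hI hs).2.2.2.1.le u
  obtain ⟨L', hL'⟩ := exists_norm_vel_eq fun s hs => (hI hs).1
  have hw : ∀ s ∈ Ioo c d, ‖coords q (σ s).proj (σ s).2.1‖ ≤ C * L' := fun s hs =>
    (hCL s hs _).trans_eq (by rw [hL' s hs])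
  have hΓb : ∀ s ∈ Ioo c d, ∀ u, ‖christoffelForm q (extChartAt (𝓡 n) q (σ s).proj)
      (coords q (σ s).proj (σ s).2.1) u‖ ≤ D * (C * L') * ‖u‖ := fun s hs u =>
    (norm_christoffelForm_le _ _ _ _).trans (by
      gcongr
      · exact (norm_nonneg _).trans (hI hs).2.1
      · exact (hI hs).2.1
      · exact hw s hs)
  have hRb : ∀ s ∈ Ioo c d, ∀ u, ‖curvatureForm q (extChartAt (𝓡 n) q (σ s).proj) u
      (coords q (σ s).proj (σ s).2.1) (coords q (σ s).proj (σ s).2.1)‖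
        ≤ 2 * (D' + D ^ 2) * (C * L') ^ 2 * ‖u‖ := fun s hs u =>
    (norm_curvatureForm_le _ _ _ _).trans (by
      have h0 := (norm_nonneg _).trans (hI hs).2.2.1
      gcongr
      · exact (hI hs).2.2.1
      · exact (hI hs).2.1
      · exact hw s hs)
  set D₁ := D * (C * L')
  set D₂ := 2 * (D' + D ^ 2) * (C * L') ^ 2
  obtain ⟨R, hR⟩ := exists_bound_of_linear_growth (D := 1 + |D₁| + |D₂|)
    (fun s hs => solAt_field (hI hs).1 (hsrc s hs))
    (fun s hs => solAt_deriv_aux (hI hs).1 (hsrc s hs))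
    (fun s hs => (norm_sub_le _ _).trans (by
      have h1 := hΓb s hs (coords q (σ s).proj (σ s).2.2.1)
      have h2 := mul_le_mul_of_nonneg_right (le_abs_self D₁)
        (norm_nonneg (coords q (σ s).proj (σ s).2.2.1))
      nlinarith [norm_nonneg (coords q (σ s).proj (σ s).2.2.1),
        norm_nonneg (coords q (σ s).proj (σ s).2.2.2), abs_nonneg D₁, abs_nonneg D₂,
        mul_nonneg (abs_nonneg D₁) (norm_nonneg (coords q (σ s).proj (σ s).2.2.2)),
        mul_nonneg (abs_nonneg D₂) (norm_nonneg (coords q (σ s).proj (σ s).2.2.2)),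
        mul_nonneg (abs_nonneg D₂) (norm_nonneg (coords q (σ s).proj (σ s).2.2.1))]))
    (fun s hs => (norm_sub_le _ _).trans (by
      rw [norm_neg]
      have h1 := hΓb s hs (coords q (σ s).proj (σ s).2.2.2)
      have h2 := mul_le_mul_of_nonneg_right (le_abs_self D₁)
        (norm_nonneg (coords q (σ s).proj (σ s).2.2.2))
      have h3 := hRb s hs (coords q (σ s).proj (σ s).2.2.1)
      have h4 := mul_le_mul_of_nonneg_right (le_abs_self D₂)
        (norm_nonneg (coords q (σ s).proj (σ s).2.2.1))
      nlinarith [norm_nonneg (coords q (σ s).proj (σ s).2.2.1),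
        norm_nonneg (coords q (σ s).proj (σ s).2.2.2),
        mul_nonneg (abs_nonneg D₁) (norm_nonneg (coords q (σ s).proj (σ s).2.2.1)),
        mul_nonneg (abs_nonneg D₂) (norm_nonneg (coords q (σ s).proj (σ s).2.2.2))]))
  have hlip : LipschitzOnWith (Real.toNNReal (C * L' + |D₁| * (C * L') + R + |D₁| * R + |D₂| * R))
      (fun s => stateCoords q (σ s)) (Ioo c d) := by
    refine (convex_Ioo c d).lipschitzOnWith_of_nnnorm_hasDerivWithin_le
      (fun s hs => (solAt_hasDerivAt (hI hs).1 (hsrc s hs)).hasDerivWithinAt) fun s hs => ?_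
    rw [← NNReal.coe_le_coe, coe_nnnorm]
    refine le_trans ?_ (Real.le_coe_toNNReal _)
    obtain ⟨h1, h2⟩ := hR s hs
    have h0 := (norm_nonneg _).trans (hw s hs)
    have hR0 := (norm_nonneg _).trans h1
    have hg : ∀ u r, ‖u‖ ≤ r → ‖christoffelForm q (extChartAt (𝓡 n) q (σ s).proj)
      (coords q (σ s).proj (σ s).2.1) u‖ ≤ |D₁| * r := fun u r hr =>
        (hΓb s hs u).trans (mul_le_mul (le_abs_self _) hr (norm_nonneg _) (abs_nonneg _))
    have hg' := (hRb s hs (coords q (σ s).proj (σ s).2.2.1)).trans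
      (mul_le_mul (le_abs_self _) h1 (norm_nonneg _) (abs_nonneg _))
    have p1 := mul_nonneg (abs_nonneg D₁) h0
    have p2 := mul_nonneg (abs_nonneg D₁) hR0
    have p3 := mul_nonneg (abs_nonneg D₂) hR0
    refine norm_prod_le_iff.2 ⟨?_, norm_prod_le_iff.2 ⟨?_, norm_prod_le_iff.2 ⟨?_, ?_⟩⟩⟩
    · exact (hw s hs).trans (by linarith)
    · refine (norm_neg _).trans_le ((hg _ _ (hw s hs)).trans (by linarith))
    · refine (norm_sub_le _ _).trans ((add_le_add h2 (hg _ _ h1)).trans (by linarith))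
    · refine (norm_sub_le _ _).trans ?_
      refine (add_le_add ((norm_neg _).trans_le hg') (hg _ _ h2)).trans (by linarith)
  obtain ⟨z, hz⟩ := exists_tendsto_of_lipschitzOnWith hl hcd hlip
  -- The chart restricts only the footpoint, and the footpoint of the limit is `q`.
  have hzt : z ∈ (stateChart q).target := by
    have : l.NeBot := hl.1
    rw [mem_stateChart_target,
      tendsto_nhds_unique ((continuous_fst.tendsto z).comp hz) hy]
    exact hqt
  refine ⟨_, (((stateChart q).continuousAt_symm hzt).tendsto.comp hz).congr' ?_⟩
  filter_upwards [hcd] with s hs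
  rw [Function.comp_apply, stateCoords, ← stateChart_apply (hsrc s hs)]
  exact (stateChart q).left_inv (mem_stateChart_source.2 (hsrc s hs))

variable (n M) in
/-- The geodesic flow, with Jacobi fields, of a complete Riemannian manifold is complete. -/
lemma endsConverge_jacobiAtlas [IsRiemannianManifold (𝓡 n) M] [CompleteSpace M] :
    (jacobiAtlas n M).EndsConverge := by
  intro σ a b hab h
  constructor
  · refine exists_tendsto_of_solAt (cauchy_nhds.mono inf_le_left) (fun s hs => ?_)
      (mem_of_superset (Ioo_mem_nhdsLT hab) h)
    obtain ⟨c, hc, hs⟩ := mem_nhdsLT_iff_exists_Ioo_subset.1 hs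
    exact ⟨c, b, Ioo_mem_nhdsLT hc, hs⟩
  · refine exists_tendsto_of_solAt (cauchy_nhds.mono inf_le_left) (fun s hs => ?_)
      (mem_of_superset (Ioo_mem_nhdsGT hab) h)
    obtain ⟨d, hd, hs⟩ := mem_nhdsGT_iff_exists_Ioo_subset.1 hs
    exact ⟨a, d, Ioo_mem_nhdsGT hd, hs⟩

end Complete

/-! ### Uniqueness for geodesics and Jacobi fields, and their global flow. -/

section StateExt

variable {n : ℕ} {M : Type*} [TopologicalSpace M] [ChartedSpace (EuclideanSpace ℝ (Fin n)) M]

lemma state_ext_iff {p : M} {w X X' Y Y' : TangentSpace (𝓡 n) p} :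
    (⟨p, (w, X, Y)⟩ : State n M) = ⟨p, (w, X', Y')⟩ ↔ X = X' ∧ Y = Y' := by
  constructor
  · intro h
    have h' := eq_of_heq (TotalSpace.mk.inj h).2
    exact ⟨congrArg (fun z => z.2.1) h', congrArg (fun z => z.2.2) h'⟩
  · rintro ⟨rfl, rfl⟩
    rfl

end StateExt

section Uniqueness

variable {n : ℕ} {M : Type*} [TopologicalSpace M]
  [ChartedSpace (EuclideanSpace ℝ (Fin n)) M]
  [IsManifold (𝓡 n) ∞ M] {σ : ℝ → State n M} {t : ℝ}
  {γ γ' : ℝ → M} {J₁ K₁ J₂ K₂ : ∀ t, TangentSpace (𝓡 n) (γ t)}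
  [RiemannianBundle (fun x : M => TangentSpace (𝓡 n) x)]
  [IsContMDiffRiemannianBundle (𝓡 n) ∞ (EuclideanSpace ℝ (Fin n))
      (fun x : M => TangentSpace (𝓡 n) x)] [T2Space M]

/-- A geodesic is determined by its initial velocity. -/
lemma IsGeodesic.eq_of_velocity_eq (hγ : IsGeodesic (n := n) γ) (hγ' : IsGeodesic (n := n) γ')
    (h : (⟨γ 0, velocity γ 0⟩ : TangentBundle (𝓡 n) M) = ⟨γ' 0, velocity γ' 0⟩) : γ = γ' := by
  -- Equipped with the zero Jacobi field, a geodesic becomes a solution in the state space.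
  have h0 : lift γ (fun _ => 0) (fun _ => 0) 0 = lift γ' (fun _ => 0) (fun _ => 0) 0 :=
    congrArg (fun v : TangentBundle (𝓡 n) M => (⟨v.proj, (v.2, 0, 0)⟩ : State n M)) h
  have h1 := FieldAtlas.eq_of_solAt (solAt_lift_zero hγ) (solAt_lift_zero hγ') h0
  exact funext fun t => congrArg TotalSpace.proj (congrFun h1 t)

/-- A solution is a lift over its own projection, and uniqueness of geodesics identifies that
projection with `γ`. Substituting the equality avoids transporting fields between tangent spaces. -/
lemma exists_eq_lift (h : ∀ t, (jacobiAtlas n M).SolAt σ t) (hγ : IsGeodesic (n := n) γ)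
    (h0 : (⟨(σ 0).proj, (σ 0).2.1⟩ : TangentBundle (𝓡 n) M) = ⟨γ 0, velocity γ 0⟩) :
    ∃ J K, σ = lift γ J K := by
  have h1 : γ = fun s => (σ s).proj := hγ.eq_of_velocity_eq (isGeodesic_of_sol h) (by
    rw [velocity_of_sol h]; exact h0.symm)
  subst h1
  exact ⟨_, _, eq_lift_of_sol h⟩

lemma eq_of_solAt_lift (h₁ : ∀ t, (jacobiAtlas n M).SolAt (lift γ J₁ K₁) t)
    (h₂ : ∀ t, (jacobiAtlas n M).SolAt (lift γ J₂ K₂) t) (hJ : J₁ t = J₂ t) (hK : K₁ t = K₂ t) :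
    J₁ = J₂ ∧ K₁ = K₂ := by
  have h := FieldAtlas.eq_of_solAt h₁ h₂ (state_ext_iff.2 ⟨hJ, hK⟩)
  exact ⟨funext fun s => (state_ext_iff.1 (congrFun h s)).1,
    funext fun s => (state_ext_iff.1 (congrFun h s)).2⟩

end Uniqueness

section Flow

variable {n : ℕ} {M : Type*} [EMetricSpace M] [ChartedSpace (EuclideanSpace ℝ (Fin n)) M]
  [IsManifold (𝓡 n) ∞ M] {σ : ℝ → State n M} {t : ℝ}
  {γ γ' : ℝ → M} {J₁ K₁ J₂ K₂ : ∀ t, TangentSpace (𝓡 n) (γ t)}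
  [RiemannianBundle (fun x : M => TangentSpace (𝓡 n) x)]
  [IsContMDiffRiemannianBundle (𝓡 n) ∞ (EuclideanSpace ℝ (Fin n))
      (fun x : M => TangentSpace (𝓡 n) x)] [IsRiemannianManifold (𝓡 n) M] [CompleteSpace M]

/-- The flow of Jacobi fields along geodesics on a complete manifold. -/
def jacobiFlow (x : State n M) : ℝ → State n M := (endsConverge_jacobiAtlas n M).flow x

lemma solAt_jacobiFlow (x : State n M) (t : ℝ) : (jacobiAtlas n M).SolAt (jacobiFlow x) t :=
  (endsConverge_jacobiAtlas n M).flow_solAt x t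

lemma jacobiFlow_zero (x : State n M) : jacobiFlow x 0 = x :=
  (endsConverge_jacobiAtlas n M).flow_zero x

lemma continuous_jacobiFlow (t : ℝ) : Continuous fun x : State n M => jacobiFlow x t :=
  (endsConverge_jacobiAtlas n M).continuous_flow t

lemma eq_jacobiFlow (h : ∀ t, (jacobiAtlas n M).SolAt σ t) : σ = jacobiFlow (σ 0) :=
  (endsConverge_jacobiAtlas n M).eq_flow h

lemma exists_isGeodesic (p : M) (w : TangentSpace (𝓡 n) p) : ∃ γ : ℝ → M,
    IsGeodesic (n := n) γ ∧ (⟨γ 0, velocity γ 0⟩ : TangentBundle (𝓡 n) M) = ⟨p, w⟩ := by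
  have h := solAt_jacobiFlow (⟨p, (w, 0, 0)⟩ : State n M)
  refine ⟨_, isGeodesic_of_sol h, ?_⟩
  rw [velocity_of_sol h]
  exact congrArg (fun x : State n M => (⟨x.proj, x.2.1⟩ : TangentBundle (𝓡 n) M))
    (jacobiFlow_zero _)

/-- Jacobi fields with given initial value and initial covariant derivative. -/
lemma exists_jacobiFlow_eq_lift (hγ : IsGeodesic (n := n) γ) (X Y : TangentSpace (𝓡 n) (γ 0)) :
    ∃ J K, jacobiFlow ⟨γ 0, (velocity γ 0, X, Y)⟩ = lift γ J K ∧ J 0 = X ∧ K 0 = Y := by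
  have h := solAt_jacobiFlow (⟨γ 0, (velocity γ 0, X, Y)⟩ : State n M)
  obtain ⟨J, K, hJK⟩ := exists_eq_lift h hγ (by rw [jacobiFlow_zero])
  refine ⟨J, K, hJK, ?_⟩
  have h2 := congrFun hJK 0
  rw [jacobiFlow_zero] at h2
  exact state_ext_iff.1 h2.symm

lemma exists_solAt_lift (hγ : IsGeodesic (n := n) γ) (X Y : TangentSpace (𝓡 n) (γ 0)) :
    ∃ J K, (∀ t, (jacobiAtlas n M).SolAt (lift γ J K) t) ∧ J 0 = X ∧ K 0 = Y := by
  obtain ⟨J, K, h, h0⟩ := exists_jacobiFlow_eq_lift hγ X Y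
  exact ⟨J, K, h ▸ solAt_jacobiFlow _, h0⟩

end Flow

/-! ### Convexity of the squared norm of a Jacobi field in nonpositive curvature. -/

lemma nonpos_of_monotone_deriv_of_bounded {f g : ℝ → ℝ} {C : ℝ} (hf : ∀ t, HasDerivAt f (g t) t)
    (hg : Monotone g) (hC : ∀ t, 0 ≤ t → f t ≤ C) (t : ℝ) : g t ≤ 0 := by
  by_contra! h
  have h1 : ∀ s ∈ Ici t, g t * (s - t) ≤ f s - f t := fun s hs =>
    (convex_Ici t).mul_sub_le_image_sub_of_le_deriv
      (fun x _ => (hf x).continuousAt.continuousWithinAt)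
      (fun x _ => (hf x).differentiableAt.differentiableWithinAt)
      (fun x hx => by rw [(hf x).deriv]; exact hg (interior_subset hx)) t self_mem_Ici s hs hs
  -- If `g t > 0`, then `f` lies above its tangent line at `t`. Following this line for the chosen
  -- length raises `f` by at least `|C - f t| + 1`, past `C`; the `max` ensures that `s ≥ 0`, where
  -- the bound holds.
  set s := max t 0 + (|C - f t| + 1) / g t
  have hpos : 0 < (|C - f t| + 1) / g t := by positivity
  have h2 := h1 s (by simp only [mem_Ici, s]; linarith [le_max_left t 0])
  have h3 := hC s (by simp only [s]; linarith [le_max_right t 0])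
  have h4 : g t * ((|C - f t| + 1) / g t) ≤ g t * (s - t) :=
    mul_le_mul_of_nonneg_left (by simp only [s]; linarith [le_max_left t 0]) h.le
  rw [mul_div_cancel₀ _ h.ne'] at h4
  linarith [le_abs_self (C - f t)]

lemma le_max_of_monotone_deriv {f g : ℝ → ℝ} (hf : ∀ t, HasDerivAt f (g t) t)
    (hg : Monotone g) {a b t : ℝ} (ht : t ∈ Icc a b) : f t ≤ max (f a) (f b) := by
  have hd : deriv f = g := funext fun t => (hf t).deriv
  have hc : ConvexOn ℝ univ f :=
    Monotone.convexOn_univ_of_deriv (fun t => (hf t).differentiableAt) (hd ▸ hg)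
  exact hc.le_max_of_mem_Icc (mem_univ a) (mem_univ b) ht

section Curvature

variable {n : ℕ} {M : Type*} [TopologicalSpace M]
  [ChartedSpace (EuclideanSpace ℝ (Fin n)) M]
  [IsManifold (𝓡 n) ∞ M] {γ : ℝ → M} {J K : ∀ t, TangentSpace (𝓡 n) (γ t)} {t : ℝ}
  [RiemannianBundle (fun x : M => TangentSpace (𝓡 n) x)]
  [IsContMDiffRiemannianBundle (𝓡 n) ∞ (EuclideanSpace ℝ (Fin n))
      (fun x : M => TangentSpace (𝓡 n) x)]

/-- The sectional curvature assumption covers only independent pairs. For dependent ones the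
antisymmetry of `R` in its first two arguments takes over. -/
lemma curvature_eq_zero_of_not_linearIndependent {p : M} {u w : TangentSpace (𝓡 n) p}
    (h : ¬LinearIndependent ℝ ![u, w]) : curvature p u w w = 0 := by
  refine coords_injective (mem_extChartAt_source (I := 𝓡 n) p) ?_
  rw [coords_curvature, map_zero]
  rw [LinearIndependent.pair_iff] at h
  push Not at h
  obtain ⟨a, b, hab, hne⟩ := h
  by_cases ha : a = 0
  · have hw : w = 0 := by
      rw [ha, zero_smul, zero_add] at hab
      exact (smul_eq_zero.1 hab).resolve_left (hne ha)
    rw [hw]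
    simp [curvatureForm]
  · have hu : u = (-(a⁻¹ * b)) • w := by
      rw [neg_smul, mul_smul, eq_neg_iff_add_eq_zero, ← inv_smul_smul₀ ha u, ← smul_add, hab,
        smul_zero]
    rw [hu, map_smul]
    simp only [curvatureForm, map_smul, smul_apply]
    abel

lemma inner_curvature_nonpos (hK : NonposSectionalCurvature n M) (p : M)
    (u w : TangentSpace (𝓡 n) p) : ⟪curvature p u w w, u⟫ ≤ 0 := by
  by_cases h : LinearIndependent ℝ ![u, w]
  · have hpos : 0 < ‖u‖ ^ 2 * ‖w‖ ^ 2 - ⟪u, w⟫ ^ 2 := by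
      have hle : |⟪u, w⟫| ≤ ‖u‖ * ‖w‖ := abs_real_inner_le_norm u w
      have hu : u ≠ 0 := h.ne_zero 0
      have hw : w ≠ 0 := h.ne_zero 1
      have hlt : |⟪u, w⟫| < ‖u‖ * ‖w‖ := by
        refine lt_of_le_of_ne hle fun he => ?_
        have h1 : |⟪u, w⟫ / (‖u‖ * ‖w‖)| = 1 := by
          rw [abs_div, he, abs_of_nonneg (by positivity), div_self (by simp [hu, hw])]
        obtain ⟨-, r, -, hr⟩ := (abs_real_inner_div_norm_mul_norm_eq_one_iff u w).1 h1
        rw [LinearIndependent.pair_iff] at h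
        exact one_ne_zero (neg_eq_zero.1 (h r (-1) (by rw [hr]; simp)).2)
      rw [← mul_pow, ← sq_abs ⟪u, w⟫, sub_pos]
      exact pow_lt_pow_left₀ hlt (abs_nonneg _) two_ne_zero
    have := hK p u w h
    rw [sectionalCurvature, div_nonpos_iff] at this
    rcases this with h' | h'
    · linarith [h'.2]
    · exact h'.1
  · rw [curvature_eq_zero_of_not_linearIndependent h, inner_zero_left]

lemma hasDerivAt_inner_field_of_lift (h : (jacobiAtlas n M).SolAt (lift γ J K) t) :
    HasDerivAt (fun s => ⟪J s, J s⟫) (2 * ⟪K t, J t⟫) t := by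
  have h1 := solAt_hasDerivAt_inner_field h
  exact h1

lemma hasDerivAt_inner_deriv_of_lift (h : (jacobiAtlas n M).SolAt (lift γ J K) t) :
    HasDerivAt (fun s => ⟪K s, J s⟫)
      (⟪-curvature (γ t) (J t) (velocity γ t) (velocity γ t), J t⟫ + ⟪K t, K t⟫) t := by
  have h1 := solAt_hasDerivAt_inner_deriv h
  exact h1

section

variable (hK : NonposSectionalCurvature n M)
  (h : ∀ t, (jacobiAtlas n M).SolAt (lift γ J K) t)
include hK h

lemma monotone_inner_deriv : Monotone fun s => 2 * ⟪K s, J s⟫ := by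
  refine Monotone.const_mul (monotone_of_hasDerivAt_nonneg
    (fun t => hasDerivAt_inner_deriv_of_lift (h t)) fun t => ?_) zero_le_two
  rw [inner_neg_left]
  exact add_nonneg (neg_nonneg.2 (inner_curvature_nonpos hK _ _ _)) real_inner_self_nonneg

/-- A convex function on `ℝ` that is bounded above on a half-line to the right has nonpositive
derivative everywhere, also at negative times. -/
lemma inner_deriv_nonpos_of_bounded {C : ℝ} (hC : ∀ t, 0 ≤ t → ‖J t‖ ≤ C) (t : ℝ) :
    ⟪K t, J t⟫ ≤ 0 := by
  have := nonpos_of_monotone_deriv_of_bounded (C := C ^ 2)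
    (fun t => hasDerivAt_inner_field_of_lift (h t)) (monotone_inner_deriv hK h) (fun t ht => by
      rw [real_inner_self_eq_norm_sq]
      exact pow_le_pow_left₀ (norm_nonneg _) (hC t ht) 2) t
  linarith

lemma norm_le_of_bounded {C : ℝ} (hC : ∀ t, 0 ≤ t → ‖J t‖ ≤ C) (ht : 0 ≤ t) : ‖J t‖ ≤ ‖J 0‖ := by
  have hanti : Antitone fun s => ⟪J s, J s⟫ := antitone_of_hasDerivAt_nonpos
    (fun t => hasDerivAt_inner_field_of_lift (h t)) fun t =>
      mul_nonpos_of_nonneg_of_nonpos zero_le_two (inner_deriv_nonpos_of_bounded hK h hC t)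
  have h1 := hanti ht
  simp only [real_inner_self_eq_norm_sq] at h1
  exact le_of_sq_le_sq h1 (norm_nonneg _)

/-- On `[0, T]` the convex function `|J|²` is at most the larger of its end values, and the one at
`T` is zero. -/
lemma norm_le_of_eq_zero {T : ℝ} (hT : J T = 0) (ht : t ∈ Icc 0 T) : ‖J t‖ ≤ ‖J 0‖ := by
  have h1 := le_max_of_monotone_deriv (fun t => hasDerivAt_inner_field_of_lift (h t))
    (monotone_inner_deriv hK h) ht
  rw [hT, inner_zero_left, max_eq_left real_inner_self_nonneg] at h1
  simp only [real_inner_self_eq_norm_sq] at h1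
  exact le_of_sq_le_sq h1 (norm_nonneg _)

end

/-- A Jacobi field vanishing on an interval has vanishing derivative there. -/
lemma deriv_eq_zero_of_eventually_eq_zero (h : (jacobiAtlas n M).SolAt (lift γ J K) t)
    (h0 : ∀ᶠ s in 𝓝 t, J s = 0) : K t = 0 := by
  have h1 := hasDerivAt_inner_deriv_of_lift h
  have h2 : HasDerivAt (fun s => ⟪K s, J s⟫) 0 t :=
    (hasDerivAt_const t (0 : ℝ)).congr_of_eventuallyEq
      (h0.mono fun s hs => by
        change ⟪K s, J s⟫ = 0
        rw [hs, inner_zero_right])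
  have h3 := h1.unique h2
  rwa [h0.self_of_nhds, inner_zero_right, zero_add, inner_self_eq_zero] at h3

/-- Both initial data vanish at time `t`, so the field coincides with the zero solution. -/
lemma eq_zero_of_eventually_eq_zero [T2Space M] (hγ : IsGeodesic (n := n) γ)
    (h : ∀ t, (jacobiAtlas n M).SolAt (lift γ J K) t) (h0 : ∀ᶠ s in 𝓝 t, J s = 0) (s : ℝ) :
    J s = 0 ∧ K s = 0 := by
  obtain ⟨h1, h2⟩ := eq_of_solAt_lift (t := t) h (solAt_lift_zero hγ) h0.self_of_nhds
    (deriv_eq_zero_of_eventually_eq_zero (h t) h0)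
  exact ⟨congrFun h1 s, congrFun h2 s⟩

end Curvature

/-! ### Uniqueness of bounded Jacobi fields and the boundary value problem. -/

section BoundaryValue

variable {n : ℕ} {M : Type*} [EMetricSpace M] [ChartedSpace (EuclideanSpace ℝ (Fin n)) M]
  [IsManifold (𝓡 n) ∞ M] {t : ℝ}
  {γ : ℝ → M} {J K J₁ K₁ J₂ K₂ : ∀ t, TangentSpace (𝓡 n) (γ t)}
  [RiemannianBundle (fun x : M => TangentSpace (𝓡 n) x)]
  [IsContMDiffRiemannianBundle (𝓡 n) ∞ (EuclideanSpace ℝ (Fin n))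
      (fun x : M => TangentSpace (𝓡 n) x)]

/-- A Jacobi field that vanishes at two times is zero if the curvature is nonpositive. -/
lemma eq_zero_of_eq_zero_of_eq_zero (hK : NonposSectionalCurvature n M)
    (hγ : IsGeodesic (n := n) γ) (h : ∀ t, (jacobiAtlas n M).SolAt (lift γ J K) t) {T : ℝ}
    (hT : 0 < T) (h0 : J 0 = 0) (h1 : J T = 0) (s : ℝ) : J s = 0 ∧ K s = 0 := by
  refine eq_zero_of_eventually_eq_zero (t := T / 2) hγ h ?_ s
  filter_upwards [Icc_mem_nhds (half_pos hT) (half_lt_self hT)] with r hr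
  have := norm_le_of_eq_zero hK h h1 hr
  rwa [h0, norm_zero, norm_le_zero_iff] at this

/-- Two bounded Jacobi fields with the same initial value agree. -/
lemma eq_of_bounded (hK : NonposSectionalCurvature n M) (hγ : IsGeodesic (n := n) γ)
    (h₁ : ∀ t, (jacobiAtlas n M).SolAt (lift γ J₁ K₁) t)
    (h₂ : ∀ t, (jacobiAtlas n M).SolAt (lift γ J₂ K₂) t) {C₁ C₂ : ℝ}
    (hC₁ : ∀ t, 0 ≤ t → ‖J₁ t‖ ≤ C₁) (hC₂ : ∀ t, 0 ≤ t → ‖J₂ t‖ ≤ C₂) (h0 : J₁ 0 = J₂ 0) (s : ℝ) :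
    J₁ s = J₂ s ∧ K₁ s = K₂ s := by
  have h3 := fun t => solAt_lift_combination hγ.1 1 (-1) (h₁ t) (h₂ t)
  have hz : ∀ t, 0 ≤ t → (1 : ℝ) • J₁ t + (-1 : ℝ) • J₂ t = 0 := by
    intro t ht
    have h4 := norm_le_of_bounded hK h3 (C := C₁ + C₂) (fun t ht => by
      refine (norm_add_le _ _).trans ?_
      rw [norm_smul, norm_smul]
      norm_num
      exact add_le_add (hC₁ t ht) (hC₂ t ht)) ht
    rw [h0] at h4
    have h5 : (1 : ℝ) • J₂ 0 + (-1 : ℝ) • J₂ 0 = 0 := by module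
    rwa [h5, norm_zero, norm_le_zero_iff] at h4
  -- The difference vanishes for `t ≥ 0`, which is a neighbourhood of `1` but not of `0`.
  have h6 := eq_zero_of_eventually_eq_zero (t := 1) hγ h3
    (eventually_of_mem (Ioi_mem_nhds zero_lt_one) fun t ht => hz t (le_of_lt ht)) s
  simp only [one_smul, neg_smul, ← sub_eq_add_neg, sub_eq_zero] at h6
  exact h6

/-- The boundary value problem for Jacobi fields. -/
lemma exists_solAt_lift_of_boundary [IsRiemannianManifold (𝓡 n) M] [CompleteSpace M]
    (hK : NonposSectionalCurvature n M) (hγ : IsGeodesic (n := n) γ) {T : ℝ} (hT : 0 < T)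
    (X : TangentSpace (𝓡 n) (γ 0)) :
    ∃ J K, (∀ t, (jacobiAtlas n M).SolAt (lift γ J K) t) ∧ J 0 = X ∧ J T = 0 := by
  choose j k hjk hj0 hk0 using fun Y => exists_solAt_lift hγ 0 Y
  have hlin : ∀ (a b : ℝ) Y₁ Y₂, j (a • Y₁ + b • Y₂) T = a • j Y₁ T + b • j Y₂ T := by
    intro a b Y₁ Y₂
    have h := eq_of_solAt_lift (t := 0) (hjk (a • Y₁ + b • Y₂))
      (fun t => solAt_lift_combination hγ.1 a b (hjk Y₁ t) (hjk Y₂ t))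
      (by rw [hj0, hj0, hj0, smul_zero, smul_zero, add_zero]) (by rw [hk0, hk0, hk0])
    exact congrFun h.1 T
  -- `L` sends `Y` to the value at `T` of the Jacobi field with initial value `0` and initial
  -- derivative `Y`. It is injective because a field with two zeros is zero.
  let L : TangentSpace (𝓡 n) (γ 0) →ₗ[ℝ] TangentSpace (𝓡 n) (γ T) :=
    { toFun := fun Y => j Y T
      map_add' := fun Y₁ Y₂ => by simpa using hlin 1 1 Y₁ Y₂
      map_smul' := fun a Y => by simpa using hlin a 0 Y 0 }
  have hinj : Function.Injective L := by
    refine (injective_iff_map_eq_zero L).2 fun Y hY => ?_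
    rw [← hk0 Y]
    exact (eq_zero_of_eq_zero_of_eq_zero hK hγ (hjk Y) hT (hj0 Y) hY 0).2
  -- In coordinates `L` is an endomorphism of a finite-dimensional space, so injectivity gives
  -- surjectivity.
  let L' : EuclideanSpace ℝ (Fin n) →ₗ[ℝ] EuclideanSpace ℝ (Fin n) :=
    (coords (γ T) (γ T)).toLinearMap ∘ₗ L ∘ₗ (ofCoords (γ 0) (γ 0)).toLinearMap
  have hsurj' : Function.Surjective L' := LinearMap.injective_iff_surjective.1
    ((coords_injective (mem_extChartAt_source (γ T))).comp
      (hinj.comp (ofCoords_injective (mem_extChartAt_source (γ 0)))))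
  have hsurj : Function.Surjective L := fun v => by
    obtain ⟨y, hy⟩ := hsurj' (coords (γ T) (γ T) v)
    exact ⟨_, coords_injective (mem_extChartAt_source (γ T)) hy⟩
  obtain ⟨J, K, hJK, hJ0, -⟩ := exists_solAt_lift hγ X 0
  obtain ⟨Y, hY⟩ := hsurj (J T)
  refine ⟨_, _, fun t => solAt_lift_combination hγ.1 1 (-1) (hJK t) (hjk Y t), ?_, ?_⟩
  · rw [hJ0, hj0]
    simp
  · change _ + (-1 : ℝ) • L Y = 0
    rw [hY]
    simp

end BoundaryValue

/-! ### Compactness for initial data of Jacobi fields. -/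

section Scale

variable {n : ℕ} {M : Type*} [TopologicalSpace M] [ChartedSpace (EuclideanSpace ℝ (Fin n)) M]

/-- The state of the multiple of a Jacobi field. -/
def scale (a : ℝ) (x : State n M) : State n M := ⟨x.proj, (x.2.1, a • x.2.2.1, a • x.2.2.2)⟩

variable [RiemannianBundle (fun x : M => TangentSpace (𝓡 n) x)]

/-- The norm of the Jacobi field. -/
def fieldNorm (x : State n M) : ℝ := ‖x.2.2.1‖

lemma fieldNorm_scale (a : ℝ) (x : State n M) : fieldNorm (scale a x) = |a| * fieldNorm x :=
  norm_smul a x.2.2.1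

end Scale

section StateTopology

variable {n : ℕ} {M : Type*} [TopologicalSpace M] [ChartedSpace (EuclideanSpace ℝ (Fin n)) M]
  [IsManifold (𝓡 n) ∞ M] {ι : Type*} {l : Filter ι} {x : ι → State n M} {y : State n M} {c : M}

lemma tendsto_stateCoords (hy : y.proj ∈ (extChartAt (𝓡 n) c).source) (h : Tendsto x l (𝓝 y)) :
    Tendsto (fun i => stateCoords c (x i)) l (𝓝 (stateCoords c y)) := by
  have h1 := ((stateChart c).continuousAt (mem_stateChart_source.2 hy)).tendsto.comp h
  rw [stateChart_apply hy] at h1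
  refine h1.congr' ?_
  filter_upwards [(continuous_proj.continuousAt.tendsto.comp h).eventually
    ((isOpen_extChartAt_source c).mem_nhds hy)] with i hi
  exact stateChart_apply hi

lemma tendsto_of_stateCoords (hy : y.proj ∈ (extChartAt (𝓡 n) c).source)
    (hx : ∀ᶠ i in l, (x i).proj ∈ (extChartAt (𝓡 n) c).source)
    (h : Tendsto (fun i => stateCoords c (x i)) l (𝓝 (stateCoords c y))) : Tendsto x l (𝓝 y) := by
  have hs := mem_stateChart_source.2 hy
  have h1 := (((stateChart c).continuousAt_symm ((stateChart c).map_source hs)).tendsto.comp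
    (by rw [stateChart_apply hy]; exact h))
  rw [(stateChart c).left_inv hs] at h1
  refine h1.congr' ?_
  filter_upwards [hx] with i hi
  rw [Function.comp_apply, stateCoords, ← stateChart_apply hi]
  exact (stateChart c).left_inv (mem_stateChart_source.2 hi)

variable [RiemannianBundle (fun x : M => TangentSpace (𝓡 n) x)]
  [IsContMDiffRiemannianBundle (𝓡 n) ∞ (EuclideanSpace ℝ (Fin n))
      (fun x : M => TangentSpace (𝓡 n) x)]

lemma continuous_fieldNorm : Continuous (fieldNorm : State n M → ℝ) := by
  have h : Continuous fun x : State n M => ⟪x.2.2.1, x.2.2.1⟫ := by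
    refine continuous_iff_continuousAt.2 fun x => ?_
    have h1 := (continuous_state_iff (f := fun x : State n M => x) (s := univ)).1
      (continuousWithinAt_id (x := x))
    exact (h1.2.1.inner_bundle h1.2.1).continuousAt univ_mem
  refine (Real.continuous_sqrt.comp h).congr fun x => ?_
  rw [Function.comp_apply, real_inner_self_eq_norm_sq, Real.sqrt_sq (norm_nonneg _), fieldNorm]

end StateTopology

section Compactness

variable {n : ℕ} {M : Type*} [EMetricSpace M] [ChartedSpace (EuclideanSpace ℝ (Fin n)) M]
  [IsManifold (𝓡 n) ∞ M] [RiemannianBundle (fun x : M => TangentSpace (𝓡 n) x)]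
  [IsContMDiffRiemannianBundle (𝓡 n) ∞ (EuclideanSpace ℝ (Fin n))
      (fun x : M => TangentSpace (𝓡 n) x)] [IsRiemannianManifold (𝓡 n) M] [CompleteSpace M]
  {t : ℝ}

lemma jacobiFlow_scale (a : ℝ) (x : State n M) (t : ℝ) :
    jacobiFlow (scale a x) t = scale a (jacobiFlow x t) := by
  have h := solAt_jacobiFlow x
  have h1 := fun t => solAt_lift_combination (t := t) (contMDiff_proj_of_sol h) a 0
    (eq_lift_of_sol h ▸ h t) (eq_lift_of_sol h ▸ h t)
  have h2 : ∀ t, (jacobiAtlas n M).SolAt (fun s => scale a (jacobiFlow x s)) t := by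
    intro t
    refine (h1 t).congr (Eventually.of_forall fun s => ?_)
    simp only [lift, scale, velocity_of_sol h, zero_smul, add_zero]
  have h3 := congrFun (eq_jacobiFlow h2) t
  simp only [jacobiFlow_zero] at h3
  exact h3.symm

/-- The Jacobi field with the given initial state is bounded for positive times. -/
def IsBoundedState (x : State n M) : Prop := ∃ C, ∀ t, 0 ≤ t → fieldNorm (jacobiFlow x t) ≤ C

lemma IsBoundedState.eq (hK : NonposSectionalCurvature n M) {p : M}
    {w X Y Y' : TangentSpace (𝓡 n) p} (h : IsBoundedState (⟨p, (w, X, Y)⟩ : State n M))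
    (h' : IsBoundedState (⟨p, (w, X, Y')⟩ : State n M)) : Y = Y' := by
  -- Replacing `p` and `w` by the initial point and velocity of a geodesic turns both flow lines
  -- into lifts over the same `γ`.
  obtain ⟨γ, hγ, h0⟩ := exists_isGeodesic p w
  cases h0
  obtain ⟨J₁, K₁, h₁, hJ₁, rfl⟩ := exists_jacobiFlow_eq_lift hγ X Y
  obtain ⟨J₂, K₂, h₂, hJ₂, rfl⟩ := exists_jacobiFlow_eq_lift hγ X Y'
  obtain ⟨C, hC⟩ := h
  obtain ⟨C', hC'⟩ := h'
  rw [h₁] at hC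
  rw [h₂] at hC'
  exact (eq_of_bounded hK hγ (h₁ ▸ solAt_jacobiFlow _) (h₂ ▸ solAt_jacobiFlow _) hC hC'
    (hJ₁.trans hJ₂.symm) 0).2

/-- Since `|J|²` is nonincreasing, the unspecified bound improves to the initial norm. This bound is
uniform over families and survives limits. -/
lemma IsBoundedState.fieldNorm_le (hK : NonposSectionalCurvature n M) {x : State n M}
    (h : IsBoundedState x) (ht : 0 ≤ t) : fieldNorm (jacobiFlow x t) ≤ fieldNorm x := by
  have h1 := solAt_jacobiFlow x
  obtain ⟨C, hC⟩ := h
  have h2 := norm_le_of_bounded hK (eq_lift_of_sol h1 ▸ h1) hC ht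
  exact h2.trans_eq (congrArg fieldNorm (jacobiFlow_zero x))

lemma isBoundedState_zero (p : M) (w : TangentSpace (𝓡 n) p) :
    IsBoundedState (⟨p, (w, 0, 0)⟩ : State n M) := by
  refine ⟨0, fun t _ => ?_⟩
  have : (⟨p, (w, 0, 0)⟩ : State n M) = scale 0 ⟨p, (w, 0, 0)⟩ := by simp [scale]
  rw [this, jacobiFlow_scale, fieldNorm_scale]
  simp

variable {ι : Type*} {x : ι → State n M} {p : M} {w X : TangentSpace (𝓡 n) p}

/-- Bounded coordinates converge along an ultrafilter. For each fixed `t` the inequality passes to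
the limit, because the time-`t` flow and the norm are continuous. -/
lemma exists_tendsto_of_coords_bounded {f : Ultrafilter ι}
    (hsrc : ∀ᶠ i in f, (x i).proj ∈ (extChartAt (𝓡 n) p).source)
    (h1 : Tendsto (fun i => extChartAt (𝓡 n) p (x i).proj) f (𝓝 (extChartAt (𝓡 n) p p)))
    (h2 : Tendsto (fun i => coords p (x i).proj (x i).2.1) f (𝓝 (coords p p w)))
    (h3 : Tendsto (fun i => coords p (x i).proj (x i).2.2.1) f (𝓝 (coords p p X)))
    (hb : ∀ t, 0 ≤ t → ∀ᶠ i in f, fieldNorm (jacobiFlow (x i) t) ≤ fieldNorm (x i)) {R : ℝ}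
    (hR : ∀ᶠ i in f, ‖coords p (x i).proj (x i).2.2.2‖ ≤ R) :
    ∃ Y, IsBoundedState (⟨p, (w, X, Y)⟩ : State n M) ∧
      Tendsto x f (𝓝 ⟨p, (w, X, Y)⟩) := by
  have hp := mem_extChartAt_source (I := 𝓡 n) p
  obtain ⟨y, -, hy⟩ := (isCompact_closedBall (0 : EuclideanSpace ℝ (Fin n)) R).ultrafilter_le_nhds
    (f.map fun i => coords p (x i).proj (x i).2.2.2) (le_principal_iff.2 (by
      rw [Ultrafilter.mem_coe, Ultrafilter.mem_map]
      filter_upwards [hR] with i hi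
      simpa using hi))
  have h4 : Tendsto (fun i => coords p (x i).proj (x i).2.2.2) f (𝓝 y) := hy
  have hx : Tendsto x f (𝓝 ⟨p, (w, X, ofCoords p p y)⟩) := by
    refine tendsto_of_stateCoords hp hsrc ?_
    simp only [stateCoords, coords_ofCoords hp]
    exact h1.prodMk_nhds (h2.prodMk_nhds (h3.prodMk_nhds h4))
  refine ⟨_, ⟨fieldNorm (⟨p, (w, X, ofCoords p p y)⟩ : State n M), fun t ht => ?_⟩, hx⟩
  exact le_of_tendsto_of_tendsto
    ((continuous_fieldNorm.comp (continuous_jacobiFlow t)).continuousAt.tendsto.comp hx)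
    (continuous_fieldNorm.continuousAt.tendsto.comp hx) (hb t ht)

/-- Initial values of Jacobi fields that are bounded for longer and longer times converge. -/
lemma exists_tendsto_of_fieldNorm_le (hK : NonposSectionalCurvature n M) {l : Filter ι} [l.NeBot]
    (hx : Tendsto (fun i => (⟨(x i).proj, ((x i).2.1, (x i).2.2.1, 0)⟩ : State n M)) l
      (𝓝 ⟨p, (w, X, 0)⟩))
    (hb : ∀ t, 0 ≤ t → ∀ᶠ i in l, fieldNorm (jacobiFlow (x i) t) ≤ fieldNorm (x i)) :
    ∃ Y, IsBoundedState (⟨p, (w, X, Y)⟩ : State n M) ∧ Tendsto x l (𝓝 ⟨p, (w, X, Y)⟩) := by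
  have hp := mem_extChartAt_source (I := 𝓡 n) p
  have hsrc : ∀ᶠ i in l, (x i).proj ∈ (extChartAt (𝓡 n) p).source :=
    (continuous_proj.continuousAt.tendsto.comp hx).eventually
      ((isOpen_extChartAt_source p).mem_nhds hp)
  have hc := tendsto_stateCoords (c := p) hp hx
  have h1 := (continuous_fst.tendsto _).comp hc
  have h2 := ((continuous_fst.comp continuous_snd).tendsto _).comp hc
  have h3 := ((continuous_fst.comp (continuous_snd.comp continuous_snd)).tendsto _).comp hc
  have key : ∀ f : Ultrafilter ι, ↑f ≤ l → ∃ Y, IsBoundedState (⟨p, (w, X, Y)⟩ : State n M) ∧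
      Tendsto x f (𝓝 ⟨p, (w, X, Y)⟩) := by
    intro f hf
    -- Along an ultrafilter the derivative coordinates are either eventually bounded or tend to
    -- infinity in norm. The second case is excluded by rescaling the Jacobi fields.
    by_cases hR : ∃ R, ∀ᶠ i in f, ‖coords p (x i).proj (x i).2.2.2‖ ≤ R
    · obtain ⟨R, hR⟩ := hR
      exact exists_tendsto_of_coords_bounded (hf hsrc) (h1.mono_left hf) (h2.mono_left hf)
        (h3.mono_left hf) (fun t ht => hf (hb t ht)) hR
    · exfalso
      push Not at hR
      have hinf : Tendsto (fun i => ‖coords p (x i).proj (x i).2.2.2‖) f atTop := by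
        exact tendsto_atTop.2 fun R => (hR R).mono fun i hi => hi.le
      set a := fun i => ‖coords p (x i).proj (x i).2.2.2‖⁻¹ with ha
      have ha0 : Tendsto a f (𝓝 0) := tendsto_inv_atTop_zero.comp hinf
      have hone : ∀ᶠ i in f, ‖coords p (x i).proj (a i • (x i).2.2.2)‖ = 1 := by
        filter_upwards [hinf.eventually_gt_atTop 0] with i hi
        rw [map_smul, norm_smul, ha, norm_inv, norm_norm, inv_mul_cancel₀ hi.ne']
      obtain ⟨Y, hY, hYt⟩ := exists_tendsto_of_coords_bounded (x := fun i => scale (a i) (x i))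
        (w := w) (X := 0) (R := 1) (hf hsrc) (h1.mono_left hf) (h2.mono_left hf) (by
          rw [map_zero, ← zero_smul ℝ (coords p p X)]
          refine (ha0.smul (h3.mono_left hf)).congr fun i => ?_
          exact (map_smul (coords p (x i).proj) (a i) (x i).2.2.1).symm) (fun t ht => by
          filter_upwards [hf (hb t ht)] with i hi
          rw [jacobiFlow_scale, fieldNorm_scale, fieldNorm_scale]
          exact mul_le_mul_of_nonneg_left hi (abs_nonneg _)) (hone.mono fun i hi => hi.le)
      -- The rescaled limit is bounded with initial value zero, so its derivative is zero by
      -- uniqueness, although its coordinates are limits of vectors of norm `1`.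
      rw [hY.eq hK (isBoundedState_zero p w)] at hYt
      have h4 := tendsto_stateCoords (c := p) hp hYt
      have h5 := (((continuous_snd.comp (continuous_snd.comp continuous_snd)).tendsto _).comp h4).norm
      have h6 : Tendsto (fun _ : ι => (1 : ℝ)) f (𝓝 0) := by
        refine (h5.congr' hone).trans_eq ?_
        simp [stateCoords]
      exact one_ne_zero (tendsto_nhds_unique tendsto_const_nhds h6)
  -- By uniqueness of the bounded field, all ultrafilters below `l` give the same limit, so
  -- convergence holds along `l`.
  obtain ⟨Y, hY, -⟩ := key (Ultrafilter.of l) (Ultrafilter.of_le l)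
  refine ⟨Y, hY, (tendsto_iff_ultrafilter _ _ _).2 fun f hf => ?_⟩
  obtain ⟨Y', hY', h⟩ := key f hf
  rwa [hY.eq hK hY']

end Compactness

/-! ### Bounded Jacobi fields: existence, linearity, sign and continuity. -/

section Stable

variable {n : ℕ} {M : Type*} [EMetricSpace M] [ChartedSpace (EuclideanSpace ℝ (Fin n)) M]
  [IsManifold (𝓡 n) ∞ M] [RiemannianBundle (fun x : M => TangentSpace (𝓡 n) x)]
  [IsContMDiffRiemannianBundle (𝓡 n) ∞ (EuclideanSpace ℝ (Fin n))
      (fun x : M => TangentSpace (𝓡 n) x)] [IsRiemannianManifold (𝓡 n) M] [CompleteSpace M]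
  {p : M} {w X X' Y Y' : TangentSpace (𝓡 n) p}

/-- The bounded field is a limit of the fields with `J(0) = X` and `J(m + 1) = 0`, whose norms are
at most `|X|` on `[0, m + 1]`. -/
lemma exists_isBoundedState (hK : NonposSectionalCurvature n M) (p : M)
    (w X : TangentSpace (𝓡 n) p) : ∃ Y, IsBoundedState (⟨p, (w, X, Y)⟩ : State n M) := by
  obtain ⟨γ, hγ, h0⟩ := exists_isGeodesic p w
  cases h0
  choose J K h hJ0 hJ using fun m : ℕ =>
    exists_solAt_lift_of_boundary hK hγ (Nat.cast_add_one_pos m) X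
  have hflow : ∀ m, jacobiFlow ⟨γ 0, (velocity γ 0, X, K m 0)⟩ = lift γ (J m) (K m) := by
    intro m
    rw [eq_jacobiFlow (h m), lift, hJ0]
  obtain ⟨Y, hY, -⟩ := exists_tendsto_of_fieldNorm_le (l := atTop) hK
    (x := fun m : ℕ => ⟨γ 0, (velocity γ 0, X, K m 0)⟩) (p := γ 0) (w := velocity γ 0) (X := X)
    tendsto_const_nhds fun t ht => by
      obtain ⟨N, hN⟩ := exists_nat_ge t
      filter_upwards [eventually_ge_atTop N] with m hm
      have hm' : (N : ℝ) ≤ m := by exact_mod_cast hm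
      rw [hflow]
      refine (norm_le_of_eq_zero hK (h m) (hJ m) ⟨ht, by linarith⟩).trans_eq ?_
      rw [hJ0]
      rfl
  exact ⟨Y, hY⟩

lemma IsBoundedState.combination (a b : ℝ) (h : IsBoundedState (⟨p, (w, X, Y)⟩ : State n M))
    (h' : IsBoundedState (⟨p, (w, X', Y')⟩ : State n M)) :
    IsBoundedState (⟨p, (w, a • X + b • X', a • Y + b • Y')⟩ : State n M) := by
  obtain ⟨γ, hγ, h0⟩ := exists_isGeodesic p w
  cases h0
  obtain ⟨J₁, K₁, h₁, rfl, rfl⟩ := exists_jacobiFlow_eq_lift hγ X Y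
  obtain ⟨J₂, K₂, h₂, rfl, rfl⟩ := exists_jacobiFlow_eq_lift hγ X' Y'
  obtain ⟨C, hC⟩ := h
  obtain ⟨C', hC'⟩ := h'
  rw [h₁] at hC
  rw [h₂] at hC'
  have h3 := eq_jacobiFlow fun t => solAt_lift_combination hγ.1 a b
    (h₁ ▸ solAt_jacobiFlow _ t) (h₂ ▸ solAt_jacobiFlow _ t)
  rw [lift] at h3
  refine ⟨|a| * C + |b| * C', fun t ht => ?_⟩
  rw [← h3]
  refine (norm_add_le (a • J₁ t) (b • J₂ t)).trans ?_
  refine (add_le_add (norm_smul a (J₁ t)).le (norm_smul b (J₂ t)).le).trans ?_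
  exact add_le_add (mul_le_mul_of_nonneg_left (hC t ht) (abs_nonneg a))
    (mul_le_mul_of_nonneg_left (hC' t ht) (abs_nonneg b))

/-- The initial covariant derivative of the bounded Jacobi field with initial value `X` along the
geodesic with initial velocity `w`. -/
def stableDeriv (p : M) (w X : TangentSpace (𝓡 n) p) : TangentSpace (𝓡 n) p :=
  Classical.epsilon fun Y => IsBoundedState (⟨p, (w, X, Y)⟩ : State n M)

section

variable (hK : NonposSectionalCurvature n M)
include hK

lemma isBoundedState_stableDeriv (p : M) (w X : TangentSpace (𝓡 n) p) :
    IsBoundedState (⟨p, (w, X, stableDeriv p w X)⟩ : State n M) :=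
  Classical.epsilon_spec (exists_isBoundedState hK p w X)

lemma stableDeriv_combination (p : M) (w X X' : TangentSpace (𝓡 n) p) (a b : ℝ) :
    stableDeriv p w (a • X + b • X') = a • stableDeriv p w X + b • stableDeriv p w X' :=
  (isBoundedState_stableDeriv hK p w _).eq hK ((isBoundedState_stableDeriv hK p w X).combination
    a b (isBoundedState_stableDeriv hK p w X'))

lemma stableDeriv_add (p : M) (w X X' : TangentSpace (𝓡 n) p) :
    stableDeriv p w (X + X') = stableDeriv p w X + stableDeriv p w X' := by
  simpa using stableDeriv_combination hK p w X X' 1 1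

lemma stableDeriv_smul (p : M) (w X : TangentSpace (𝓡 n) p) (a : ℝ) :
    stableDeriv p w (a • X) = a • stableDeriv p w X := by
  simpa using stableDeriv_combination hK p w X 0 a 0

lemma inner_stableDeriv_nonpos (p : M) (w X : TangentSpace (𝓡 n) p) :
    ⟪stableDeriv p w X, X⟫ ≤ 0 := by
  have hb := isBoundedState_stableDeriv hK p w X
  obtain ⟨γ, hγ, h0⟩ := exists_isGeodesic p w
  cases h0
  obtain ⟨J, K, h, hJ, hK'⟩ := exists_jacobiFlow_eq_lift hγ X (stableDeriv (γ 0) (velocity γ 0) X)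
  obtain ⟨C, hC⟩ := hb
  rw [h] at hC
  have h1 : ⟪K 0, J 0⟫ ≤ 0 := inner_deriv_nonpos_of_bounded hK (h ▸ solAt_jacobiFlow _) hC 0
  rwa [hJ, hK'] at h1

/-- The initial derivative of the bounded Jacobi field depends continuously on the initial data. -/
lemma continuousWithinAt_stableDeriv {B : Type*} [TopologicalSpace B] {U : Set B} {b₀ : B}
    (hb₀ : b₀ ∈ U) {q : B → M} {w X : ∀ b, TangentSpace (𝓡 n) (q b)}
    (hw : ContinuousWithinAt (fun b => (⟨q b, w b⟩ : TangentBundle (𝓡 n) M)) U b₀)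
    (hX : ContinuousWithinAt (fun b => (⟨q b, X b⟩ : TangentBundle (𝓡 n) M)) U b₀) :
    ContinuousWithinAt (fun b => (⟨q b, stableDeriv (q b) (w b) (X b)⟩ :
      TangentBundle (𝓡 n) M)) U b₀ := by
  have : (𝓝[U] b₀).NeBot := mem_closure_iff_nhdsWithin_neBot.1 (subset_closure hb₀)
  have hzero : ContinuousWithinAt (fun b => (⟨q b, 0⟩ : TangentBundle (𝓡 n) M)) U b₀ :=
    (Bundle.Trivialization.continuous_zeroSection (F := EuclideanSpace ℝ (Fin n))
      (E := fun x : M => TangentSpace (𝓡 n) x) ℝ).continuousAt.comp_continuousWithinAt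
      ((FiberBundle.continuous_proj _ _).continuousAt.comp_continuousWithinAt hw)
  obtain ⟨Y, hY, hYt⟩ := exists_tendsto_of_fieldNorm_le (l := 𝓝[U] b₀) hK
    (x := fun b => ⟨q b, (w b, X b, stableDeriv (q b) (w b) (X b))⟩) (p := q b₀) (w := w b₀)
    (X := X b₀)
    (continuous_state_iff (f := fun b => (⟨q b, (w b, X b, 0)⟩ : State n M)).2 ⟨hw, hX, hzero⟩)
    fun t ht => Eventually.of_forall fun b =>
      (isBoundedState_stableDeriv hK _ _ _).fieldNorm_le hK ht
  rw [hY.eq hK (isBoundedState_stableDeriv hK _ _ _)] at hYt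
  exact (continuous_state_iff
    (f := fun b => (⟨q b, (w b, X b, stableDeriv (q b) (w b) (X b))⟩ : State n M)).1 hYt).2.2

lemma existsUnique_isBoundedJacobiField {γ : ℝ → M} (hγ : IsGeodesic (n := n) γ)
    (h0 : (⟨γ 0, velocity γ 0⟩ : TangentBundle (𝓡 n) M) = ⟨p, w⟩) (X : TangentSpace (𝓡 n) p) :
    ∃! J, IsBoundedJacobiField γ X J := by
  cases h0
  obtain ⟨J, K, h, hJ, hK'⟩ := exists_jacobiFlow_eq_lift hγ X (stableDeriv (γ 0) (velocity γ 0) X)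
  obtain ⟨C, hC⟩ := isBoundedState_stableDeriv hK (γ 0) (velocity γ 0) X
  have hs : ∀ t, (jacobiAtlas n M).SolAt (lift γ J K) t := h ▸ solAt_jacobiFlow _
  rw [h] at hC
  have hj := isJacobiField_of_sol hs
  refine ⟨J, ⟨hj, by rw [hJ], C, hC⟩, fun J' hJ' => ?_⟩
  obtain ⟨hj', h0', C', hC'⟩ := hJ'
  have h0'' : J' 0 = X := eq_of_heq (TotalSpace.mk.inj h0').2
  exact funext fun t => (eq_of_bounded hK hγ (solAt_lift_covDeriv hγ hj') hs hC' hC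
    (h0''.trans hJ.symm) t).1

/-- The initial covariant derivative of any bounded field with initial value `X` must be
`stableDeriv p w X`, so the quadratic form does not depend on the choices made by `epsilon`. -/
lemma inner_covDeriv_of_isBoundedJacobiField {γ : ℝ → M} (hγ : IsGeodesic (n := n) γ)
    (h0 : (⟨γ 0, velocity γ 0⟩ : TangentBundle (𝓡 n) M) = ⟨p, w⟩) {X : TangentSpace (𝓡 n) p}
    {J : ∀ t, TangentSpace (𝓡 n) (γ t)} (hJ : IsBoundedJacobiField γ X J) :
    ⟪covDeriv γ J 0, J 0⟫ = ⟪stableDeriv p w X, X⟫ := by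
  cases h0
  obtain ⟨hj, h0, C, hC⟩ := hJ
  have h1 : J 0 = X := eq_of_heq (TotalSpace.mk.inj h0).2
  subst h1
  have hb : IsBoundedState (⟨γ 0, (velocity γ 0, J 0, covDeriv γ J 0)⟩ : State n M) := by
    refine ⟨C, fun t ht => ?_⟩
    have h2 := eq_jacobiFlow (solAt_lift_covDeriv hγ hj)
    rw [lift] at h2
    rw [← h2]
    exact hC t ht
  rw [hb.eq hK (isBoundedState_stableDeriv hK _ _ _)]

end

end Stable

/-! ### The horosphere form in terms of `stableDeriv`. -/

section Form

variable {n : ℕ} {M : Type*} [EMetricSpace M] [ChartedSpace (EuclideanSpace ℝ (Fin n)) M]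
  [IsManifold (𝓡 n) ∞ M] [RiemannianBundle (fun x : M => TangentSpace (𝓡 n) x)]
  [IsContMDiffRiemannianBundle (𝓡 n) ∞ (EuclideanSpace ℝ (Fin n))
      (fun x : M => TangentSpace (𝓡 n) x)] [IsRiemannianManifold (𝓡 n) M] [CompleteSpace M]

lemma existsUnique_isGeodesicFrom (v : TangentBundle (𝓡 n) M) : ∃! γ, IsGeodesicFrom v γ := by
  obtain ⟨γ, hγ, h0⟩ := exists_isGeodesic v.proj v.2
  exact ⟨γ, ⟨hγ, h0⟩, fun γ' h => h.1.eq_of_velocity_eq hγ (h.2.trans h0.symm)⟩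

lemma horosphereQuad_eq (hK : NonposSectionalCurvature n M) (v : UnitTangentBundle n M)
    (X : normalSpace v) : horosphereQuad v X =
      (-⟪stableDeriv v.1.proj v.1.2 (X : TangentSpace (𝓡 n) v.1.proj),
        (X : TangentSpace (𝓡 n) v.1.proj)⟫) • v.1.2 := by
  obtain ⟨hγ, h0⟩ : IsGeodesicFrom v.1 (geodesicFrom v) :=
    Classical.epsilon_spec (existsUnique_isGeodesicFrom v.1).exists
  have hJ : IsBoundedJacobiField (geodesicFrom v) (X : TangentSpace (𝓡 n) v.1.proj)
      (boundedJacobiField v X) :=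
    Classical.epsilon_spec (existsUnique_isBoundedJacobiField hK hγ h0 X.1).exists
  rw [horosphereQuad, inner_neg_left, inner_covDeriv_of_isBoundedJacobiField hK hγ h0 hJ]

/-- Expanding the polarization by additivity of `stableDeriv` symmetrizes the bilinear form `⟨S X,
Y⟩`. Symmetry of the horosphere form thus needs no self-adjointness of `S`. -/
lemma horosphereForm_eq (hK : NonposSectionalCurvature n M) (v : UnitTangentBundle n M)
    (X Y : normalSpace v) : horosphereForm v X Y =
      (-(1 / 2) * (⟪stableDeriv v.1.proj v.1.2 (X : TangentSpace (𝓡 n) v.1.proj),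
        (Y : TangentSpace (𝓡 n) v.1.proj)⟫ +
        ⟪stableDeriv v.1.proj v.1.2 (Y : TangentSpace (𝓡 n) v.1.proj),
        (X : TangentSpace (𝓡 n) v.1.proj)⟫)) • v.1.2 := by
  simp only [horosphereForm, horosphereQuad_eq hK, Submodule.coe_add, stableDeriv_add hK,
    inner_add_left, inner_add_right]
  module

end Form

end Horosphere

end

theorem mainTheorem4 {n : ℕ} {M : Type*} [EMetricSpace M]
    [ChartedSpace (EuclideanSpace ℝ (Fin n)) M] [IsManifold (𝓡 n) ∞ M]
    [RiemannianBundle (fun x : M => TangentSpace (𝓡 n) x)]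
    [IsContMDiffRiemannianBundle (𝓡 n) ∞ (EuclideanSpace ℝ (Fin n))
      (fun x : M => TangentSpace (𝓡 n) x)]
    [IsRiemannianManifold (𝓡 n) M] [CompleteSpace M]
    (hK : Horosphere.NonposSectionalCurvature n M) :
    -- the geodesic with initial velocity `v` exists on all of `ℝ` and is unique
    (∀ v : Horosphere.UnitTangentBundle n M, ∃! γ : ℝ → M, Horosphere.IsGeodesicFrom v.1 γ) ∧
    -- the Jacobi field `J_X` exists and is unique
    (∀ (v : Horosphere.UnitTangentBundle n M) (γ : ℝ → M), Horosphere.IsGeodesicFrom v.1 γ →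
      ∀ X : Horosphere.normalSpace v, ∃! J : ∀ t, TangentSpace (𝓡 n) (γ t),
        Horosphere.IsBoundedJacobiField γ (X : TangentSpace (𝓡 n) v.1.proj) J) ∧
    -- the form is bilinear, symmetric, and restricts to the given quadratic form on the diagonal
    (∀ v : Horosphere.UnitTangentBundle n M,
      IsBilinearMap ℝ (Horosphere.horosphereForm v) ∧
      (∀ X Y, Horosphere.horosphereForm v X Y = Horosphere.horosphereForm v Y X) ∧
      (∀ X, Horosphere.horosphereForm v X X = Horosphere.horosphereQuad v X)) ∧
    -- it is positive semidefinite in the direction of `v`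
    (∀ (v : Horosphere.UnitTangentBundle n M) (X : Horosphere.normalSpace v),
      0 ≤ ⟪Horosphere.horosphereForm v X X, v.1.2⟫) ∧
    -- it depends continuously on `v`
    (∀ (U : Set (Horosphere.UnitTangentBundle n M)), IsOpen U →
      ∀ X Y : ∀ v : Horosphere.UnitTangentBundle n M, Horosphere.normalSpace v,
        ContinuousOn (fun v => (⟨v.1.proj, (X v : TangentSpace (𝓡 n) v.1.proj)⟩ :
          TangentBundle (𝓡 n) M)) U →
        ContinuousOn (fun v => (⟨v.1.proj, (Y v : TangentSpace (𝓡 n) v.1.proj)⟩ :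
          TangentBundle (𝓡 n) M)) U →
        ContinuousOn (fun v => ⟪Horosphere.horosphereForm v (X v) (Y v), v.1.2⟫) U) := by
  refine ⟨fun v => Horosphere.existsUnique_isGeodesicFrom v.1, fun v γ hγ X =>
    Horosphere.existsUnique_isBoundedJacobiField hK hγ.1 hγ.2 X.1, fun v => ⟨⟨?_, ?_, ?_, ?_⟩,
      ?_, ?_⟩, ?_, ?_⟩
  · intro X₁ X₂ Y
    simp only [Horosphere.horosphereForm_eq hK, Submodule.coe_add, Horosphere.stableDeriv_add hK,
      inner_add_left, inner_add_right]
    module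
  · intro a X Y
    simp only [Horosphere.horosphereForm_eq hK, Submodule.coe_smul,
      Horosphere.stableDeriv_smul hK, real_inner_smul_left, real_inner_smul_right]
    module
  · intro X Y₁ Y₂
    simp only [Horosphere.horosphereForm_eq hK, Submodule.coe_add, Horosphere.stableDeriv_add hK,
      inner_add_left, inner_add_right]
    module
  · intro a X Y
    simp only [Horosphere.horosphereForm_eq hK, Submodule.coe_smul,
      Horosphere.stableDeriv_smul hK, real_inner_smul_left, real_inner_smul_right]
    module
  · intro X Y
    rw [Horosphere.horosphereForm_eq hK, Horosphere.horosphereForm_eq hK, add_comm]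
  · intro X
    rw [Horosphere.horosphereForm_eq hK, Horosphere.horosphereQuad_eq hK]
    module
  · intro v X
    rw [Horosphere.horosphereForm_eq hK, real_inner_smul_left, real_inner_self_eq_norm_sq, v.2]
    linarith [Horosphere.inner_stableDeriv_nonpos hK v.1.proj v.1.2 X.1]
  · intro U _ X Y hX hY v hv
    have hw : ContinuousWithinAt (fun v : Horosphere.UnitTangentBundle n M =>
        (⟨v.1.proj, v.1.2⟩ : TangentBundle (𝓡 n) M)) U v :=
      continuous_subtype_val.continuousWithinAt
    have hSX := Horosphere.continuousWithinAt_stableDeriv hK hv hw (hX v hv)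
    have hSY := Horosphere.continuousWithinAt_stableDeriv hK hv hw (hY v hv)
    -- As `v` is a unit vector, pairing the form with it leaves `-½ (⟨S X, Y⟩ + ⟨S Y, X⟩)`, which
    -- consists of inner products of continuous sections.
    refine (((hSX.inner_bundle (hY v hv)).add (hSY.inner_bundle (hX v hv))).const_mul
      (-(1 / 2))).congr_of_mem (fun u _ => ?_) hv
    rw [Horosphere.horosphereForm_eq hK, real_inner_smul_left, real_inner_self_eq_norm_sq, u.2,
      one_pow, mul_one]
    rfl
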